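/- All algebras are over $\mathbb{Q}$ and graded by $\mathbb{N}$; $\Lambda V$ is the free graded commutative algebra on a graded vector space $V$. For a commutative differential graded algebra (cdga) $(\Lambda V,d)$ let $\mu_{\Lambda V}:\Lambda V\otimes\Lambda V\to\Lambda V$ be the multiplication and let $\rho_k:\Lambda V\otimes\Lambda V\to(\Lambda V\otimes\Lambda V)/(\ker\mu_{\Lambda V})^{k+1}$ be the projection. Then $\mathrm{TC}(\Lambda V)$ denotes the least $k$ such that $\rho_k$ admits a homotopy retraction, that is, such that there are a relative Sullivan model $\Lambda V\otimes\Lambda V\stackrel{i}{\hookrightarrow}\Lambda V\otimes\Lambda V\otimes\Lambda Z\stackrel{\xi}{\to}(\Lambda V\otimes\Lambda V)/(\ker\mu_{\Lambda V})^{k+1}$ of $\rho_k$ ($i$ a KS-extension, $\xi$ a quasi-isomorphism, $\xi i=\rho_k$) and a cdga morphism $r:\Lambda V\otimes\Lambda V\otimes\Lambda Z\to\Lambda V\otimes\Lambda V$ with $r\circ i=\mathrm{id}$ (and $\mathrm{TC}(\Lambda V)=\infty$ if there is no such $k$). Let $(\Lambda W,d)=(\Lambda(x_1,\dots,x_n,u_1,\dots,u_n,y_1,\dots,y_m),d)$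 be a cdga with $n\ge1$, $m>1$, where the $x_i$ have positive even degrees, the $u_i$ and $y_j$ have odd degrees, $dx_i=0$, $du_i=x_i^2$, and each $dy_j$ is a quadratic polynomial in $x_1,\dots,x_n$. 1. If $dy_1\in\Lambda(x_1,\dots,x_{n-1})$ and, for every $j\ge2$, $dy_j=x_n\sum_i\alpha^j_ix_i$ with $\alpha^j_i\in\mathbb{Q}$, then $\mathrm{TC}(\Lambda W)=\dim W=2n+m$. 2. If $n=2$, then $\mathrm{TC}(\Lambda W)=m+4$. 3. If $n=3$ and there is an element $w$ in the span of the $u_i$ and $y_j$ with $dw=\lambda x_1x_2$, $\lambda\in\mathbb{Q}$, $\lambda\ne0$, then $\mathrm{TC}(\Lambda W)=m+6$. 4. Let $(\Lambda V,d)=(\Lambda(x_1,\dots,x_n,y_1,\dots,y_m),d)$, where the $x_i$ have positive even degrees, the $y_j$ have odd degrees, $dx_i=0$, and each $dy_j$ is a quadratic polynomial in the $x_i$; suppose that $(\Lambda V,d)$ is elliptic, i.e. that $H(\Lambda V,d)$ is finite dimensional. If either $n=2$ and $m>2$, or $n=3$, $m>3$ and some element $w$ in the span of the $y_j$ satisfies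 $dw=\alpha x_1^2+\beta x_1x_2+\gamma x_2^2$ with $\alpha,\beta,\gamma\in\mathbb{Q}$, $\beta\ne0$, then $\mathrm{TC}(\Lambda V)\ge\dim V=n+m$. -/

import Mathlib

/-! Commutative differential graded algebras over `ℚ`, free ones `ΛV`, relative Sullivan models,
and the invariant `TC(ΛV, d)`. -/

namespace RatTC

/-! ### Commutative differential graded algebras -/

/-- A commutative cochain differential graded algebra over `ℚ`, graded by `ℕ`. -/
structure CDGA : Type 1 where
  carrier : Type
  [ring : Ring carrier]
  [algebra : Algebra ℚ carrier]
  gr : ℕ → Submodule ℚ carrier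
  isInternal : DirectSum.IsInternal gr
  one_mem : (1 : carrier) ∈ gr 0
  mul_mem : ∀ {p q : ℕ} {a b : carrier}, a ∈ gr p → b ∈ gr q → a * b ∈ gr (p + q)
  comm : ∀ {p q : ℕ} {a b : carrier}, a ∈ gr p → b ∈ gr q →
    a * b = ((-1 : ℚ) ^ (p * q)) • (b * a)
  d : carrier →ₗ[ℚ] carrier
  d_mem : ∀ {p : ℕ} {a : carrier}, a ∈ gr p → d a ∈ gr (p + 1)
  d_d : ∀ a : carrier, d (d a) = 0
  leibniz : ∀ {p : ℕ} {a : carrier} (b : carrier), a ∈ gr p →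
    d (a * b) = d a * b + ((-1 : ℚ) ^ p) • (a * d b)

attribute [instance] CDGA.ring CDGA.algebra

/-- Morphisms of cdgas. -/
structure CDGA.Hom (A B : CDGA) where
  toAlgHom : A.carrier →ₐ[ℚ] B.carrier
  map_gr : ∀ {p : ℕ} {a : A.carrier}, a ∈ A.gr p → toAlgHom a ∈ B.gr p
  map_d : ∀ a : A.carrier, toAlgHom (A.d a) = B.d (toAlgHom a)

/-- The cocycles of a cdga. -/
def CDGA.cocycles (A : CDGA) : Submodule ℚ A.carrier := LinearMap.ker A.d

/-- The coboundaries of a cdga, as a subspace of the cocycles. -/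
def CDGA.coboundaries (A : CDGA) : Submodule ℚ A.cocycles :=
  (LinearMap.range A.d).comap A.cocycles.subtype

/-- The (total) cohomology `H(A, d) = ker d / im d`. -/
abbrev CDGA.Cohomology (A : CDGA) : Type := A.cocycles ⧸ A.coboundaries

/-- The map induced by a morphism on cocycles. -/
def CDGA.Hom.onCocycles {A B : CDGA} (f : A.Hom B) : A.cocycles →ₗ[ℚ] B.cocycles :=
  (f.toAlgHom.toLinearMap.domRestrict A.cocycles).codRestrict B.cocycles (by
    rintro ⟨a, ha⟩
    have h : A.d a = 0 := ha
    change B.d (f.toAlgHom a) = 0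
    rw [← f.map_d, h, map_zero])

/-- The map induced by a morphism in cohomology. -/
def CDGA.Hom.onCohomology {A B : CDGA} (f : A.Hom B) : A.Cohomology →ₗ[ℚ] B.Cohomology :=
  A.coboundaries.mapQ B.coboundaries f.onCocycles (by
    rintro ⟨a, ha⟩ ⟨c, hc⟩
    exact ⟨f.toAlgHom c, (f.map_d c).symm.trans (congrArg f.toAlgHom hc)⟩)

/-- Quasi-isomorphisms: morphisms inducing an isomorphism in cohomology. -/
def CDGA.Hom.QuasiIso {A B : CDGA} (f : A.Hom B) : Prop := Function.Bijective f.onCohomology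

/-- A direct sum decomposition, from projections. -/
theorem isInternal_of_proj {M : Type} [AddCommGroup M] [Module ℚ M] (S : ℕ → Submodule ℚ M)
    (π : ℕ → M →ₗ[ℚ] M) (h1 : ∀ p, ∀ a ∈ S p, π p a = a)
    (h0 : ∀ p q, p ≠ q → ∀ a ∈ S q, π p a = 0) (hS : ⨆ p, S p = ⊤) :
    DirectSum.IsInternal S := by
  refine ⟨(injective_iff_map_eq_zero (DirectSum.coeAddMonoidHom S)).2 fun x hx => ?_, ?_⟩
  · have key : ∀ (p : ℕ) (y : DirectSum ℕ fun i => S i),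
        π p (DirectSum.coeAddMonoidHom S y) = y p := by
      intro p y
      induction y using DirectSum.induction_on with
      | zero => simp
      | of q a =>
        rw [DirectSum.coeAddMonoidHom_of]
        by_cases h : p = q
        · subst h; rw [DirectSum.of_eq_same]; exact h1 _ _ a.2
        · rw [DirectSum.of_eq_of_ne _ _ _ h]; exact h0 _ _ h _ a.2
      | add a b ha hb => rw [map_add, map_add, ha, hb]; rfl
    refine DFinsupp.ext fun p => Subtype.ext ?_
    rw [← key p x, hx, map_zero]; rfl
  · have h : LinearMap.range (DirectSum.coeLinearMap S) = ⊤ := by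
      rw [DirectSum.range_coeLinearMap, hS]
    exact LinearMap.range_eq_top.1 h

/-- The projection of a cdga onto its component of degree `p`. -/
noncomputable def CDGA.proj (A : CDGA) (p : ℕ) : A.carrier →ₗ[ℚ] A.carrier :=
  (A.gr p).subtype ∘ₗ DirectSum.component ℚ ℕ (fun i => A.gr i) p ∘ₗ
    (LinearEquiv.ofBijective (DirectSum.coeLinearMap A.gr) A.isInternal).symm.toLinearMap

theorem CDGA.proj_same (A : CDGA) {p : ℕ} {a : A.carrier} (ha : a ∈ A.gr p) :
    A.proj p a = a :=
  congrArg Subtype.val (A.isInternal.ofBijective_coeLinearMap_same ⟨a, ha⟩)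

theorem CDGA.proj_ne (A : CDGA) {p q : ℕ} (h : p ≠ q) {a : A.carrier} (ha : a ∈ A.gr q) :
    A.proj p a = 0 :=
  congrArg Subtype.val (A.isInternal.ofBijective_coeLinearMap_of_ne (Ne.symm h) ⟨a, ha⟩)

theorem CDGA.iSup_gr (A : CDGA) : ⨆ p, A.gr p = ⊤ := A.isInternal.submodule_iSup_eq_top

/-- A differential graded ideal: every element is a sum of homogeneous elements of the ideal, and
the ideal is stable under the differential. -/
structure CDGA.IsDGIdeal (A : CDGA) (I : Ideal A.carrier) : Prop where
  homogeneous : I.restrictScalars ℚ ≤ ⨆ p, I.restrictScalars ℚ ⊓ A.gr p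
  d_mem : ∀ a ∈ I, A.d a ∈ I

theorem CDGA.IsDGIdeal.proj_mem {A : CDGA} {I : Ideal A.carrier} (hI : A.IsDGIdeal I) (p : ℕ)
    {a : A.carrier} (ha : a ∈ I) : A.proj p a ∈ I := by
  have h : (⨆ p, I.restrictScalars ℚ ⊓ A.gr p) ≤
      (I.restrictScalars ℚ).comap (A.proj p) := by
    refine iSup_le fun q => ?_
    rintro b ⟨hb, hq⟩
    by_cases h : p = q
    · subst h; simpa [A.proj_same hq] using hb
    · simp [A.proj_ne h hq]
  exact h (hI.homogeneous ha)

/-- The kernel of a morphism is a differential graded ideal. -/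
theorem CDGA.Hom.isDGIdeal_ker {A B : CDGA} (f : A.Hom B) :
    A.IsDGIdeal (RingHom.ker f.toAlgHom) := by
  constructor
  · intro a ha
    have hp : ∀ (p : ℕ) (c : A.carrier),
        f.toAlgHom (A.proj p c) = B.proj p (f.toAlgHom c) := by
      intro p c
      have hc : c ∈ ⨆ p, A.gr p := by rw [A.iSup_gr]; trivial
      induction hc using Submodule.iSup_induction' with
      | mem q x hx =>
        by_cases h : p = q
        · subst h; rw [A.proj_same hx, B.proj_same (f.map_gr hx)]
        · rw [A.proj_ne h hx, B.proj_ne h (f.map_gr hx), map_zero]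
      | zero => simp
      | add x y _ _ hx hy => simp only [map_add, hx, hy]
    have hs : ∀ c : A.carrier, c ∈ ⨆ p, Submodule.span ℚ {A.proj p c} := by
      classical
      intro c
      set e := LinearEquiv.ofBijective (DirectSum.coeLinearMap A.gr) A.isInternal with he
      have h1 : c = DirectSum.coeLinearMap A.gr (e.symm c) := (e.apply_symm_apply c).symm
      have h2 : DirectSum.coeLinearMap A.gr (e.symm c) =
          ∑ i ∈ DFinsupp.support (e.symm c), ((e.symm c) i : A.carrier) := by
        rw [DirectSum.coeLinearMap_eq_dfinsuppSum]
        rfl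
      have h3 : c = ∑ i ∈ DFinsupp.support (e.symm c), A.proj i c := h1.trans h2
      nth_rewrite 2 [h3]
      exact Submodule.sum_mem _ fun i _ =>
        Submodule.mem_iSup_of_mem i (Submodule.mem_span_singleton_self _)
    refine (iSup_mono fun p => ?_ :
      (⨆ p, Submodule.span ℚ {A.proj p a}) ≤ _) (hs a)
    rw [Submodule.span_singleton_le_iff_mem]
    have h0 : f.toAlgHom a = 0 := ha
    refine ⟨?_, Subtype.property _⟩
    change f.toAlgHom (A.proj p a) = 0
    rw [hp, h0, map_zero]
  · intro a ha
    have h : f.toAlgHom a = 0 := ha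
    change f.toAlgHom (A.d a) = 0
    rw [f.map_d, h, map_zero]

theorem CDGA.IsDGIdeal.mul {A : CDGA} {I J : Ideal A.carrier} [I.IsTwoSided] [J.IsTwoSided]
    (hI : A.IsDGIdeal I) (hJ : A.IsDGIdeal J) : A.IsDGIdeal (I * J) := by
  have key : ∀ x ∈ I * J, x ∈ (⨆ p, (I * J).restrictScalars ℚ ⊓ A.gr p) ⊓
      ((I * J).restrictScalars ℚ).comap A.d := by
    intro x hx
    refine Submodule.mul_induction_on hx ?_ fun a b ha hb => Submodule.add_mem _ ha hb
    intro a ha b hb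
    have ha' := hI.homogeneous ha
    have hb' := hJ.homogeneous hb
    clear ha hb
    induction ha' using Submodule.iSup_induction' with
    | zero => rw [zero_mul]; exact Submodule.zero_mem _
    | add a a' _ _ h h' => rw [add_mul]; exact Submodule.add_mem _ h h'
    | mem p a hp =>
      induction hb' using Submodule.iSup_induction' with
      | zero => rw [mul_zero]; exact Submodule.zero_mem _
      | add b b' _ _ h h' => rw [mul_add]; exact Submodule.add_mem _ h h'
      | mem q b hq =>
        refine ⟨Submodule.mem_iSup_of_mem (p + q)
          ⟨Ideal.mul_mem_mul hp.1 hq.1, A.mul_mem hp.2 hq.2⟩, ?_⟩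
        change A.d (a * b) ∈ (I * J).restrictScalars ℚ
        rw [A.leibniz b hp.2]
        exact Submodule.add_mem _ (Ideal.mul_mem_mul (hI.d_mem a hp.1) hq.1)
          (Submodule.smul_mem _ _ (Ideal.mul_mem_mul hp.1 (hJ.d_mem b hq.1)))
  exact ⟨fun x hx => (key x hx).1, fun x hx => (key x hx).2⟩

theorem CDGA.IsDGIdeal.pow_succ {A : CDGA} {I : Ideal A.carrier} [I.IsTwoSided]
    (hI : A.IsDGIdeal I) (m : ℕ) : A.IsDGIdeal (I ^ (m + 1)) := by
  induction m with
  | zero => rw [zero_add, Submodule.pow_one]; exact hI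
  | succ m ih => rw [Submodule.pow_succ]; exact ih.mul hI

/-- The differential induced on the quotient by a differential graded ideal. -/
def CDGA.quotD (A : CDGA) (I : Ideal A.carrier) (hI : A.IsDGIdeal I) :
    (A.carrier ⧸ I) →ₗ[ℚ] (A.carrier ⧸ I) :=
  (Submodule.Quotient.restrictScalarsEquiv ℚ I).toLinearMap ∘ₗ
    (I.restrictScalars ℚ).mapQ (I.restrictScalars ℚ) A.d (fun a ha => hI.d_mem a ha) ∘ₗ
    (Submodule.Quotient.restrictScalarsEquiv ℚ I).symm.toLinearMap

/-- The quotient `(A / I, d̄)` of a cdga by a differential graded ideal. -/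
def CDGA.quot (A : CDGA) (I : Ideal A.carrier) [I.IsTwoSided] (hI : A.IsDGIdeal I) : CDGA where
  carrier := A.carrier ⧸ I
  gr p := (A.gr p).map (Ideal.Quotient.mkₐ ℚ I).toLinearMap
  isInternal := by
    let e := Submodule.Quotient.restrictScalarsEquiv ℚ I
    refine isInternal_of_proj _ (fun p => e.toLinearMap ∘ₗ
      (I.restrictScalars ℚ).mapQ (I.restrictScalars ℚ) (A.proj p)
        (fun a ha => hI.proj_mem p ha) ∘ₗ e.symm.toLinearMap) ?_ ?_ ?_
    · rintro p _ ⟨a, ha, rfl⟩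
      exact congrArg (Ideal.Quotient.mk I) (A.proj_same ha)
    · rintro p q h _ ⟨a, ha, rfl⟩
      exact (congrArg (Ideal.Quotient.mk I) (A.proj_ne h ha)).trans (map_zero _)
    · rw [← Submodule.map_iSup, A.iSup_gr, Submodule.map_top]
      exact LinearMap.range_eq_top.2 (Ideal.Quotient.mkₐ_surjective ℚ I)
  one_mem := ⟨1, A.one_mem, map_one (Ideal.Quotient.mkₐ ℚ I)⟩
  mul_mem := by
    rintro p q _ _ ⟨a, ha, rfl⟩ ⟨b, hb, rfl⟩
    exact ⟨a * b, A.mul_mem ha hb, map_mul (Ideal.Quotient.mkₐ ℚ I) a b⟩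
  comm := by
    rintro p q _ _ ⟨a, ha, rfl⟩ ⟨b, hb, rfl⟩
    have h := congrArg (Ideal.Quotient.mkₐ ℚ I) (A.comm ha hb)
    rwa [map_smul, map_mul, map_mul] at h
  d := A.quotD I hI
  d_mem := by
    rintro p _ ⟨a, ha, rfl⟩
    exact ⟨A.d a, A.d_mem ha, rfl⟩
  d_d := by
    intro x
    obtain ⟨a, rfl⟩ := Ideal.Quotient.mk_surjective x
    exact (congrArg (Ideal.Quotient.mk I) (A.d_d a)).trans (map_zero _)
  leibniz := by
    rintro p _ x ⟨a, ha, rfl⟩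
    obtain ⟨b, rfl⟩ := Ideal.Quotient.mk_surjective x
    have h := congrArg (Ideal.Quotient.mkₐ ℚ I) (A.leibniz b ha)
    rw [map_add, map_smul, map_mul (Ideal.Quotient.mkₐ ℚ I) (A.d a),
      map_mul (Ideal.Quotient.mkₐ ℚ I) a] at h
    exact h

/-- The projection `A → A / I`. -/
def CDGA.quotHom (A : CDGA) (I : Ideal A.carrier) [I.IsTwoSided] (hI : A.IsDGIdeal I) :
    A.Hom (A.quot I hI) where
  toAlgHom := Ideal.Quotient.mkₐ ℚ I
  map_gr := fun ha => ⟨_, ha, rfl⟩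
  map_d := fun _ => rfl

/-! ### Free graded commutative algebras -/

section Free

variable {ι κ : Type}

/-- The relations `v w = (-1)^{|v||w|} w v`; over `ℚ` they include `v² = 0` for `v` odd. -/
inductive FreeCGA.Rel (deg : ι → ℕ) : FreeAlgebra ℚ ι → FreeAlgebra ℚ ι → Prop
  | comm (i j : ι) : FreeCGA.Rel deg (FreeAlgebra.ι ℚ i * FreeAlgebra.ι ℚ j)
      (((-1 : ℚ) ^ (deg i * deg j)) • (FreeAlgebra.ι ℚ j * FreeAlgebra.ι ℚ i))

/-- The free graded commutative `ℚ`-algebra `ΛV` on the graded vector space `V` with homogeneous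
basis indexed by `ι`, the basis element `i` having degree `deg i`. -/
def FreeCGA (deg : ι → ℕ) : Type := RingQuot (FreeCGA.Rel deg)

noncomputable instance (deg : ι → ℕ) : Ring (FreeCGA deg) :=
  inferInstanceAs (Ring (RingQuot (FreeCGA.Rel deg)))

noncomputable instance (deg : ι → ℕ) : Algebra ℚ (FreeCGA deg) :=
  inferInstanceAs (Algebra ℚ (RingQuot (FreeCGA.Rel deg)))

namespace FreeCGA

/-- The generators of `ΛV`. -/
noncomputable def gen (deg : ι → ℕ) (i : ι) : FreeCGA deg :=
  RingQuot.mkAlgHom ℚ (Rel deg) (FreeAlgebra.ι ℚ i)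

theorem gen_comm (deg : ι → ℕ) (i j : ι) :
    gen deg i * gen deg j = ((-1 : ℚ) ^ (deg i * deg j)) • (gen deg j * gen deg i) := by
  have h := RingQuot.mkAlgHom_rel ℚ (Rel.comm (deg := deg) i j)
  rw [map_smul, map_mul, map_mul] at h
  exact h

/-- The universal property of `ΛV`. -/
noncomputable def lift (deg : ι → ℕ) {A : Type} [Ring A] [Algebra ℚ A] (f : ι → A)
    (hf : ∀ i j, f i * f j = ((-1 : ℚ) ^ (deg i * deg j)) • (f j * f i)) :
    FreeCGA deg →ₐ[ℚ] A :=
  RingQuot.liftAlgHom ℚ ⟨FreeAlgebra.lift ℚ f, by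
    rintro _ _ ⟨i, j⟩
    simpa using hf i j⟩

theorem lift_gen (deg : ι → ℕ) {A : Type} [Ring A] [Algebra ℚ A] (f : ι → A)
    (hf : ∀ i j, f i * f j = ((-1 : ℚ) ^ (deg i * deg j)) • (f j * f i)) (i : ι) :
    lift deg f hf (gen deg i) = f i := by
  have h := RingQuot.liftAlgHom_mkAlgHom_apply ℚ (FreeAlgebra.lift ℚ f)
    (s := Rel deg) (by rintro _ _ ⟨i, j⟩; simpa using hf i j) (FreeAlgebra.ι ℚ i)
  exact h.trans (by simp)

/-- The word (product of generators) given by a list of indices. -/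
noncomputable def word (deg : ι → ℕ) (l : List ι) : FreeCGA deg := (l.map (gen deg)).prod

/-- The subspace of elements of degree `p`, spanned by the words of total degree `p`. -/
noncomputable def homog (deg : ι → ℕ) (p : ℕ) : Submodule ℚ (FreeCGA deg) :=
  Submodule.span ℚ {a | ∃ l : List ι, (l.map deg).sum = p ∧ word deg l = a}

theorem word_nil (deg : ι → ℕ) : word deg [] = 1 := rfl

theorem word_cons (deg : ι → ℕ) (i : ι) (l : List ι) :
    word deg (i :: l) = gen deg i * word deg l := by simp [word]

theorem word_append (deg : ι → ℕ) (l l' : List ι) :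
    word deg (l ++ l') = word deg l * word deg l' := by simp [word]

theorem word_mem (deg : ι → ℕ) (l : List ι) : word deg l ∈ homog deg (l.map deg).sum :=
  Submodule.subset_span ⟨l, rfl, rfl⟩

theorem gen_mem (deg : ι → ℕ) (i : ι) : gen deg i ∈ homog deg (deg i) := by
  have h := word_mem deg [i]
  rw [word_cons, word_nil, mul_one] at h
  simpa using h

theorem one_mem (deg : ι → ℕ) : (1 : FreeCGA deg) ∈ homog deg 0 := word_mem deg []

theorem mul_mem (deg : ι → ℕ) {p q : ℕ} {a b : FreeCGA deg} (ha : a ∈ homog deg p)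
    (hb : b ∈ homog deg q) : a * b ∈ homog deg (p + q) := by
  induction ha using Submodule.span_induction with
  | zero => rw [zero_mul]; exact Submodule.zero_mem _
  | add x y _ _ hx hy => rw [add_mul]; exact Submodule.add_mem _ hx hy
  | smul c x _ hx => rw [smul_mul_assoc]; exact Submodule.smul_mem _ _ hx
  | mem x hx =>
    obtain ⟨l, rfl, rfl⟩ := hx
    induction hb using Submodule.span_induction with
    | zero => rw [mul_zero]; exact Submodule.zero_mem _
    | add x y _ _ hx hy => rw [mul_add]; exact Submodule.add_mem _ hx hy
    | smul c x _ hx => rw [mul_smul_comm]; exact Submodule.smul_mem _ _ hx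
    | mem x hx =>
      obtain ⟨l', rfl, rfl⟩ := hx
      exact Submodule.subset_span ⟨l ++ l', by simp, word_append _ _ _⟩

theorem span_word (deg : ι → ℕ) : Submodule.span ℚ (Set.range (word deg)) = ⊤ := by
  rw [eq_top_iff]
  rintro x -
  obtain ⟨a, rfl⟩ := RingQuot.mkAlgHom_surjective ℚ (Rel deg) x
  have hone : (1 : FreeCGA deg) ∈ Submodule.span ℚ (Set.range (word deg)) :=
    Submodule.subset_span ⟨[], rfl⟩
  induction a using FreeAlgebra.induction with
  | grade0 r =>
    rw [AlgHom.commutes, Algebra.algebraMap_eq_smul_one]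
    exact Submodule.smul_mem _ _ hone
  | grade1 i => exact Submodule.subset_span ⟨[i], by rw [word_cons, word_nil, mul_one]; rfl⟩
  | add a b ha hb => rw [map_add]; exact Submodule.add_mem _ ha hb
  | mul a b ha hb =>
    rw [map_mul]
    generalize RingQuot.mkAlgHom ℚ (Rel deg) a = a' at ha
    generalize RingQuot.mkAlgHom ℚ (Rel deg) b = b' at hb
    have h := Submodule.mul_mem_mul (R := ℚ) (A := FreeCGA deg) ha hb
    rw [Submodule.span_mul_span] at h
    refine Submodule.span_mono ?_ h
    rintro _ ⟨_, ⟨l, rfl⟩, _, ⟨l', rfl⟩, rfl⟩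
    exact ⟨l ++ l', word_append _ _ _⟩

/-- Two linear maps which agree on words are equal. -/
theorem ext_word (deg : ι → ℕ) {M : Type} [AddCommGroup M] [Module ℚ M]
    {f g : FreeCGA deg →ₗ[ℚ] M} (h : ∀ l, f (word deg l) = g (word deg l)) (a : FreeCGA deg) :
    f a = g a := by
  have : f = g := LinearMap.ext_on (span_word deg) (by rintro _ ⟨l, rfl⟩; exact h l)
  rw [this]

theorem comm_gen (deg : ι → ℕ) {p : ℕ} {a : FreeCGA deg} (ha : a ∈ homog deg p) (i : ι) :
    a * gen deg i = ((-1 : ℚ) ^ (p * deg i)) • (gen deg i * a) := by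
  induction ha using Submodule.span_induction with
  | zero => simp
  | add x y _ _ hx hy => rw [add_mul, mul_add, hx, hy, smul_add]
  | smul c x _ hx => rw [smul_mul_assoc, hx, mul_smul_comm, smul_comm]
  | mem x hx =>
    obtain ⟨l, rfl, rfl⟩ := hx
    induction l with
    | nil => simp [word_nil]
    | cons j l ih =>
      rw [word_cons, mul_assoc, ih, mul_smul_comm, ← mul_assoc, gen_comm deg j i,
        smul_mul_assoc, smul_smul, mul_assoc, ← pow_add]
      congr 2
      simp only [List.map_cons, List.sum_cons]
      ring

theorem comm (deg : ι → ℕ) {p q : ℕ} {a b : FreeCGA deg} (ha : a ∈ homog deg p)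
    (hb : b ∈ homog deg q) : a * b = ((-1 : ℚ) ^ (p * q)) • (b * a) := by
  induction hb using Submodule.span_induction with
  | zero => simp
  | add x y _ _ hx hy => rw [add_mul, mul_add, hx, hy, smul_add]
  | smul c x _ hx => rw [smul_mul_assoc, mul_smul_comm, hx, smul_comm]
  | mem x hx =>
    obtain ⟨l, rfl, rfl⟩ := hx
    induction l with
    | nil => simp [word_nil]
    | cons j l ih =>
      rw [word_cons, ← mul_assoc, comm_gen deg ha j, smul_mul_assoc, mul_assoc, ih,
        mul_smul_comm, smul_smul, mul_assoc, ← pow_add]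
      congr 2
      simp only [List.map_cons, List.sum_cons]
      ring

theorem isInternal (deg : ι → ℕ) : DirectSum.IsInternal (homog deg) := by
  let Φ : FreeCGA deg →ₐ[ℚ] Polynomial (FreeCGA deg) :=
    lift deg (fun i => Polynomial.monomial (deg i) (gen deg i)) (by
      intro i j
      rw [Polynomial.monomial_mul_monomial, Polynomial.monomial_mul_monomial, gen_comm,
        Polynomial.smul_monomial, add_comm])
  have hΦ : ∀ l, Φ (word deg l) = Polynomial.monomial (l.map deg).sum (word deg l) := by
    intro l
    induction l with
    | nil => simp [word_nil]
    | cons i l ih =>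
      rw [word_cons, map_mul, ih, lift_gen, Polynomial.monomial_mul_monomial]
      simp
  have hΦ' : ∀ p, ∀ a ∈ homog deg p, Φ a = Polynomial.monomial p a := by
    intro p a ha
    induction ha using Submodule.span_induction with
    | zero => simp
    | add x y _ _ hx hy => rw [map_add, map_add, hx, hy]
    | smul c x _ hx => rw [map_smul, hx, Polynomial.smul_monomial]
    | mem x hx => obtain ⟨l, rfl, rfl⟩ := hx; exact hΦ l
  refine isInternal_of_proj _ (fun p =>
    { toFun := fun a => (Φ a).coeff p
      map_add' := by intro a b; simp
      map_smul' := by intro c a; simp }) ?_ ?_ ?_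
  · intro p a ha
    simp [hΦ' p a ha]
  · intro p q h a ha
    simp [hΦ' q a ha, Polynomial.coeff_monomial, Ne.symm h]
  · rw [eq_top_iff, ← span_word deg, Submodule.span_le]
    rintro _ ⟨l, rfl⟩
    exact Submodule.mem_iSup_of_mem _ (word_mem deg l)

/-- The morphism `ΛV → ΛV'` induced by a degree preserving map between the bases. -/
noncomputable def rename {deg : ι → ℕ} {deg' : κ → ℕ} (e : ι → κ)
    (he : ∀ i, deg' (e i) = deg i) : FreeCGA deg →ₐ[ℚ] FreeCGA deg' :=
  lift deg (fun i => gen deg' (e i)) (by intro i j; rw [gen_comm, he, he])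

theorem rename_word {deg : ι → ℕ} {deg' : κ → ℕ} (e : ι → κ) (he : ∀ i, deg' (e i) = deg i)
    (l : List ι) : rename e he (word deg l) = word deg' (l.map e) := by
  induction l with
  | nil => simp [word_nil]
  | cons i l ih => rw [word_cons, map_mul, ih, List.map_cons, word_cons, rename, lift_gen]

theorem rename_gen {deg : ι → ℕ} {deg' : κ → ℕ} (e : ι → κ) (he : ∀ i, deg' (e i) = deg i)
    (i : ι) : rename e he (gen deg i) = gen deg' (e i) := lift_gen _ _ _ _

theorem rename_mem {deg : ι → ℕ} {deg' : κ → ℕ} (e : ι → κ) (he : ∀ i, deg' (e i) = deg i)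
    {p : ℕ} {a : FreeCGA deg} (ha : a ∈ homog deg p) : rename e he a ∈ homog deg' p := by
  induction ha using Submodule.span_induction with
  | zero => rw [map_zero]; exact Submodule.zero_mem _
  | add x y _ _ hx hy => rw [map_add]; exact Submodule.add_mem _ hx hy
  | smul c x _ hx => rw [map_smul]; exact Submodule.smul_mem _ _ hx
  | mem x hx =>
    obtain ⟨l, rfl, rfl⟩ := hx
    rw [rename_word]
    refine Submodule.subset_span ⟨l.map e, ?_, rfl⟩
    rw [List.map_map]
    congr 1
    exact List.map_congr_left fun i _ => he i

end FreeCGA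

open FreeCGA

/-! ### Differentials on `ΛV` -/

/-- A differential on `ΛV`: a derivation of degree `+1` and square zero. -/
structure Differential (deg : ι → ℕ) where
  toLin : FreeCGA deg →ₗ[ℚ] FreeCGA deg
  mem : ∀ {p : ℕ} {a : FreeCGA deg}, a ∈ homog deg p → toLin a ∈ homog deg (p + 1)
  sq : ∀ a : FreeCGA deg, toLin (toLin a) = 0
  leibniz : ∀ {p : ℕ} {a : FreeCGA deg} (b : FreeCGA deg), a ∈ homog deg p →
    toLin (a * b) = toLin a * b + ((-1 : ℚ) ^ p) • (a * toLin b)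

/-- The cdga `(ΛV, d)`. -/
noncomputable def free {deg : ι → ℕ} (d : Differential deg) : CDGA where
  carrier := FreeCGA deg
  gr := homog deg
  isInternal := FreeCGA.isInternal deg
  one_mem := FreeCGA.one_mem deg
  mul_mem := FreeCGA.mul_mem deg
  comm := FreeCGA.comm deg
  d := d.toLin
  d_mem := d.mem
  d_d := d.sq
  leibniz := d.leibniz

/-- The algebra map `a ↦ !![± a, D a; 0, a]` behind the derivation `D` with values `f` on
generators. -/
noncomputable def derivAux (deg : ι → ℕ) (f : ι → FreeCGA deg)
    (hf : ∀ i, f i ∈ homog deg (deg i + 1)) :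
    FreeCGA deg →ₐ[ℚ] Matrix (Fin 2) (Fin 2) (FreeCGA deg) :=
  lift deg (fun i => !![((-1 : ℚ) ^ deg i) • gen deg i, f i; 0, gen deg i]) (by
    intro i j
    have h1 := gen_comm deg i j
    have h2 := comm_gen deg (hf i) j
    have h3 := FreeCGA.comm deg (gen_mem deg i) (hf j)
    ext a b
    fin_cases a <;> fin_cases b
    · simp [h1, smul_smul]
      ring_nf
    · simp only [Matrix.mul_fin_two, Matrix.smul_apply]
      simp [h2, h3, smul_smul, add_mul, mul_add, pow_add, ← mul_assoc]
      rw [add_comm, mul_comm (_ ^ (deg i * deg j)) (_ ^ deg j), mul_right_comm, ← mul_pow]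
      simp [mul_comm]
    · simp
    · simpa using h1)

/-- The derivation of `ΛV` with prescribed values on generators. -/
noncomputable def derivation (deg : ι → ℕ) (f : ι → FreeCGA deg)
    (hf : ∀ i, f i ∈ homog deg (deg i + 1)) : FreeCGA deg →ₗ[ℚ] FreeCGA deg where
  toFun a := derivAux deg f hf a 0 1
  map_add' := by intro a b; simp
  map_smul' := by intro c a; simp


theorem derivAux_gen (deg : ι → ℕ) (f : ι → FreeCGA deg)
    (hf : ∀ i, f i ∈ homog deg (deg i + 1)) (i : ι) :
    derivAux deg f hf (gen deg i) =
      !![((-1 : ℚ) ^ deg i) • gen deg i, f i; 0, gen deg i] := lift_gen _ _ _ _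

theorem derivAux_word (deg : ι → ℕ) (f : ι → FreeCGA deg)
    (hf : ∀ i, f i ∈ homog deg (deg i + 1)) (l : List ι) :
    derivAux deg f hf (word deg l) 0 0 = ((-1 : ℚ) ^ (l.map deg).sum) • word deg l ∧
    derivAux deg f hf (word deg l) 1 1 = word deg l ∧
    derivAux deg f hf (word deg l) 1 0 = 0 := by
  induction l with
  | nil => simp [word_nil]
  | cons i l ih =>
    rw [word_cons, map_mul, derivAux_gen]
    simp [Matrix.mul_apply, Fin.sum_univ_two, ih.1, ih.2, smul_smul, pow_add, mul_comm]

theorem derivation_gen (deg : ι → ℕ) (f : ι → FreeCGA deg)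
    (hf : ∀ i, f i ∈ homog deg (deg i + 1)) (i : ι) : derivation deg f hf (gen deg i) = f i := by
  change derivAux deg f hf (gen deg i) 0 1 = f i
  rw [derivAux_gen]; rfl

theorem derivation_leibniz (deg : ι → ℕ) (f : ι → FreeCGA deg)
    (hf : ∀ i, f i ∈ homog deg (deg i + 1)) {p : ℕ} {a : FreeCGA deg} (b : FreeCGA deg)
    (ha : a ∈ homog deg p) :
    derivation deg f hf (a * b) =
      derivation deg f hf a * b + ((-1 : ℚ) ^ p) • (a * derivation deg f hf b) := by
  have h11 : derivAux deg f hf b 1 1 = b :=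
    ext_word deg (f := { toFun := fun a => derivAux deg f hf a 1 1
                         map_add' := by intro a b; simp
                         map_smul' := by intro c a; simp })
      (g := LinearMap.id) (fun l => (derivAux_word deg f hf l).2.1) b
  have h00 : derivAux deg f hf a 0 0 = ((-1 : ℚ) ^ p) • a := by
    induction ha using Submodule.span_induction with
    | zero => simp
    | add x y _ _ hx hy => rw [map_add, Matrix.add_apply, hx, hy, smul_add]
    | smul c x _ hx => rw [map_smul, Matrix.smul_apply, hx, smul_comm]
    | mem x hx => obtain ⟨l, rfl, rfl⟩ := hx; exact (derivAux_word deg f hf l).1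
  change derivAux deg f hf (a * b) 0 1 = derivAux deg f hf a 0 1 * b + _ • (a * _)
  rw [map_mul, Matrix.mul_apply, Fin.sum_univ_two, h11, h00, add_comm, smul_mul_assoc]
  rfl

theorem derivation_one (deg : ι → ℕ) (f : ι → FreeCGA deg)
    (hf : ∀ i, f i ∈ homog deg (deg i + 1)) : derivation deg f hf 1 = 0 := by
  change derivAux deg f hf 1 0 1 = 0
  rw [map_one]; simp

theorem derivation_mem (deg : ι → ℕ) (f : ι → FreeCGA deg)
    (hf : ∀ i, f i ∈ homog deg (deg i + 1)) {p : ℕ} {a : FreeCGA deg} (ha : a ∈ homog deg p) :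
    derivation deg f hf a ∈ homog deg (p + 1) := by
  induction ha using Submodule.span_induction with
  | zero => rw [map_zero]; exact Submodule.zero_mem _
  | add x y _ _ hx hy => rw [map_add]; exact Submodule.add_mem _ hx hy
  | smul c x _ hx => rw [map_smul]; exact Submodule.smul_mem _ _ hx
  | mem x hx =>
    obtain ⟨l, rfl, rfl⟩ := hx
    induction l with
    | nil => rw [word_nil, derivation_one]; exact Submodule.zero_mem _
    | cons i l ih =>
      rw [word_cons, derivation_leibniz deg f hf _ (gen_mem deg i), derivation_gen]
      refine Submodule.add_mem _ ?_ (Submodule.smul_mem _ _ ?_)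
      · have h := FreeCGA.mul_mem deg (hf i) (word_mem deg l)
        simpa [add_right_comm] using h
      · have h := FreeCGA.mul_mem deg (gen_mem deg i) ih
        simpa [add_assoc] using h

theorem derivation_sq (deg : ι → ℕ) (f : ι → FreeCGA deg)
    (hf : ∀ i, f i ∈ homog deg (deg i + 1)) (h : ∀ i, derivation deg f hf (f i) = 0)
    (a : FreeCGA deg) : derivation deg f hf (derivation deg f hf a) = 0 := by
  refine ext_word deg (f := derivation deg f hf ∘ₗ derivation deg f hf) (g := 0) (fun l => ?_) a
  simp only [LinearMap.comp_apply, LinearMap.zero_apply]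
  induction l with
  | nil => rw [word_nil, derivation_one, map_zero]
  | cons i l ih =>
    rw [word_cons, derivation_leibniz deg f hf _ (gen_mem deg i), derivation_gen, map_add, map_smul,
      derivation_leibniz deg f hf _ (hf i),
      derivation_leibniz deg f hf _ (gen_mem deg i), h, ih, derivation_gen,
      pow_succ]
    simp

/-- The differential of `ΛV` with prescribed values `f` on generators. -/
noncomputable def Differential.ofGen (deg : ι → ℕ) (f : ι → FreeCGA deg)
    (hf : ∀ i, f i ∈ homog deg (deg i + 1)) (h : ∀ i, derivation deg f hf (f i) = 0) :
    Differential deg where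
  toLin := derivation deg f hf
  mem := derivation_mem deg f hf
  sq := derivation_sq deg f hf h
  leibniz := derivation_leibniz deg f hf

/-- An algebra map induced by a map of bases commutes with differentials if it does so on
generators. -/
theorem Differential.rename_comm {deg : ι → ℕ} {deg' : κ → ℕ} (e : ι → κ)
    (he : ∀ i, deg' (e i) = deg i) (d : Differential deg) (D : FreeCGA deg' →ₗ[ℚ] FreeCGA deg')
    (hD1 : D 1 = 0)
    (hD : ∀ {p : ℕ} {a : FreeCGA deg'} (b : FreeCGA deg'), a ∈ homog deg' p →
      D (a * b) = D a * b + ((-1 : ℚ) ^ p) • (a * D b))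
    (h : ∀ i, D (gen deg' (e i)) = rename e he (d.toLin (gen deg i))) (a : FreeCGA deg) :
    D (rename e he a) = rename e he (d.toLin a) := by
  have hd1 : d.toLin 1 = 0 := by
    have h := d.leibniz 1 (FreeCGA.one_mem deg)
    simpa using h
  refine ext_word deg (f := D ∘ₗ (rename e he).toLinearMap)
    (g := (rename e he).toLinearMap ∘ₗ d.toLin) (fun l => ?_) a
  simp only [LinearMap.comp_apply, AlgHom.toLinearMap_apply]
  induction l with
  | nil => rw [word_nil, map_one, hD1, hd1, map_zero]
  | cons i l ih =>
    have hi : gen deg' (e i) ∈ homog deg' (deg i) := he i ▸ gen_mem deg' (e i)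
    rw [word_cons, d.leibniz _ (gen_mem deg i), map_mul (rename e he) (gen deg i),
      rename_gen, hD _ hi, ih, h, map_add, map_smul, map_mul, map_mul, rename_gen]

/-! ### The tensor square `ΛV ⊗ ΛV = Λ(V ⊕ V)` and the multiplication -/

/-- The inclusion `ΛV → ΛV ⊗ ΛV` of the left factor. -/
noncomputable def inLeft (deg : ι → ℕ) : FreeCGA deg →ₐ[ℚ] FreeCGA (Sum.elim deg deg) :=
  rename Sum.inl (fun _ => rfl)

/-- The inclusion `ΛV → ΛV ⊗ ΛV` of the right factor. -/
noncomputable def inRight (deg : ι → ℕ) : FreeCGA deg →ₐ[ℚ] FreeCGA (Sum.elim deg deg) :=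
  rename Sum.inr (fun _ => rfl)

/-- The values on generators of the differential of `ΛV ⊗ ΛV`. -/
noncomputable def sqGen {deg : ι → ℕ} (d : Differential deg) :
    ι ⊕ ι → FreeCGA (Sum.elim deg deg) :=
  Sum.elim (fun i => inLeft deg (d.toLin (gen deg i))) (fun i => inRight deg (d.toLin (gen deg i)))

theorem sqGen_mem {deg : ι → ℕ} (d : Differential deg) (i : ι ⊕ ι) :
    sqGen d i ∈ homog (Sum.elim deg deg) (Sum.elim deg deg i + 1) := by
  rcases i with i | i
  · exact rename_mem _ _ (d.mem (gen_mem deg i))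
  · exact rename_mem _ _ (d.mem (gen_mem deg i))

/-- The differential of `ΛV ⊗ ΛV ≅ Λ(V ⊕ V)`, restricting to `d` on both copies of `ΛV`. -/
noncomputable def tensorSq {deg : ι → ℕ} (d : Differential deg) :
    Differential (Sum.elim deg deg) :=
  Differential.ofGen _ (sqGen d) (sqGen_mem d) (by
    rintro (i | i)
    · have h := d.rename_comm Sum.inl (fun _ => rfl) (derivation _ (sqGen d) (sqGen_mem d))
        (derivation_one _ _ _) (derivation_leibniz _ _ _) (fun i => derivation_gen _ _ _ _)
        (d.toLin (gen deg i))
      exact h.trans ((congrArg _ (d.sq (gen deg i))).trans (map_zero _))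
    · have h := d.rename_comm Sum.inr (fun _ => rfl) (derivation _ (sqGen d) (sqGen_mem d))
        (derivation_one _ _ _) (derivation_leibniz _ _ _) (fun i => derivation_gen _ _ _ _)
        (d.toLin (gen deg i))
      exact h.trans ((congrArg _ (d.sq (gen deg i))).trans (map_zero _)))

/-- The multiplication `μ : ΛV ⊗ ΛV → ΛV`, as a map of algebras. -/
noncomputable def mulAlgHom (deg : ι → ℕ) : FreeCGA (Sum.elim deg deg) →ₐ[ℚ] FreeCGA deg :=
  rename (Sum.elim id id) (by rintro (i | i) <;> rfl)

/-- The multiplication `μ : (ΛV ⊗ ΛV, d) → (ΛV, d)`. -/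
noncomputable def mulHom {deg : ι → ℕ} (d : Differential deg) :
    (free (tensorSq d)).Hom (free d) where
  toAlgHom := mulAlgHom deg
  map_gr := fun ha => rename_mem _ _ ha
  map_d := fun a => by
    have hd1 : d.toLin 1 = 0 := by
      have h := d.leibniz 1 (FreeCGA.one_mem deg)
      simpa using h
    refine ((tensorSq d).rename_comm _ _ d.toLin hd1 d.leibniz ?_ a).symm
    have hl : ∀ (e : ι → ι ⊕ ι) (he : ∀ i, Sum.elim deg deg (e i) = deg i)
        (_ : ∀ i, (Sum.elim id id (e i) : ι) = i) (a : FreeCGA deg),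
        mulAlgHom deg (rename e he a) = a := by
      intro e he h a
      refine ext_word deg (f := (mulAlgHom deg).toLinearMap ∘ₗ (rename e he).toLinearMap)
        (g := LinearMap.id) (fun l => ?_) a
      simp only [LinearMap.comp_apply, AlgHom.toLinearMap_apply, LinearMap.id_apply]
      rw [rename_word, mulAlgHom, rename_word, List.map_map]
      congr 1
      exact (List.map_congr_left fun i _ => h i).trans (List.map_id l)
    rintro (i | i)
    · exact ((congrArg (mulAlgHom deg) (derivation_gen _ _ _ (Sum.inl i))).trans
        (hl Sum.inl (fun _ => rfl) (fun _ => rfl) _)).symm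
    · exact ((congrArg (mulAlgHom deg) (derivation_gen _ _ _ (Sum.inr i))).trans
        (hl Sum.inr (fun _ => rfl) (fun _ => rfl) _)).symm

/-- The ideal `(ker μ)^(m+1)` of `ΛV ⊗ ΛV`. -/
noncomputable def kerPow {deg : ι → ℕ} (d : Differential deg) (m : ℕ) :
    Ideal (free (tensorSq d)).carrier := RingHom.ker (mulHom d).toAlgHom ^ (m + 1)

instance {deg : ι → ℕ} (d : Differential deg) (m : ℕ) : (kerPow d m).IsTwoSided :=
  inferInstanceAs (RingHom.ker (mulHom d).toAlgHom ^ (m + 1)).IsTwoSided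

theorem kerPow_isDGIdeal {deg : ι → ℕ} (d : Differential deg) (m : ℕ) :
    (free (tensorSq d)).IsDGIdeal (kerPow d m) := (mulHom d).isDGIdeal_ker.pow_succ m

/-- The projection `ρ_m : ΛV ⊗ ΛV → (ΛV ⊗ ΛV) / (ker μ)^(m+1)`. -/
noncomputable def rho {deg : ι → ℕ} (d : Differential deg) (m : ℕ) :
    (free (tensorSq d)).Hom ((free (tensorSq d)).quot (kerPow d m) (kerPow_isDGIdeal d m)) :=
  (free (tensorSq d)).quotHom (kerPow d m) (kerPow_isDGIdeal d m)

/-! ### Relative Sullivan models, homotopy retractions and `TC` -/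

/-- The inclusion of algebras `ΛV → ΛV ⊗ ΛZ = Λ(V ⊕ Z)`. -/
noncomputable def baseIncl (deg : ι → ℕ) (degZ : κ → ℕ) :
    FreeCGA deg →ₐ[ℚ] FreeCGA (Sum.elim deg degZ) :=
  rename Sum.inl (fun _ => rfl)

/-- `(ΛV, d) → (ΛV ⊗ ΛZ, D)` is a KS-extension: `D` extends `d`, and the homogeneous basis `κ` of
`Z` carries a height with values in `ℕ`, giving `Z = ⨁ Z(k)`, such that
`D (Z(k)) ⊆ ΛV ⊗ Λ(Z(0) ⊕ ⋯ ⊕ Z(k-1))`. -/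
def IsKSExtension {deg : ι → ℕ} {degZ : κ → ℕ} (d : Differential deg)
    (D : Differential (Sum.elim deg degZ)) : Prop :=
  (∀ a : FreeCGA deg, D.toLin (baseIncl deg degZ a) = baseIncl deg degZ (d.toLin a)) ∧
  ∃ height : κ → ℕ, ∀ z : κ, D.toLin (gen _ (Sum.inr z)) ∈
    Algebra.adjoin ℚ (Set.range (fun i : ι => gen (Sum.elim deg degZ) (Sum.inl i)) ∪
      {a | ∃ z' : κ, height z' < height z ∧ a = gen (Sum.elim deg degZ) (Sum.inr z')})

/-- A morphism `f : (ΛV, d) → B` admits a homotopy retraction: there is a relative Sullivan model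
`ΛV → ΛV ⊗ ΛZ`, `ξ : ΛV ⊗ ΛZ → B` of `f`, where `ξ` is a quasi-isomorphism, and a cdga morphism
`r : ΛV ⊗ ΛZ → ΛV` restricting to the identity on `ΛV`. -/
def HasHomotopyRetraction {deg : ι → ℕ} {d : Differential deg} {B : CDGA}
    (f : (free d).Hom B) : Prop :=
  ∃ (κ : Type) (degZ : κ → ℕ) (D : Differential (Sum.elim deg degZ)),
    IsKSExtension d D ∧
    (∃ ξ : (free D).Hom B, ξ.QuasiIso ∧
      ∀ a : FreeCGA deg, ξ.toAlgHom (baseIncl deg degZ a) = f.toAlgHom a) ∧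
    ∃ r : (free D).Hom (free d), ∀ a : FreeCGA deg, r.toAlgHom (baseIncl deg degZ a) = a

/-- `TC(ΛV, d)`: the least `m` such that `ρ_m` admits a homotopy retraction (`⊤` if there is
none). -/
noncomputable def TC {deg : ι → ℕ} (d : Differential deg) : ℕ∞ :=
  sInf {k | ∃ m : ℕ, HasHomotopyRetraction (rho d m) ∧ k = (m : ℕ∞)}

end Free

/-! ### Pure coformal models and their elliptic extensions -/

/-- A finite dimensional Sullivan algebra `(ΛV, d)` is elliptic if its cohomology is finite
dimensional. -/
def IsElliptic {ι : Type} [Finite ι] {deg : ι → ℕ} (d : Differential deg) : Prop :=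
  FiniteDimensional ℚ (free d).Cohomology

/-- The span of the quadratic monomials `x i * x k` with `i, k ∈ s`. -/
def quadratic {A σ : Type} [Ring A] [Algebra ℚ A] (x : σ → A) (s : Set σ) : Submodule ℚ A :=
  Submodule.span ℚ {q | ∃ i ∈ s, ∃ k ∈ s, q = x i * x k}

section Models

variable {n m : ℕ}

/-- The degrees of the generators `x_1, …, x_n, y_1, …, y_m`. -/
def degV (a : Fin n → ℕ) (b : Fin m → ℕ) : Fin n ⊕ Fin m → ℕ := Sum.elim a b

/-- The degrees of the generators `x_1, …, x_n, u_1, …, u_n, y_1, …, y_m`; as `d u_i = x_i²`, the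
degree of `u_i` is `2 |x_i| - 1`. -/
def degW (a : Fin n → ℕ) (b : Fin m → ℕ) : Fin n ⊕ (Fin n ⊕ Fin m) → ℕ :=
  Sum.elim a (Sum.elim (fun i => 2 * a i - 1) b)

namespace V

/-- The even generators `x_i` of `ΛV`. -/
noncomputable def x (a : Fin n → ℕ) (b : Fin m → ℕ) (i : Fin n) : FreeCGA (degV a b) :=
  FreeCGA.gen (degV a b) (Sum.inl i)

/-- The odd generators `y_j` of `ΛV`. -/
noncomputable def y (a : Fin n → ℕ) (b : Fin m → ℕ) (j : Fin m) : FreeCGA (degV a b) :=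
  FreeCGA.gen (degV a b) (Sum.inr j)

end V

namespace W

/-- The even generators `x_i` of `ΛW`. -/
noncomputable def x (a : Fin n → ℕ) (b : Fin m → ℕ) (i : Fin n) : FreeCGA (degW a b) :=
  FreeCGA.gen (degW a b) (Sum.inl i)

/-- The odd generators `u_i` of `ΛW`. -/
noncomputable def u (a : Fin n → ℕ) (b : Fin m → ℕ) (i : Fin n) : FreeCGA (degW a b) :=
  FreeCGA.gen (degW a b) (Sum.inr (Sum.inl i))

/-- The odd generators `y_j` of `ΛW`. -/
noncomputable def y (a : Fin n → ℕ) (b : Fin m → ℕ) (j : Fin m) : FreeCGA (degW a b) :=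
  FreeCGA.gen (degW a b) (Sum.inr (Sum.inr j))

end W

/-- `(ΛV, d) = (Λ(x_1, …, x_n, y_1, …, y_m), d)` is a pure coformal model: the `x_i` have positive
even degree, the `y_j` have odd degree, `d x_i = 0`, and `d y_j` is quadratic in the `x_i`. -/
structure IsPureCoformal (a : Fin n → ℕ) (b : Fin m → ℕ) (d : Differential (degV a b)) :
    Prop where
  pos : ∀ i, 0 < a i
  even : ∀ i, Even (a i)
  odd : ∀ j, Odd (b j)
  dx : ∀ i, d.toLin (V.x a b i) = 0
  dy : ∀ j, d.toLin (V.y a b j) ∈ quadratic (V.x a b) Set.univ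

/-- `(ΛW, d) = (Λ(x_1, …, x_n, u_1, …, u_n, y_1, …, y_m), d)` is the elliptic extension of a pure
coformal model: moreover `d u_i = x_i²`. -/
structure IsExtension (a : Fin n → ℕ) (b : Fin m → ℕ) (d : Differential (degW a b)) :
    Prop where
  pos : ∀ i, 0 < a i
  even : ∀ i, Even (a i)
  odd : ∀ j, Odd (b j)
  dx : ∀ i, d.toLin (W.x a b i) = 0
  du : ∀ i, d.toLin (W.u a b i) = W.x a b i ^ 2
  dy : ∀ j, d.toLin (W.y a b j) ∈ quadratic (W.x a b) Set.univ

/-- The conditions `d y_1 ∈ Λ(x_1, …, x_{n-1})` (quadratic) and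
`d y_j = x_n · ∑ i, α^j_i x_i` for `j ≥ 2`. With indices starting at `0`, `y_1` is `y 0` and
`x_n` is `x (n - 1)`. -/
structure IsSpecial (hn : 0 < n) (hm : 1 < m) (a : Fin n → ℕ) (b : Fin m → ℕ)
    (d : Differential (degW a b)) : Prop where
  dy_first : d.toLin (W.y a b ⟨0, by omega⟩) ∈ quadratic (W.x a b) {i | (i : ℕ) < n - 1}
  dy_rest : ∀ j : Fin m, 1 ≤ (j : ℕ) → ∃ α : Fin n → ℚ,
    d.toLin (W.y a b j) = W.x a b ⟨n - 1, by omega⟩ * ∑ i, α i • W.x a b i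

end Models

end RatTC

/-! Both bounds rest on the algebra `ΛV ⊗ ΛV = Λ(V ⊕ V)`. Write `x'`, `y'` for the generators of the
second factor, `E` for the set of even generators and `O` for the set of odd ones. In `ΛW` one has
`O = E ⊕ F`, with the `u_i` indexed by `E` and the `y_j` by `F`.

Lower bound for `ΛW`. A homotopy retraction of `ρ_k` forces every cocycle of `(ker μ)^(k+1)` to be
exact (`exact_of_hasHomotopyRetraction`), so it suffices to find a non-exact cocycle in `(ker
μ)^(2n+m)`. The differential is a contraction `∑ q_o(x) ∂_o + q_o(x') ∂'_o` with quadratic forms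
`q_o`. Polarising in `x + x'` and `x - x'` gives `4d = ∑ (x_i + x'_i) S_i + (x_i - x'_i) D_i`, where
the `S_i` and `D_i` are odd derivations that anticommute and have square zero. Hence `∏ S_i D_i`
applied to `∏ y_o y'_o` is killed by every `S_i` and `D_i`, so it is a cocycle
(`tensorSq_topClass`). Each factor `y_o y'_o` lies in `ker μ`, each `D_i` raises the power of `ker
μ` by one and `S_i` does not lower it again, which gives the exponent `|O| + |E| = 2n + m`
(`topClass_mem`). To see that the class is nonzero (`topClass_not_exact`), apply `∏ ∂_f ∂'_f` over
`f` in `F`; this commutes with `d`. What remains of the cocycle is `∏ 4(x_i - x'_i)²` up to sign,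
which is `∏ (-8 x_i x'_i)` modulo squares, whereas boundaries of elements without `y_f`, `y'_f`
project into the ideal of squares.

Upper bound for `ΛW`. The ideal `J` of `ΛW ⊗ ΛW` generated by all `x_i²`, `x'_i²`, `u_i`, `u'_i` is
acyclic by a Koszul argument (`sqIdeal_acyclic`). The kernel of `μ` is generated by the differences
`v - v'`, and modulo `J` the cube of `x - x'`, the first power of `u - u'` and the square of `y -
y'` vanish, so by the pigeonhole principle `(ker μ)^(2n+m+1) ⊆ J` (`kerFil_le_extIdeal`). Whenever
`K` lies in a proper acyclic ideal `J` of `A = ΛV`, with `V` in positive degrees, the projection `A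
→ A/K` has a homotopy retraction: the fibre product of `A` and `A/K` over `A/J` is quasi-isomorphic
to `A/K` and projects onto `A`, and a relative Sullivan model of `A → A ×_{A/J} A/K` does the rest
(`hasHomotopyRetraction_quotHom`). Such models are built by repeatedly killing the cohomology of a
mapping cone (`exists_relativeSullivanModel`).

Lower bound for `ΛV`. Adjoin `u_i` with `du_i = x_i²` to obtain a `ΛW`. A relative model and a
retraction for `ρ_k` over `ΛV ⊗ ΛV` base change to `ΛW ⊗ ΛW`, and the kernel of the model map
generates an acyclic ideal there. As `(u_i - u'_i)² = 0`, the power `(ker μ_W)^(k+n+1)` lies in the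
ideal generated by `(ker μ_V)^(k+1)`, so its cocycles are exact
(`exact_of_hasHomotopyRetraction_of_extension`). The non-exact cocycle in `(ker μ_W)^(2n+m)` then
forces `k ≥ n + m`.

Items 1 to 3 are instances of `IsExtension.TC_eq` and item 4 of `IsPureCoformal.le_TC`. -/

namespace RatTC

open FreeCGA

/-! ### Parity, central even elements and odd derivations of `ΛV`. -/

section Basic

variable {ι κ : Type}

namespace FreeCGA

/-- Induction on elements of `ΛV` for linear statements. -/
theorem word_induction {deg : ι → ℕ} {p : FreeCGA deg → Prop} (h0 : p 0)
    (hadd : ∀ a b, p a → p b → p (a + b)) (hsmul : ∀ (c : ℚ) a, p a → p (c • a))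
    (hw : ∀ l, p (word deg l)) (a : FreeCGA deg) : p a := by
  have ha : a ∈ Submodule.span ℚ (Set.range (word deg)) := by rw [span_word]; trivial
  induction ha using Submodule.span_induction with
  | zero => exact h0
  | add x y _ _ hx hy => exact hadd _ _ hx hy
  | smul c x _ hx => exact hsmul _ _ hx
  | mem x hx => obtain ⟨l, rfl⟩ := hx; exact hw l

theorem algHom_ext {deg : ι → ℕ} {A : Type} [Ring A] [Algebra ℚ A] {f g : FreeCGA deg →ₐ[ℚ] A}
    (h : ∀ i, f (gen deg i) = g (gen deg i)) (a : FreeCGA deg) : f a = g a := by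
  refine ext_word deg (f := f.toLinearMap) (g := g.toLinearMap) (fun l => ?_) a
  induction l with
  | nil => simp [word_nil]
  | cons i l ih =>
    simp only [AlgHom.toLinearMap_apply] at ih ⊢
    rw [word_cons, map_mul, map_mul, h, ih]

/-- The parity involution of `ΛV`. -/
noncomputable def parity (deg : ι → ℕ) : FreeCGA deg →ₐ[ℚ] FreeCGA deg :=
  lift deg (fun i => ((-1 : ℚ) ^ deg i) • gen deg i) (by
    intro i j
    simp only [smul_mul_smul_comm]
    rw [gen_comm, smul_comm, mul_comm ((-1 : ℚ) ^ deg i)])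

theorem parity_gen (deg : ι → ℕ) (i : ι) :
    parity deg (gen deg i) = ((-1 : ℚ) ^ deg i) • gen deg i := lift_gen _ _ _ _

theorem parity_word (deg : ι → ℕ) (l : List ι) :
    parity deg (word deg l) = ((-1 : ℚ) ^ (l.map deg).sum) • word deg l := by
  induction l with
  | nil => simp [word_nil]
  | cons i l ih => simp [word_cons, ih, parity_gen, pow_add, smul_smul, mul_comm]

theorem parity_of_mem {deg : ι → ℕ} {p : ℕ} {a : FreeCGA deg} (ha : a ∈ homog deg p) :
    parity deg a = ((-1 : ℚ) ^ p) • a := by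
  induction ha using Submodule.span_induction with
  | zero => simp
  | add x y _ _ hx hy => rw [map_add, hx, hy, smul_add]
  | smul c x _ hx => rw [map_smul, hx, smul_comm]
  | mem x hx => obtain ⟨l, rfl, rfl⟩ := hx; exact parity_word deg l

theorem parity_parity (deg : ι → ℕ) (a : FreeCGA deg) : parity deg (parity deg a) = a := by
  have := algHom_ext (f := (parity deg).comp (parity deg)) (g := AlgHom.id ℚ _) (fun i => by
    simp [parity_gen, smul_smul, ← mul_pow]) a
  simpa using this

theorem parity_rename {deg : ι → ℕ} {deg' : κ → ℕ} (e : ι → κ) (he : ∀ i, deg' (e i) = deg i)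
    (a : FreeCGA deg) : parity deg' (rename e he a) = rename e he (parity deg a) :=
  algHom_ext (f := (parity deg').comp (rename e he)) (g := (rename e he).comp (parity deg))
    (fun i => by simp [parity_gen, rename_gen, he]) a

/-- The Koszul sign is carried by the linear map `parity`, so the rule holds for inhomogeneous
elements too. -/
theorem mul_gen_of_odd {deg : ι → ℕ} {i : ι} (hi : Odd (deg i)) (a : FreeCGA deg) :
    a * gen deg i = gen deg i * parity deg a := by
  induction a using word_induction with
  | h0 => simp
  | hadd a b ha hb => simp [add_mul, mul_add, ha, hb]
  | hsmul c a ha => simp [ha]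
  | hw l =>
    rw [comm_gen deg (word_mem deg l), parity_word, mul_smul_comm, pow_mul]
    congr 1
    rcases neg_one_pow_eq_or ℚ ((l.map deg).sum) with h | h <;> simp [h, hi.neg_one_pow]

theorem gen_mul_gen_of_odd {deg : ι → ℕ} {i j : ι} (hi : Odd (deg i)) (hj : Odd (deg j)) :
    gen deg i * gen deg j = -(gen deg j * gen deg i) := by
  rw [gen_comm, (hi.mul hj).neg_one_pow, neg_one_smul]

theorem gen_sq_of_odd {deg : ι → ℕ} {i : ι} (hi : Odd (deg i)) :
    gen deg i * gen deg i = 0 := by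
  have h := gen_mul_gen_of_odd hi hi
  have h2 : (2 : ℚ) • (gen deg i * gen deg i) = 0 := by
    rw [two_smul]; nth_rewrite 1 [h]; simp
  simpa using h2

/-- Central even elements. -/
structure IsScalar {deg : ι → ℕ} (r : FreeCGA deg) : Prop where
  comm : ∀ a, r * a = a * r
  parity : parity deg r = r

theorem isScalar_gen {deg : ι → ℕ} {i : ι} (hi : Even (deg i)) : IsScalar (gen deg i) where
  comm a := by
    induction a using word_induction with
    | h0 => simp
    | hadd a b ha hb => simp [add_mul, mul_add, ha, hb]
    | hsmul c a ha => simp [ha]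
    | hw l => rw [comm_gen deg (word_mem deg l), (hi.mul_left _).neg_one_pow, one_smul]
  parity := by rw [parity_gen, hi.neg_one_pow, one_smul]

namespace IsScalar

variable {deg : ι → ℕ} {r s : FreeCGA deg}

theorem add (hr : IsScalar r) (hs : IsScalar s) : IsScalar (r + s) :=
  ⟨fun a => by rw [add_mul, mul_add, hr.comm, hs.comm], by rw [map_add, hr.parity, hs.parity]⟩
theorem mul (hr : IsScalar r) (hs : IsScalar s) : IsScalar (r * s) :=
  ⟨fun a => by rw [mul_assoc, hs.comm, ← mul_assoc, hr.comm, mul_assoc],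
    by rw [map_mul, hr.parity, hs.parity]⟩

end IsScalar

/-- Odd derivations of `ΛV`. -/
structure IsOddDer {deg : ι → ℕ} (D : FreeCGA deg →ₗ[ℚ] FreeCGA deg) : Prop where
  mul : ∀ a b, D (a * b) = D a * b + parity deg a * D b
  parity : ∀ a, parity deg (D a) = -D (parity deg a)

namespace IsOddDer

variable {deg : ι → ℕ} {D D' : FreeCGA deg →ₗ[ℚ] FreeCGA deg}

theorem one (h : IsOddDer D) : D 1 = 0 := by
  have := h.mul 1 1
  simpa using this

theorem zero : IsOddDer (0 : FreeCGA deg →ₗ[ℚ] FreeCGA deg) := ⟨by simp, by simp⟩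

theorem add (h : IsOddDer D) (h' : IsOddDer D') : IsOddDer (D + D') where
  mul a b := by simp only [LinearMap.add_apply, h.mul, h'.mul, mul_add, add_mul]; abel
  parity a := by simp only [LinearMap.add_apply, map_add, h.parity, h'.parity]; abel

theorem scalar_smul {r : FreeCGA deg} (hr : IsScalar r) (h : IsOddDer D) :
    IsOddDer (LinearMap.mulLeft ℚ r ∘ₗ D) where
  mul a b := by
    simp only [LinearMap.comp_apply, LinearMap.mulLeft_apply, h.mul, mul_add, ← mul_assoc]
    rw [hr.comm (FreeCGA.parity deg a)]
  parity a := by simp [h.parity, hr.parity]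

theorem smul (c : ℚ) (h : IsOddDer D) : IsOddDer (c • D) where
  mul a b := by simp [h.mul]
  parity a := by simp [h.parity]

theorem sum {τ : Type} {S : Finset τ} {f : τ → FreeCGA deg →ₗ[ℚ] FreeCGA deg}
    (h : ∀ i ∈ S, IsOddDer (f i)) : IsOddDer (∑ i ∈ S, f i) := by
  classical
  induction S using Finset.induction_on with
  | empty => simpa using zero
  | insert i S hi ih =>
    rw [Finset.sum_insert hi]
    exact (h i (by simp)).add (ih fun j hj => h j (by simp [hj]))

/-- Odd derivations are determined by their values on generators. -/
theorem ext (h : IsOddDer D) (h' : IsOddDer D') (hg : ∀ i, D (gen deg i) = D' (gen deg i)) :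
    D = D' := by
  refine LinearMap.ext fun a => ext_word deg (fun l => ?_) a
  induction l with
  | nil => rw [word_nil, h.one, h'.one]
  | cons i l ih => rw [word_cons, h.mul, h'.mul, hg, ih]

/-- Two odd derivations anticommute if they do so on generators. -/
theorem anticomm (h : IsOddDer D) (h' : IsOddDer D')
    (hg : ∀ i, D (D' (gen deg i)) + D' (D (gen deg i)) = 0) (a : FreeCGA deg) :
    D (D' a) = -D' (D a) := by
  rw [eq_neg_iff_add_eq_zero]
  refine ext_word deg (f := D ∘ₗ D' + D' ∘ₗ D) (g := 0) (fun l => ?_) a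
  simp only [LinearMap.add_apply, LinearMap.comp_apply, LinearMap.zero_apply]
  induction l with
  | nil => simp [word_nil, h.one, h'.one]
  | cons i l ih =>
    rw [word_cons]
    simp only [h.mul, h'.mul, map_add, h.parity, h'.parity, parity_parity]
    generalize word deg l = w at ih ⊢
    have e1 : D (D' (gen deg i)) = -D' (D (gen deg i)) := eq_neg_of_add_eq_zero_left (hg i)
    have e2 : D (D' w) = -D' (D w) := eq_neg_of_add_eq_zero_left ih
    rw [e1, e2]
    noncomm_ring

theorem mul_eq_zero (h : IsOddDer D) {a b : FreeCGA deg} (ha : D a = 0) (hb : D b = 0) :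
    D (a * b) = 0 := by rw [h.mul, ha, hb]; simp

theorem scalar_mul (h : IsOddDer D) {r : FreeCGA deg} (hr : IsScalar r) (h0 : D r = 0)
    (a : FreeCGA deg) : D (r * a) = r * D a := by rw [h.mul, h0, hr.parity]; simp

theorem rename_eq_zero {deg' : κ → ℕ} {D : FreeCGA deg' →ₗ[ℚ] FreeCGA deg'} (h : IsOddDer D)
    (e : ι → κ) (he : ∀ i, deg' (e i) = deg i) (h0 : ∀ i, D (gen deg' (e i)) = 0)
    (a : FreeCGA deg) : D (rename e he a) = 0 := by
  induction a using word_induction with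
  | h0 => simp
  | hadd a b ha hb => simp [ha, hb]
  | hsmul c a ha => simp [ha]
  | hw l =>
    induction l with
    | nil => simp [word_nil, h.one]
    | cons i l ih =>
      rw [word_cons, map_mul, rename_gen]
      exact h.mul_eq_zero (h0 i) ih

end IsOddDer

/-- Replaces the degree-dependent sign in the Leibniz rule by `parity`, so that the calculus of odd
derivations applies to arbitrary elements. -/
theorem _root_.RatTC.Differential.isOddDer {deg : ι → ℕ} (d : Differential deg) :
    IsOddDer d.toLin where
  mul a b := by
    induction a using word_induction with
    | h0 => simp
    | hadd a a' ha ha' => simp only [add_mul, map_add, ha, ha']; abel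
    | hsmul c a ha => simp [ha]
    | hw l => rw [d.leibniz b (word_mem deg l), parity_word, smul_mul_assoc]
  parity a := by
    induction a using word_induction with
    | h0 => simp
    | hadd a a' ha ha' => simp only [map_add, ha, ha']; abel
    | hsmul c a ha => simp [ha]
    | hw l =>
      rw [parity_of_mem (d.mem (word_mem deg l)), parity_word, map_smul, pow_succ]
      simp

/-! ### Partial derivatives along odd generators. -/

section Partial

variable [DecidableEq ι] (deg : ι → ℕ)

/-- The values of a partial derivative on generators. -/
noncomputable def deltaGen (k i : ι) : FreeCGA deg := if i = k then 1 else 0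

/-- The algebra map `a ↦ !![± a, ∂ a; 0, a]` behind the partial derivative `∂`. -/
noncomputable def partialAux (k : ι) (hk : Odd (deg k)) :
    FreeCGA deg →ₐ[ℚ] Matrix (Fin 2) (Fin 2) (FreeCGA deg) :=
  lift deg (fun i => !![((-1 : ℚ) ^ deg i) • gen deg i, deltaGen deg k i; 0, gen deg i]) (by
    intro i j
    have h1 := gen_comm deg i j
    ext a b
    fin_cases a <;> fin_cases b
    · simp [h1, smul_smul]
      ring_nf
    · simp only [Matrix.mul_fin_two, Matrix.smul_apply]
      by_cases hi : i = k <;> by_cases hj : j = k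
      · subst hi; subst hj; simp [deltaGen, hk.neg_one_pow]
      · subst hi; simp [deltaGen, hj, pow_mul, hk.neg_one_pow, smul_smul, ← mul_pow]
      · subst hj; simp [deltaGen, hi, mul_comm _ (deg j), pow_mul, hk.neg_one_pow]
      · simp [deltaGen, hi, hj]
    · simp
    · simpa using h1)

/-- The partial derivative with respect to an odd generator. -/
noncomputable def partialD (k : ι) (hk : Odd (deg k)) : FreeCGA deg →ₗ[ℚ] FreeCGA deg where
  toFun a := partialAux deg k hk a 0 1
  map_add' := by intro a b; simp
  map_smul' := by intro c a; simp

theorem partialD_gen (k : ι) (hk : Odd (deg k)) (i : ι) :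
    partialD deg k hk (gen deg i) = if i = k then 1 else 0 := by
  change partialAux deg k hk (gen deg i) 0 1 = _
  rw [partialAux, lift_gen]; rfl

theorem partialAux_word (k : ι) (hk : Odd (deg k)) (l : List ι) :
    partialAux deg k hk (word deg l) 0 0 = parity deg (word deg l) ∧
    partialAux deg k hk (word deg l) 1 1 = word deg l ∧
    partialAux deg k hk (word deg l) 1 0 = 0 := by
  induction l with
  | nil => simp [word_nil]
  | cons i l ih =>
    rw [word_cons, map_mul, map_mul, parity_gen]
    have h : partialAux deg k hk (gen deg i) = _ := lift_gen _ _ _ _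
    rw [h]
    simp [Matrix.mul_apply, Fin.sum_univ_two, ih.1, ih.2]

/-- The product rule is the upper right entry of a product of upper triangular matrices whose
diagonal entries are `parity deg a` and `a`. -/
theorem isOddDer_partialD (k : ι) (hk : Odd (deg k)) : IsOddDer (partialD deg k hk) := by
  have hmul : ∀ a b, partialD deg k hk (a * b) =
      partialD deg k hk a * b + parity deg a * partialD deg k hk b := by
    intro a b
    change partialAux deg k hk (a * b) 0 1 = partialAux deg k hk a 0 1 * b + _ *
      partialAux deg k hk b 0 1
    rw [map_mul, Matrix.mul_apply, Fin.sum_univ_two, add_comm]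
    congr 2
    · induction b using word_induction with
      | h0 => simp
      | hadd a a' ha ha' => simp [ha, ha']
      | hsmul c a ha => simp [ha]
      | hw l => exact (partialAux_word deg k hk l).2.1
    · induction a using word_induction with
      | h0 => simp
      | hadd a a' ha ha' => simp [ha, ha']
      | hsmul c a ha => simp [ha]
      | hw l => exact (partialAux_word deg k hk l).1
  refine ⟨hmul, fun a => ?_⟩
  have h1 : partialD deg k hk 1 = 0 := by
    change partialAux deg k hk 1 0 1 = 0
    rw [map_one]; simp
  induction a using word_induction with
  | h0 => simp
  | hadd a a' ha ha' => simp only [map_add, ha, ha']; abel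
  | hsmul c a ha => simp [ha]
  | hw l =>
    induction l with
    | nil => simp [word_nil, h1]
    | cons i l ih =>
      rw [word_cons, hmul, map_mul (parity deg), hmul, map_add, map_mul, map_mul, ih, parity_parity,
        partialD_gen, parity_gen, map_smul, partialD_gen]
      by_cases hi : i = k
      · subst hi; simp [hk.neg_one_pow, add_comm]
      · simp [hi]

theorem partialD_anticomm (k k' : ι) (hk : Odd (deg k)) (hk' : Odd (deg k')) (a : FreeCGA deg) :
    partialD deg k hk (partialD deg k' hk' a) = -partialD deg k' hk' (partialD deg k hk a) := by
  have h1 := (isOddDer_partialD deg k hk).one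
  have h2 := (isOddDer_partialD deg k' hk').one
  refine (isOddDer_partialD deg k hk).anticomm (isOddDer_partialD deg k' hk') (fun i => ?_) a
  simp only [partialD_gen]
  split_ifs <;> simp [h1, h2]

/-- The endomorphism of `ΛV` which kills the generator `k`. -/
noncomputable def killGen (k : ι) : FreeCGA deg →ₐ[ℚ] FreeCGA deg :=
  lift deg (fun i => if i = k then 0 else gen deg i) (by
    intro i j
    by_cases hi : i = k <;> by_cases hj : j = k <;> simp [hi, hj]
    exact gen_comm deg i j)

theorem killGen_gen (k i : ι) : killGen deg k (gen deg i) = if i = k then 0 else gen deg i :=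
  lift_gen _ _ _ _

/-- An odd generator `y` has square zero, so every element is affine in it: a part free of `y`, plus
`y` times its derivative. -/
theorem killGen_add (k : ι) (hk : Odd (deg k)) (a : FreeCGA deg) :
    killGen deg k a + gen deg k * partialD deg k hk a = a := by
  have h := isOddDer_partialD deg k hk
  induction a using word_induction with
  | h0 => simp
  | hadd a a' ha ha' =>
    nth_rewrite 3 [← ha]; nth_rewrite 3 [← ha']
    simp only [map_add, mul_add]; abel
  | hsmul c a ha => rw [map_smul, map_smul, mul_smul_comm, ← smul_add, ha]
  | hw l =>
    induction l with
    | nil => simp [word_nil, h.one]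
    | cons i l ih =>
      rw [word_cons, map_mul, h.mul, killGen_gen, partialD_gen, mul_add]
      by_cases hi : i = k
      · subst hi
        simp [parity_gen, hk.neg_one_pow, ← mul_assoc, gen_sq_of_odd hk]
      · have e : gen deg k * parity deg (gen deg i) = gen deg i * gen deg k :=
          (mul_gen_of_odd hk _).symm
        simp only [hi, if_false, zero_mul, mul_zero, zero_add]
        rw [← mul_assoc, e, mul_assoc, ← mul_add, ih]

theorem partialD_killGen (k : ι) (hk : Odd (deg k)) (a : FreeCGA deg) :
    partialD deg k hk (killGen deg k a) = 0 := by
  have h := isOddDer_partialD deg k hk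
  induction a using word_induction with
  | h0 => simp
  | hadd a a' ha ha' => simp [ha, ha']
  | hsmul c a ha => simp [ha]
  | hw l =>
    induction l with
    | nil => simp [word_nil, h.one]
    | cons i l ih =>
      rw [word_cons, map_mul, killGen_gen]
      refine h.mul_eq_zero ?_ ih
      split_ifs with hi
      · simp
      · rw [partialD_gen, if_neg hi]

end Partial

end FreeCGA
end Basic
end RatTC

namespace RatTC

open FreeCGA

/-! ### The subalgebra of even generators and products of commuting operators. -/

section EvenPart

variable {ι κ : Type}

namespace FreeCGA

/-- The subalgebra generated by the even generators. -/
noncomputable def evenPart (deg : ι → ℕ) : Subalgebra ℚ (FreeCGA deg) :=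
  Algebra.adjoin ℚ {a | ∃ i, Even (deg i) ∧ gen deg i = a}

theorem gen_mem_evenPart {deg : ι → ℕ} {i : ι} (hi : Even (deg i)) :
    gen deg i ∈ evenPart deg := Algebra.subset_adjoin ⟨i, hi, rfl⟩

theorem isScalar_of_mem_evenPart {deg : ι → ℕ} {r : FreeCGA deg} (hr : r ∈ evenPart deg) :
    IsScalar r := by
  induction hr using Algebra.adjoin_induction with
  | mem x hx => obtain ⟨i, hi, rfl⟩ := hx; exact isScalar_gen hi
  | algebraMap c => exact ⟨fun a => Algebra.commutes c a, AlgHom.commutes _ c⟩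
  | add x y _ _ hx hy => exact hx.add hy
  | mul x y _ _ hx hy => exact hx.mul hy

theorem IsOddDer.eq_zero_of_mem_evenPart {deg : ι → ℕ} {D : FreeCGA deg →ₗ[ℚ] FreeCGA deg}
    (h : IsOddDer D) (h0 : ∀ i, Even (deg i) → D (gen deg i) = 0) {r : FreeCGA deg}
    (hr : r ∈ evenPart deg) : D r = 0 := by
  induction hr using Algebra.adjoin_induction with
  | mem x hx => obtain ⟨i, hi, rfl⟩ := hx; exact h0 i hi
  | algebraMap c => rw [Algebra.algebraMap_eq_smul_one, map_smul, h.one, smul_zero]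
  | add x y _ _ hx hy => rw [map_add, hx, hy, add_zero]
  | mul x y _ _ hx hy => exact h.mul_eq_zero hx hy

theorem partialD_eq_zero [DecidableEq ι] {deg : ι → ℕ} {k : ι} (hk : Odd (deg k))
    {r : FreeCGA deg} (hr : r ∈ evenPart deg) : partialD deg k hk r = 0 := by
  refine (isOddDer_partialD deg k hk).eq_zero_of_mem_evenPart (fun i hi => ?_) hr
  rw [partialD_gen, if_neg]
  rintro rfl
  exact Nat.not_even_iff_odd.2 hk hi

end FreeCGA

end EvenPart

/-- A list of commuting operators kills whatever one of them kills. -/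
theorem list_prod_kill {τ M : Type} [AddCommGroup M] [Module ℚ M] {T D : τ → M →ₗ[ℚ] M}
    (hD : ∀ i j a, D j (T i a) = T i (D j a)) (hz : ∀ i a, D i (T i a) = 0) {L : List τ} {j : τ}
    (hj : j ∈ L) (a : M) : D j ((L.map (fun i => (T i : Module.End ℚ M))).prod a) = 0 := by
  induction L with
  | nil => simp at hj
  | cons i L ih =>
    rw [List.map_cons, List.prod_cons, Module.End.mul_apply]
    rcases List.mem_cons.1 hj with rfl | h
    · exact hz _ _
    · rw [hD, ih h, map_zero]

/-- Operators commuting with all factors commute with the product. -/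
theorem list_prod_comm {τ M : Type} [AddCommGroup M] [Module ℚ M] {T : τ → M →ₗ[ℚ] M}
    {D : M →ₗ[ℚ] M} {L : List τ} (hD : ∀ i ∈ L, ∀ a, D (T i a) = T i (D a))
    (a : M) : D ((L.map (fun i => (T i : Module.End ℚ M))).prod a) =
      (L.map (fun i => (T i : Module.End ℚ M))).prod (D a) := by
  induction L with
  | nil => simp
  | cons i L ih =>
    rw [List.map_cons, List.prod_cons, Module.End.mul_apply, Module.End.mul_apply,
      hD i (by simp), ih fun j hj => hD j (by simp [hj])]

/-! ### The filtration of `ΛV ⊗ ΛV` by powers of `ker μ`. -/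

section Filtration

variable {ι : Type}

/-- The kernel of `μ`, as a `ℚ`-subspace. -/
noncomputable def kerMul (deg : ι → ℕ) : Submodule ℚ (FreeCGA (Sum.elim deg deg)) :=
  LinearMap.ker (mulAlgHom deg).toLinearMap

theorem mem_kerMul {deg : ι → ℕ} {a : FreeCGA (Sum.elim deg deg)} :
    a ∈ kerMul deg ↔ mulAlgHom deg a = 0 := Iff.rfl

theorem mulAlgHom_inl (deg : ι → ℕ) (i : ι) :
    mulAlgHom deg (gen (Sum.elim deg deg) (Sum.inl i)) = gen deg i := rename_gen _ _ _

theorem mulAlgHom_inr (deg : ι → ℕ) (i : ι) :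
    mulAlgHom deg (gen (Sum.elim deg deg) (Sum.inr i)) = gen deg i := rename_gen _ _ _

theorem diff_mem_kerMul (deg : ι → ℕ) (i : ι) :
    gen (Sum.elim deg deg) (Sum.inl i) - gen (Sum.elim deg deg) (Sum.inr i) ∈ kerMul deg := by
  rw [mem_kerMul, map_sub, mulAlgHom_inl, mulAlgHom_inr, sub_self]

theorem top_mul_kerMul (deg : ι → ℕ) : ⊤ * kerMul deg = kerMul deg := by
  refine le_antisymm (Submodule.mul_le.2 fun a _ b hb => ?_) fun a ha => ?_
  · rw [mem_kerMul] at *; rw [map_mul, hb, mul_zero]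
  · simpa using Submodule.mul_mem_mul (Submodule.mem_top (x := 1) (R := ℚ)) ha

theorem kerMul_mul_top (deg : ι → ℕ) : kerMul deg * ⊤ = kerMul deg := by
  refine le_antisymm (Submodule.mul_le.2 fun a ha b _ => ?_) fun a ha => ?_
  · rw [mem_kerMul] at *; rw [map_mul, ha, zero_mul]
  · simpa using Submodule.mul_mem_mul ha (Submodule.mem_top (x := 1) (R := ℚ))

theorem parity_mem_kerMul {deg : ι → ℕ} {a : FreeCGA (Sum.elim deg deg)} (ha : a ∈ kerMul deg) :
    parity _ a ∈ kerMul deg := by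
  rw [mem_kerMul] at *
  rw [mulAlgHom, ← parity_rename, ← mulAlgHom, ha, map_zero]

/-- The powers of the ideal `ker μ`, the zeroth one being everything. -/
noncomputable def kerFil (deg : ι → ℕ) (k : ℕ) : Submodule ℚ (FreeCGA (Sum.elim deg deg)) :=
  ⊤ * kerMul deg ^ k

theorem kerFil_zero (deg : ι → ℕ) : kerFil deg 0 = ⊤ := by simp [kerFil]

theorem kerFil_succ (deg : ι → ℕ) (k : ℕ) : kerFil deg (k + 1) = kerFil deg k * kerMul deg := by
  rw [kerFil, pow_succ, kerFil, mul_assoc]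

/-- The factor `⊤` only matters in exponent `0`, where the power of a subspace is the line of
scalars; in positive exponents it is absorbed because the kernel is an ideal. -/
theorem kerFil_succ' (deg : ι → ℕ) (k : ℕ) : kerFil deg (k + 1) = kerMul deg ^ (k + 1) := by
  rw [kerFil, pow_succ', ← mul_assoc, top_mul_kerMul]

theorem kerFil_mul (deg : ι → ℕ) (j k : ℕ) :
    kerFil deg j * kerFil deg k = kerFil deg (j + k) := by
  have h : Commute (kerMul deg ^ j) ⊤ :=
    Commute.pow_left ((kerMul_mul_top deg).trans (top_mul_kerMul deg).symm) j
  have ht : (⊤ : Submodule ℚ (FreeCGA (Sum.elim deg deg))) * ⊤ = ⊤ :=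
    top_le_iff.1 fun a _ => by
      simpa using Submodule.mul_mem_mul (Submodule.mem_top (x := 1) (R := ℚ))
        (Submodule.mem_top (x := a) (R := ℚ))
  rw [kerFil, kerFil, kerFil, mul_assoc, ← mul_assoc (kerMul deg ^ j), h.eq, mul_assoc, ← pow_add,
    ← mul_assoc, ht]

theorem mul_mem_kerFil {deg : ι → ℕ} {j k : ℕ} {a b : FreeCGA (Sum.elim deg deg)}
    (ha : a ∈ kerFil deg j) (hb : b ∈ kerFil deg k) : a * b ∈ kerFil deg (j + k) := by
  rw [← kerFil_mul]; exact Submodule.mul_mem_mul ha hb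

theorem kerMul_le_kerFil (deg : ι → ℕ) : kerMul deg = kerFil deg 1 := by
  rw [kerFil_succ', zero_add, pow_one]

theorem parity_mem_kerFil {deg : ι → ℕ} {k : ℕ} {a : FreeCGA (Sum.elim deg deg)}
    (ha : a ∈ kerFil deg k) : parity _ a ∈ kerFil deg k := by
  induction k generalizing a with
  | zero => rw [kerFil_zero]; trivial
  | succ k ih =>
    rw [kerFil_succ] at ha
    induction ha using Submodule.mul_induction_on' with
    | mem_mul_mem b hb c hc =>
      rw [map_mul, kerFil_succ]
      exact Submodule.mul_mem_mul (ih hb) (parity_mem_kerMul hc)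
    | add b _ c _ hb hc => rw [map_add]; exact Submodule.add_mem _ hb hc

/-- Odd derivations lower the filtration by at most one. -/
theorem FreeCGA.IsOddDer.mem_kerFil_of_succ {deg : ι → ℕ}
    {D : FreeCGA (Sum.elim deg deg) →ₗ[ℚ] FreeCGA (Sum.elim deg deg)} (h : IsOddDer D) {k : ℕ}
    {a : FreeCGA (Sum.elim deg deg)} (ha : a ∈ kerFil deg (k + 1)) : D a ∈ kerFil deg k := by
  induction k generalizing a with
  | zero => rw [kerFil_zero]; trivial
  | succ k ih =>
    rw [kerFil_succ] at ha
    induction ha using Submodule.mul_induction_on' with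
    | mem_mul_mem b hb c hc =>
      rw [h.mul]
      refine Submodule.add_mem _ ?_ ?_
      · rw [kerFil_succ]; exact Submodule.mul_mem_mul (ih hb) hc
      · exact mul_mem_kerFil (k := 0) (parity_mem_kerFil hb) (by rw [kerFil_zero]; trivial)
    | add b _ c _ hb hc => rw [map_add]; exact Submodule.add_mem _ hb hc

/-- Odd derivations preserving `ker μ` preserve the filtration. -/
theorem FreeCGA.IsOddDer.mem_kerFil {deg : ι → ℕ}
    {D : FreeCGA (Sum.elim deg deg) →ₗ[ℚ] FreeCGA (Sum.elim deg deg)} (h : IsOddDer D)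
    (hD : ∀ a ∈ kerMul deg, D a ∈ kerMul deg) {k : ℕ}
    {a : FreeCGA (Sum.elim deg deg)} (ha : a ∈ kerFil deg k) : D a ∈ kerFil deg k := by
  induction k generalizing a with
  | zero => rw [kerFil_zero]; trivial
  | succ k ih =>
    rw [kerFil_succ] at ha
    induction ha using Submodule.mul_induction_on' with
    | mem_mul_mem b hb c hc =>
      rw [h.mul, kerFil_succ]
      exact Submodule.add_mem _ (Submodule.mul_mem_mul (ih hb) hc)
        (Submodule.mul_mem_mul (parity_mem_kerFil hb) (hD c hc))
    | add b _ c _ hb hc => rw [map_add]; exact Submodule.add_mem _ hb hc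

theorem mem_kerPow_of_mem_kerFil {deg : ι → ℕ} (d : Differential deg) {m : ℕ}
    {a : FreeCGA (Sum.elim deg deg)} (ha : a ∈ kerFil deg (m + 1)) : a ∈ kerPow d m := by
  rw [kerFil_succ'] at ha
  induction m generalizing a with
  | zero =>
    rw [zero_add, pow_one] at ha
    change a ∈ RingHom.ker (mulHom d).toAlgHom ^ (0 + 1)
    rw [zero_add, Submodule.pow_one]; exact ha
  | succ m ih =>
    rw [pow_succ] at ha
    change a ∈ RingHom.ker (mulHom d).toAlgHom ^ (m + 1 + 1)
    rw [Submodule.pow_succ]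
    induction ha using Submodule.mul_induction_on' with
    | mem_mul_mem b hb c hc => exact Ideal.mul_mem_mul (ih hb) hc
    | add b _ c _ hb hc => exact Ideal.add_mem _ hb hc

/-- In positive exponents a power of an ideal is additively generated by products of its elements,
so it agrees with the power of the underlying subspace. In exponent `0` this fails: the whole ring
against the scalars. -/
theorem mem_restrictScalars_pow {A : Type} [Ring A] [Algebra ℚ A] {I : Ideal A} {m : ℕ} {a : A}
    (ha : a ∈ I ^ (m + 1)) : a ∈ (I.restrictScalars ℚ) ^ (m + 1) := by
  induction m generalizing a with
  | zero =>
    rw [zero_add, pow_one]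
    rw [zero_add, Submodule.pow_one] at ha; exact ha
  | succ m ih =>
    rw [pow_succ]
    rw [Submodule.pow_succ] at ha
    refine Submodule.mul_induction_on (C := fun a => a ∈ (I.restrictScalars ℚ) ^ (m + 1) *
      I.restrictScalars ℚ) ha ?_ ?_
    · intro b hb c hc
      exact Submodule.mul_mem_mul (ih hb) hc
    · intro b c hb hc
      exact Submodule.add_mem _ hb hc

theorem mem_kerFil_of_mem_kerPow {deg : ι → ℕ} (d : Differential deg) {m : ℕ}
    {a : FreeCGA (Sum.elim deg deg)} (ha : a ∈ kerPow d m) : a ∈ kerFil deg (m + 1) := by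
  rw [kerFil_succ']
  exact mem_restrictScalars_pow (A := FreeCGA (Sum.elim deg deg))
    (I := RingHom.ker (mulAlgHom deg)) ha

end Filtration
end RatTC

namespace RatTC

open FreeCGA

set_option linter.unusedSectionVars false

/-! ### Contractions of `ΛV ⊗ ΛV` with polynomial coefficients. -/

section Quadratic

variable {E O : Type} [Fintype O] [DecidableEq E] [DecidableEq O]

/-- `(ΛV, d)` has even generators `x_i`, which are cocycles, and odd generators `y_o`, with
`d y_o = ∑ B o i k x_i x_k` and `B o` symmetric. -/
structure IsPureQuadratic [Fintype E] {deg : E ⊕ O → ℕ} (d : Differential deg) (B : O → E → E → ℚ) :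
    Prop where
  pos : ∀ i, 0 < deg i
  even : ∀ i, Even (deg (Sum.inl i))
  odd : ∀ o, Odd (deg (Sum.inr o))
  symm : ∀ o i k, B o i k = B o k i
  dx : ∀ i, d.toLin (gen deg (Sum.inl i)) = 0
  dy : ∀ o, d.toLin (gen deg (Sum.inr o)) =
    ∑ i, ∑ k, B o i k • (gen deg (Sum.inl i) * gen deg (Sum.inl k))

/-- The generators `x_i ⊗ 1`. -/
noncomputable abbrev dx₁ (deg : E ⊕ O → ℕ) (i : E) : FreeCGA (Sum.elim deg deg) :=
  gen _ (Sum.inl (Sum.inl i))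
/-- The generators `1 ⊗ x_i`. -/
noncomputable abbrev dx₂ (deg : E ⊕ O → ℕ) (i : E) : FreeCGA (Sum.elim deg deg) :=
  gen _ (Sum.inr (Sum.inl i))
/-- The generators `y_o ⊗ 1`. -/
noncomputable abbrev dy₁ (deg : E ⊕ O → ℕ) (o : O) : FreeCGA (Sum.elim deg deg) :=
  gen _ (Sum.inl (Sum.inr o))
/-- The generators `1 ⊗ y_o`. -/
noncomputable abbrev dy₂ (deg : E ⊕ O → ℕ) (o : O) : FreeCGA (Sum.elim deg deg) :=
  gen _ (Sum.inr (Sum.inr o))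

variable {deg : E ⊕ O → ℕ} (hE : ∀ i, Even (deg (Sum.inl i))) (hO : ∀ o, Odd (deg (Sum.inr o)))

theorem odd_left {deg : E ⊕ O → ℕ} {o : O} (h : Odd (deg (Sum.inr o))) :
    Odd (Sum.elim deg deg (Sum.inl (Sum.inr o))) := h

theorem odd_right {deg : E ⊕ O → ℕ} {o : O} (h : Odd (deg (Sum.inr o))) :
    Odd (Sum.elim deg deg (Sum.inr (Sum.inr o))) := h

/-- The derivation `∂ / ∂(y_o ⊗ 1)`. -/
noncomputable def pd₁ (o : O) :
    FreeCGA (Sum.elim deg deg) →ₗ[ℚ] FreeCGA (Sum.elim deg deg) :=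
  partialD (Sum.elim deg deg) (Sum.inl (Sum.inr o)) (odd_left (hO o))

/-- The derivation `∂ / ∂(1 ⊗ y_o)`. -/
noncomputable def pd₂ (o : O) :
    FreeCGA (Sum.elim deg deg) →ₗ[ℚ] FreeCGA (Sum.elim deg deg) :=
  partialD (Sum.elim deg deg) (Sum.inr (Sum.inr o)) (odd_right (hO o))

/-- The derivation `∑ p_o ∂ / ∂(y_o ⊗ 1) + q_o ∂ / ∂(1 ⊗ y_o)`. -/
noncomputable def contr (p q : O → FreeCGA (Sum.elim deg deg)) :
    FreeCGA (Sum.elim deg deg) →ₗ[ℚ] FreeCGA (Sum.elim deg deg) :=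
  ∑ o, (LinearMap.mulLeft ℚ (p o) ∘ₗ pd₁ hO o + LinearMap.mulLeft ℚ (q o) ∘ₗ pd₂ hO o)

theorem contr_apply (p q : O → FreeCGA (Sum.elim deg deg)) (a : FreeCGA (Sum.elim deg deg)) :
    contr hO p q a = ∑ o, (p o * pd₁ hO o a + q o * pd₂ hO o a) := by
  simp [contr]

theorem contr_x₁ (p q : O → FreeCGA (Sum.elim deg deg)) (i : E) :
    contr hO p q (dx₁ deg i) = 0 := by
  simp [contr_apply, pd₁, pd₂, partialD_gen]

theorem contr_x₂ (p q : O → FreeCGA (Sum.elim deg deg)) (i : E) :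
    contr hO p q (dx₂ deg i) = 0 := by
  simp [contr_apply, pd₁, pd₂, partialD_gen]

theorem contr_y₁ (p q : O → FreeCGA (Sum.elim deg deg)) (o : O) :
    contr hO p q (dy₁ deg o) = p o := by
  simp [contr_apply, pd₁, pd₂, partialD_gen]

theorem contr_y₂ (p q : O → FreeCGA (Sum.elim deg deg)) (o : O) :
    contr hO p q (dy₂ deg o) = q o := by
  simp [contr_apply, pd₁, pd₂, partialD_gen]

theorem isOddDer_contr {p q : O → FreeCGA (Sum.elim deg deg)}
    (hp : ∀ o, p o ∈ evenPart (Sum.elim deg deg)) (hq : ∀ o, q o ∈ evenPart (Sum.elim deg deg)) :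
    IsOddDer (contr hO p q) :=
  IsOddDer.sum fun o _ =>
    (IsOddDer.scalar_smul (isScalar_of_mem_evenPart (hp o)) (isOddDer_partialD _ _ _)).add
      (IsOddDer.scalar_smul (isScalar_of_mem_evenPart (hq o)) (isOddDer_partialD _ _ _))

theorem contr_evenPart (p q : O → FreeCGA (Sum.elim deg deg)) {r : FreeCGA (Sum.elim deg deg)}
    (hr : r ∈ evenPart (Sum.elim deg deg)) : contr hO p q r = 0 := by
  rw [contr_apply]
  refine Finset.sum_eq_zero fun o _ => ?_
  rw [pd₁, pd₂, partialD_eq_zero _ hr, partialD_eq_zero _ hr]; simp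

/-- Contractions send generators to polynomials in the even generators and kill such polynomials, so
both composites vanish on generators. -/
theorem contr_anticomm {p q p' q' : O → FreeCGA (Sum.elim deg deg)}
    (hp : ∀ o, p o ∈ evenPart (Sum.elim deg deg)) (hq : ∀ o, q o ∈ evenPart (Sum.elim deg deg))
    (hp' : ∀ o, p' o ∈ evenPart (Sum.elim deg deg)) (hq' : ∀ o, q' o ∈ evenPart (Sum.elim deg deg))
    (a : FreeCGA (Sum.elim deg deg)) :
    contr hO p q (contr hO p' q' a) = -contr hO p' q' (contr hO p q a) := by
  refine (isOddDer_contr hO hp hq).anticomm (isOddDer_contr hO hp' hq') ?_ a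
  rintro ((i | o) | (i | o))
  · rw [contr_x₁, contr_x₁]; simp
  · rw [contr_y₁, contr_y₁, contr_evenPart _ _ _ (hp o), contr_evenPart _ _ _ (hp' o), add_zero]
  · rw [contr_x₂, contr_x₂]; simp
  · rw [contr_y₂, contr_y₂, contr_evenPart _ _ _ (hq o), contr_evenPart _ _ _ (hq' o), add_zero]

theorem contr_sq {p q : O → FreeCGA (Sum.elim deg deg)}
    (hp : ∀ o, p o ∈ evenPart (Sum.elim deg deg)) (hq : ∀ o, q o ∈ evenPart (Sum.elim deg deg))
    (a : FreeCGA (Sum.elim deg deg)) : contr hO p q (contr hO p q a) = 0 := by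
  have h := contr_anticomm hO hp hq hp hq a
  have h2 : (2 : ℚ) • contr hO p q (contr hO p q a) = 0 := by
    rw [two_smul]; nth_rewrite 1 [h]; simp
  simpa using h2

/-- A partial derivative is a contraction with constant coefficients, so `contr_anticomm` settles
all its commutation rules. -/
theorem pd₁_eq_contr (o : O) : pd₁ hO o = contr hO (Pi.single o 1) 0 := by
  ext a
  rw [contr_apply, Finset.sum_eq_single o]
  · simp
  · intro b _ hb; simp [hb]
  · simp

theorem pd₂_eq_contr (o : O) : pd₂ hO o = contr hO 0 (Pi.single o 1) := by
  ext a
  rw [contr_apply, Finset.sum_eq_single o]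
  · simp
  · intro b _ hb; simp [hb]
  · simp

theorem single_mem_evenPart (o o' : O) :
    (Pi.single o 1 : O → FreeCGA (Sum.elim deg deg)) o' ∈ evenPart (Sum.elim deg deg) := by
  by_cases h : o' = o
  · subst h; simp
  · simp [h, zero_mem]

theorem zero_mem_evenPart (o : O) :
    (0 : O → FreeCGA (Sum.elim deg deg)) o ∈ evenPart (Sum.elim deg deg) := zero_mem _

theorem pd₁_anticomm_contr {p q : O → FreeCGA (Sum.elim deg deg)}
    (hp : ∀ o, p o ∈ evenPart (Sum.elim deg deg)) (hq : ∀ o, q o ∈ evenPart (Sum.elim deg deg))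
    (o : O) (a : FreeCGA (Sum.elim deg deg)) :
    pd₁ hO o (contr hO p q a) = -contr hO p q (pd₁ hO o a) := by
  rw [pd₁_eq_contr]
  exact contr_anticomm hO (single_mem_evenPart o) zero_mem_evenPart hp hq a

theorem pd₂_anticomm_contr {p q : O → FreeCGA (Sum.elim deg deg)}
    (hp : ∀ o, p o ∈ evenPart (Sum.elim deg deg)) (hq : ∀ o, q o ∈ evenPart (Sum.elim deg deg))
    (o : O) (a : FreeCGA (Sum.elim deg deg)) :
    pd₂ hO o (contr hO p q a) = -contr hO p q (pd₂ hO o a) := by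
  rw [pd₂_eq_contr]
  exact contr_anticomm hO zero_mem_evenPart (single_mem_evenPart o) hp hq a

/-- `∂² / ∂(y_o ⊗ 1) ∂(1 ⊗ y_o)`. -/
noncomputable def pd₁₂ (o : O) :
    FreeCGA (Sum.elim deg deg) →ₗ[ℚ] FreeCGA (Sum.elim deg deg) := pd₁ hO o ∘ₗ pd₂ hO o

/-- Two anticommutations cancel. Since the differential is itself a contraction, second derivatives
`∂_o ∂'_o` are thereby chain maps. -/
theorem pd₁₂_comm_contr {p q : O → FreeCGA (Sum.elim deg deg)}
    (hp : ∀ o, p o ∈ evenPart (Sum.elim deg deg)) (hq : ∀ o, q o ∈ evenPart (Sum.elim deg deg))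
    (o : O) (a : FreeCGA (Sum.elim deg deg)) :
    contr hO p q (pd₁₂ hO o a) = pd₁₂ hO o (contr hO p q a) := by
  simp only [pd₁₂, LinearMap.comp_apply]
  rw [pd₂_anticomm_contr hO hp hq, map_neg, pd₁_anticomm_contr hO hp hq, neg_neg]

theorem pd₁_pd₁ (o : O) (a : FreeCGA (Sum.elim deg deg)) : pd₁ hO o (pd₁ hO o a) = 0 := by
  rw [pd₁_eq_contr]; exact contr_sq hO (single_mem_evenPart o) zero_mem_evenPart a

theorem pd₂_pd₂ (o : O) (a : FreeCGA (Sum.elim deg deg)) : pd₂ hO o (pd₂ hO o a) = 0 := by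
  rw [pd₂_eq_contr]; exact contr_sq hO zero_mem_evenPart (single_mem_evenPart o) a

theorem pd₂_pd₁ (o o' : O) (a : FreeCGA (Sum.elim deg deg)) :
    pd₂ hO o (pd₁ hO o' a) = -pd₁ hO o' (pd₂ hO o a) :=
  partialD_anticomm _ _ _ _ _ _

theorem pd₁_comm_pd₁₂ (o o' : O) (a : FreeCGA (Sum.elim deg deg)) :
    pd₁ hO o (pd₁₂ hO o' a) = pd₁₂ hO o' (pd₁ hO o a) := by
  rw [pd₁_eq_contr]
  exact pd₁₂_comm_contr hO (single_mem_evenPart o) zero_mem_evenPart o' a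

theorem pd₂_comm_pd₁₂ (o o' : O) (a : FreeCGA (Sum.elim deg deg)) :
    pd₂ hO o (pd₁₂ hO o' a) = pd₁₂ hO o' (pd₂ hO o a) := by
  rw [pd₂_eq_contr]
  exact pd₁₂_comm_contr hO zero_mem_evenPart (single_mem_evenPart o) o' a

theorem pd₁_pd₁₂ (o : O) (a : FreeCGA (Sum.elim deg deg)) : pd₁ hO o (pd₁₂ hO o a) = 0 :=
  pd₁_pd₁ hO o _

theorem pd₂_pd₁₂ (o : O) (a : FreeCGA (Sum.elim deg deg)) : pd₂ hO o (pd₁₂ hO o a) = 0 := by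
  rw [pd₁₂, LinearMap.comp_apply, pd₂_pd₁, pd₂_pd₂, map_zero, neg_zero]

end Quadratic
end RatTC

namespace RatTC

open FreeCGA

set_option linter.unusedSectionVars false

/-! ### A cocycle in a high power of `ker μ`. -/

section Cocycle

variable {E O : Type} [Fintype O] [DecidableEq E] [DecidableEq O] [Fintype E]

/-- The even elements `x_i ⊗ 1 - 1 ⊗ x_i`. -/
noncomputable def xdiff (deg : E ⊕ O → ℕ) (i : E) : FreeCGA (Sum.elim deg deg) :=
  dx₁ deg i - dx₂ deg i

/-- The even elements `x_i ⊗ 1 + 1 ⊗ x_i`. -/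
noncomputable def xsum (deg : E ⊕ O → ℕ) (i : E) : FreeCGA (Sum.elim deg deg) :=
  dx₁ deg i + dx₂ deg i

/-- The linear form `∑ k, B o i k v_k`. -/
noncomputable def polar {deg : E ⊕ O → ℕ} (B : O → E → E → ℚ)
    (v : E → FreeCGA (Sum.elim deg deg)) (i : E) (o : O) : FreeCGA (Sum.elim deg deg) :=
  ∑ k, B o i k • v k

variable {deg : E ⊕ O → ℕ} (hE : ∀ i, Even (deg (Sum.inl i))) (hO : ∀ o, Odd (deg (Sum.inr o)))
  (B : O → E → E → ℚ)

include hE in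
theorem dx₁_mem (i : E) : dx₁ deg i ∈ evenPart (Sum.elim deg deg) :=
  gen_mem_evenPart (i := Sum.inl (Sum.inl i)) (hE i)

include hE in
theorem dx₂_mem (i : E) : dx₂ deg i ∈ evenPart (Sum.elim deg deg) :=
  gen_mem_evenPart (i := Sum.inr (Sum.inl i)) (hE i)

include hE in
theorem xdiff_mem (i : E) : xdiff deg i ∈ evenPart (Sum.elim deg deg) :=
  sub_mem (dx₁_mem hE i) (dx₂_mem hE i)

include hE in
theorem xsum_mem (i : E) : xsum deg i ∈ evenPart (Sum.elim deg deg) :=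
  add_mem (dx₁_mem hE i) (dx₂_mem hE i)

theorem polar_mem {v : E → FreeCGA (Sum.elim deg deg)}
    (hv : ∀ i, v i ∈ evenPart (Sum.elim deg deg)) (i : E) (o : O) :
    polar B v i o ∈ evenPart (Sum.elim deg deg) :=
  sum_mem fun k _ => Subalgebra.smul_mem _ (hv k) _

/-- The coefficient of `x_i ⊗ 1 - 1 ⊗ x_i` in four times the differential. -/
noncomputable def contrDiff (i : E) : FreeCGA (Sum.elim deg deg) →ₗ[ℚ] FreeCGA (Sum.elim deg deg) :=
  contr hO (polar B (xdiff deg) i) (polar B (xdiff deg) i)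

/-- The coefficient of `x_i ⊗ 1 + 1 ⊗ x_i` in four times the differential. -/
noncomputable def contrSum (i : E) : FreeCGA (Sum.elim deg deg) →ₗ[ℚ] FreeCGA (Sum.elim deg deg) :=
  contr hO (fun o => (2 : ℚ) • polar B (xdiff deg) i o + polar B (xsum deg) i o)
    (fun o => (-2 : ℚ) • polar B (xdiff deg) i o + polar B (xsum deg) i o)

include hE in
theorem contrSum_mem (c : ℚ) (i : E) (o : O) :
    c • polar B (xdiff deg) i o + polar B (xsum deg) i o ∈ evenPart (Sum.elim deg deg) :=
  add_mem (Subalgebra.smul_mem _ (polar_mem B (xdiff_mem hE) i o) _) (polar_mem B (xsum_mem hE) i o)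

theorem inLeft_gen {ι : Type} (deg : ι → ℕ) (i : ι) :
    inLeft deg (gen deg i) = gen _ (Sum.inl i) := rename_gen _ _ _

theorem inRight_gen {ι : Type} (deg : ι → ℕ) (i : ι) :
    inRight deg (gen deg i) = gen _ (Sum.inr i) := rename_gen _ _ _

variable {B} {d : Differential deg} (hd : IsPureQuadratic d B)

include hd in
theorem tensorSq_x₁ (i : E) : (tensorSq d).toLin (dx₁ deg i) = 0 := by
  refine (derivation_gen _ _ _ _).trans ?_
  change inLeft deg (d.toLin (gen deg (Sum.inl i))) = 0
  rw [hd.dx, map_zero]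

include hd in
theorem tensorSq_x₂ (i : E) : (tensorSq d).toLin (dx₂ deg i) = 0 := by
  refine (derivation_gen _ _ _ _).trans ?_
  change inRight deg (d.toLin (gen deg (Sum.inl i))) = 0
  rw [hd.dx, map_zero]

include hd in
theorem tensorSq_y₁ (o : O) : (tensorSq d).toLin (dy₁ deg o) =
    ∑ i, ∑ k, B o i k • (dx₁ deg i * dx₁ deg k) := by
  refine (derivation_gen _ _ _ _).trans ?_
  change inLeft deg (d.toLin (gen deg (Sum.inr o))) = _
  simp [hd.dy, inLeft_gen]

include hd in
theorem tensorSq_y₂ (o : O) : (tensorSq d).toLin (dy₂ deg o) =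
    ∑ i, ∑ k, B o i k • (dx₂ deg i * dx₂ deg k) := by
  refine (derivation_gen _ _ _ _).trans ?_
  change inRight deg (d.toLin (gen deg (Sum.inr o))) = _
  simp [hd.dy, inRight_gen]

include hd in
theorem sum_quadratic_mem_evenPart (o : O) :
    (∑ i, ∑ k, B o i k • (dx₁ deg i * dx₁ deg k)) ∈ evenPart (Sum.elim deg deg) :=
  sum_mem fun _ _ => sum_mem fun _ _ =>
    Subalgebra.smul_mem _ (mul_mem (dx₁_mem hd.even _) (dx₁_mem hd.even _)) _

include hd in
theorem sum_quadratic_mem_evenPart' (o : O) :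
    (∑ i, ∑ k, B o i k • (dx₂ deg i * dx₂ deg k)) ∈ evenPart (Sum.elim deg deg) :=
  sum_mem fun _ _ => sum_mem fun _ _ =>
    Subalgebra.smul_mem _ (mul_mem (dx₂_mem hd.even _) (dx₂_mem hd.even _)) _

include hd in
/-- The differential of `ΛV ⊗ ΛV` as a contraction. -/
theorem tensorSq_eq_contr : (tensorSq d).toLin =
    contr hd.odd (fun o => ∑ i, ∑ k, B o i k • (dx₁ deg i * dx₁ deg k))
      (fun o => ∑ i, ∑ k, B o i k • (dx₂ deg i * dx₂ deg k)) := by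
  refine (tensorSq d).isOddDer.ext (isOddDer_contr _ (sum_quadratic_mem_evenPart hd)
    (sum_quadratic_mem_evenPart' hd)) ?_
  rintro ((i | o) | (i | o))
  · exact (tensorSq_x₁ hd i).trans (contr_x₁ hd.odd _ _ i).symm
  · exact (tensorSq_y₁ hd o).trans (contr_y₁ hd.odd (fun o => ∑ i, ∑ k, B o i k • (dx₁ deg i * dx₁ deg k)) _ o).symm
  · exact (tensorSq_x₂ hd i).trans (contr_x₂ hd.odd _ _ i).symm
  · exact (tensorSq_y₂ hd o).trans (contr_y₂ hd.odd _ (fun o => ∑ i, ∑ k, B o i k • (dx₂ deg i * dx₂ deg k)) o).symm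

theorem sum_sum_swap {A : Type} [Ring A] [Algebra ℚ A] {β : E → E → ℚ}
    (hβ : ∀ i k, β i k = β k i) (x x' : E → A) (hx : ∀ i k, x i * x' k = x' k * x i) :
    ∑ i, ∑ k, β i k • (x' i * x k) = ∑ i, ∑ k, β i k • (x i * x' k) := by
  rw [Finset.sum_comm]
  refine Finset.sum_congr rfl fun i _ => Finset.sum_congr rfl fun k _ => ?_
  rw [hβ, hx]

/-- With `s = x + x'`, `δ = x - x'` and the symmetric form `β`, the left side is `β(s,s) + c β(s,δ)
+ β(δ,δ)`. For `c = ± 2` it is `β(s ± δ, s ± δ)`, that is `4 β(x,x)` or `4 β(x',x')`, the values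
needed on `y_o ⊗ 1` and on `1 ⊗ y_o`. -/
theorem polar_identity {A : Type} [Ring A] [Algebra ℚ A] {β : E → E → ℚ}
    (hβ : ∀ i k, β i k = β k i) (x x' : E → A) (hx : ∀ i k, x i * x' k = x' k * x i) (c : ℚ) :
    ∑ i, ((x i + x' i) * (c • (∑ k, β i k • (x k - x' k)) + ∑ k, β i k • (x k + x' k)) +
      (x i - x' i) * ∑ k, β i k • (x k - x' k)) =
    (2 + c) • (∑ i, ∑ k, β i k • (x i * x k)) + (2 - c) • ∑ i, ∑ k, β i k • (x' i * x' k) := by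
  have h := sum_sum_swap hβ x x' hx
  have h1 : ∀ i k, (x i + x' i) * (c • (β i k • (x k - x' k)) + β i k • (x k + x' k)) +
      (x i - x' i) * (β i k • (x k - x' k)) =
      (2 + c) • (β i k • (x i * x k)) + (2 - c) • (β i k • (x' i * x' k)) +
      (c • (β i k • (x' i * x k)) - c • (β i k • (x i * x' k))) := by
    intro i k
    simp only [mul_add, add_mul, sub_mul, mul_sub, mul_smul_comm, smul_add, smul_sub]
    module
  calc _ = ∑ i, ∑ k, ((x i + x' i) * (c • (β i k • (x k - x' k)) + β i k • (x k + x' k)) +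
      (x i - x' i) * (β i k • (x k - x' k))) := by
        refine Finset.sum_congr rfl fun i _ => ?_
        rw [Finset.smul_sum, ← Finset.sum_add_distrib, Finset.mul_sum, Finset.mul_sum,
          ← Finset.sum_add_distrib]
    _ = _ := by
        simp only [h1, Finset.sum_add_distrib, Finset.sum_sub_distrib, ← Finset.smul_sum, h]
        simp

include hd in
/-- Four times the differential of `ΛV ⊗ ΛV`. -/
theorem tensorSq_eq_sum (a : FreeCGA (Sum.elim deg deg)) : (4 : ℚ) • (tensorSq d).toLin a =
    ∑ i, (xsum deg i * contrSum hd.odd B i a + xdiff deg i * contrDiff hd.odd B i a) := by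
  have hE := hd.even
  have key : (4 : ℚ) • (tensorSq d).toLin =
      ∑ i, (LinearMap.mulLeft ℚ (xsum deg i) ∘ₗ contrSum hd.odd B i +
        LinearMap.mulLeft ℚ (xdiff deg i) ∘ₗ contrDiff hd.odd B i) := by
    refine ((tensorSq d).isOddDer.smul 4).ext (IsOddDer.sum fun i _ => IsOddDer.add
      (IsOddDer.scalar_smul (isScalar_of_mem_evenPart (xsum_mem hE i))
        (isOddDer_contr _ (contrSum_mem hE B 2 i) (contrSum_mem hE B (-2) i)))
      (IsOddDer.scalar_smul (isScalar_of_mem_evenPart (xdiff_mem hE i))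
        (isOddDer_contr _ (polar_mem B (xdiff_mem hE) i) (polar_mem B (xdiff_mem hE) i)))) ?_
    have hx : ∀ i k, dx₁ deg i * dx₂ deg k = dx₂ deg k * dx₁ deg i := fun i k =>
      (isScalar_of_mem_evenPart (dx₁_mem hE i)).comm _
    intro g
    simp only [LinearMap.smul_apply, LinearMap.sum_apply, LinearMap.add_apply,
      LinearMap.comp_apply, LinearMap.mulLeft_apply, contrSum, contrDiff]
    rcases g with ((i | o) | (i | o))
    · rw [tensorSq_x₁ hd, smul_zero]
      refine (Finset.sum_eq_zero fun k _ => ?_).symm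
      rw [contr_x₁, contr_x₁]; simp
    · rw [tensorSq_y₁ hd]
      refine Eq.trans ?_ ((polar_identity (hd.symm o) (dx₁ deg) (dx₂ deg) hx 2).symm.trans
        (Finset.sum_congr rfl fun k _ => ?_))
      · norm_num
      · rw [contr_y₁, contr_y₁]; rfl
    · rw [tensorSq_x₂ hd, smul_zero]
      refine (Finset.sum_eq_zero fun k _ => ?_).symm
      rw [contr_x₂, contr_x₂]; simp
    · rw [tensorSq_y₂ hd]
      refine Eq.trans ?_ ((polar_identity (hd.symm o) (dx₁ deg) (dx₂ deg) hx (-2)).symm.trans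
        (Finset.sum_congr rfl fun k _ => ?_))
      · norm_num
      · rw [contr_y₂, contr_y₂]; rfl
  have := LinearMap.congr_fun key a
  simpa using this

/-- The product of the even elements `(y_o ⊗ 1) (1 ⊗ y_o)` over a list. -/
noncomputable def yProd (deg : E ⊕ O → ℕ) (L : List O) : FreeCGA (Sum.elim deg deg) :=
  (L.map fun o => dy₁ deg o * dy₂ deg o).prod

/-- The operator `contrSum i ∘ contrDiff i`. -/
noncomputable def contrPair (B : O → E → E → ℚ) (i : E) :
    FreeCGA (Sum.elim deg deg) →ₗ[ℚ] FreeCGA (Sum.elim deg deg) :=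
  contrSum hO B i ∘ₗ contrDiff hO B i

include hE in
-- A pair of anticommuting odd operators is even for the purpose of signs, so no ordering issue
-- arises in the product defining `topClass`.
theorem contrPair_comm_contr (B : O → E → E → ℚ) {p q : O → FreeCGA (Sum.elim deg deg)}
    (hp : ∀ o, p o ∈ evenPart (Sum.elim deg deg)) (hq : ∀ o, q o ∈ evenPart (Sum.elim deg deg))
    (i : E) (a : FreeCGA (Sum.elim deg deg)) :
    contr hO p q (contrPair hO B i a) = contrPair hO B i (contr hO p q a) := by
  simp only [contrPair, LinearMap.comp_apply, contrSum, contrDiff]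
  rw [contr_anticomm hO hp hq (contrSum_mem hE B 2 i) (contrSum_mem hE B (-2) i),
    contr_anticomm hO hp hq (polar_mem B (xdiff_mem hE) i) (polar_mem B (xdiff_mem hE) i), map_neg,
    neg_neg]

/-- The cocycle obtained by contracting a product of odd generators. -/
noncomputable def topClass (B : O → E → E → ℚ) (L : List O) : FreeCGA (Sum.elim deg deg) :=
  ((Finset.univ : Finset E).toList.map
    (fun i => (contrPair hO B i : Module.End ℚ (FreeCGA (Sum.elim deg deg))))).prod (yProd deg L)

include hd in
-- By `tensorSq_eq_sum` it is enough that each `contrSum i` and each `contrDiff i` kills the class.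
-- Either one commutes with all the factors `contrPair` and meets its own copy in the factor of
-- index `i`, where its square is zero.
theorem tensorSq_topClass (L : List O) : (tensorSq d).toLin (topClass hd.odd B L) = 0 := by
  have hE := hd.even
  have h4 := tensorSq_eq_sum hd (topClass hd.odd B L)
  have h0 : ∑ i, (xsum deg i * contrSum hd.odd B i (topClass hd.odd B L) +
      xdiff deg i * contrDiff hd.odd B i (topClass hd.odd B L)) = 0 := by
    refine Finset.sum_eq_zero fun i _ => ?_
    have hi : i ∈ (Finset.univ : Finset E).toList := by simp
    rw [topClass, list_prod_kill (T := contrPair hd.odd B) (D := contrSum hd.odd B) ?_ ?_ hi,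
      list_prod_kill (T := contrPair hd.odd B) (D := contrDiff hd.odd B) ?_ ?_ hi]
    · simp
    · exact fun i j a => contrPair_comm_contr hE hd.odd B (polar_mem B (xdiff_mem hE) j)
        (polar_mem B (xdiff_mem hE) j) i a
    · intro j a
      have h := contrPair_comm_contr hE hd.odd B (polar_mem B (xdiff_mem hE) j)
        (polar_mem B (xdiff_mem hE) j) j a
      refine h.trans ?_
      simp only [contrPair, LinearMap.comp_apply, contrDiff]
      rw [contr_sq hd.odd (polar_mem B (xdiff_mem hE) j) (polar_mem B (xdiff_mem hE) j), map_zero]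
    · exact fun i j a => contrPair_comm_contr hE hd.odd B (contrSum_mem hE B 2 j)
        (contrSum_mem hE B (-2) j) i a
    · exact fun j a => contr_sq hd.odd (contrSum_mem hE B 2 j) (contrSum_mem hE B (-2) j) _
  rw [h0] at h4
  simpa using h4

include hO in
-- As `y² = y'² = 0`, one has `y y' = ½ (y - y')(y + y')`, so every factor lies in `ker μ`.
theorem yProd_mem (L : List O) : yProd deg L ∈ kerFil deg L.length := by
  induction L with
  | nil => rw [List.length_nil, kerFil_zero]; trivial
  | cons o L ih =>
    rw [yProd, List.map_cons, List.prod_cons, ← yProd, List.length_cons, add_comm]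
    refine mul_mem_kerFil ?_ ih
    have h1 := gen_sq_of_odd (odd_left (hO o))
    have h2 := gen_sq_of_odd (odd_right (hO o))
    have h3 := gen_mul_gen_of_odd (odd_right (hO o)) (odd_left (hO o))
    have e : dy₁ deg o * dy₂ deg o =
        (1 / 2 : ℚ) • ((dy₁ deg o - dy₂ deg o) * (dy₁ deg o + dy₂ deg o)) := by
      simp only [sub_mul, mul_add, h1, h2, h3]
      module
    rw [e]
    refine Submodule.smul_mem _ _ (mul_mem_kerFil (j := 1) (k := 0) ?_ ?_)
    · rw [← kerMul_le_kerFil]; exact diff_mem_kerMul deg _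
    · rw [kerFil_zero]; trivial

/-- The multiplication intertwines `∂ + ∂'` on `ΛV ⊗ ΛV` with `∂` on `ΛV`. A single `∂` has no such
property and only satisfies `mem_kerFil_of_succ`. -/
theorem pd_add_mem_kerMul (o : O) (a : FreeCGA (Sum.elim deg deg)) (ha : a ∈ kerMul deg) :
    (pd₁ hO o + pd₂ hO o) a ∈ kerMul deg := by
  have key : ∀ b : FreeCGA (Sum.elim deg deg), mulAlgHom deg ((pd₁ hO o + pd₂ hO o) b) =
      partialD deg (Sum.inr o) (hO o) (mulAlgHom deg b) := by
    have h := (isOddDer_partialD _ _ (odd_left (hO o))).add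
      (isOddDer_partialD _ _ (odd_right (hO o)))
    have h' := isOddDer_partialD deg (Sum.inr o) (hO o)
    intro b
    refine ext_word _ (f := (mulAlgHom deg).toLinearMap ∘ₗ (pd₁ hO o + pd₂ hO o))
      (g := partialD deg (Sum.inr o) (hO o) ∘ₗ (mulAlgHom deg).toLinearMap) (fun l => ?_) b
    induction l with
    | nil =>
      simp only [LinearMap.comp_apply, word_nil, AlgHom.toLinearMap_apply, map_one, h'.one]
      exact (congrArg _ h.one).trans (map_zero _)
    | cons g l ih =>
      simp only [LinearMap.comp_apply, AlgHom.toLinearMap_apply] at ih ⊢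
      rw [word_cons, map_mul (mulAlgHom deg), h'.mul]
      refine (congrArg _ (h.mul _ _)).trans ?_
      rw [map_add, map_mul, map_mul]
      refine congrArg₂ (· + ·) (congrArg (· * _) ?_) (congrArg₂ (· * ·) ?_ ih)
      · simp only [LinearMap.add_apply, partialD_gen]
        rcases g with (g | g)
        · rw [mulAlgHom_inl, partialD_gen]
          by_cases hg : g = Sum.inr o <;> simp [hg]
        · rw [mulAlgHom_inr, partialD_gen]
          by_cases hg : g = Sum.inr o <;> simp [hg]
      · rw [mulAlgHom, ← parity_rename]
  rw [mem_kerMul] at *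
  rw [key, ha, map_zero]

theorem polar_xdiff_mem (B : O → E → E → ℚ) (i : E) (o : O) :
    polar B (xdiff deg) i o ∈ kerFil deg 1 := by
  rw [← kerMul_le_kerFil]
  exact Submodule.sum_mem _ fun k _ => Submodule.smul_mem _ _ (diff_mem_kerMul deg _)

theorem pd_add_mem_kerFil {k : ℕ} (o : O) {a : FreeCGA (Sum.elim deg deg)}
    (ha : a ∈ kerFil deg k) : pd₁ hO o a + pd₂ hO o a ∈ kerFil deg k :=
  ((isOddDer_partialD _ _ (odd_left (hO o))).add
    (isOddDer_partialD _ _ (odd_right (hO o)))).mem_kerFil (pd_add_mem_kerMul hO o) ha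

/-- The two coefficients agree, so the operator is `∑ polar(x - x') (∂ + ∂')`: the derivation
preserves the filtration and the coefficient raises it by one. -/
theorem contrDiff_mem_kerFil (B : O → E → E → ℚ) (i : E) {k : ℕ}
    {a : FreeCGA (Sum.elim deg deg)} (ha : a ∈ kerFil deg k) :
    contrDiff hO B i a ∈ kerFil deg (k + 1) := by
  rw [contrDiff, contr_apply]
  refine Submodule.sum_mem _ fun o _ => ?_
  rw [← mul_add, add_comm]
  exact mul_mem_kerFil (polar_xdiff_mem B i o) (pd_add_mem_kerFil hO o ha)

/-- The operator is rewritten as `2 polar(x - x') (∂ - ∂') + polar(x + x') (∂ + ∂')`. In the first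
term the step lost by differentiating is regained from the coefficient; the second term loses
nothing. -/
theorem contrSum_mem_kerFil (B : O → E → E → ℚ) (i : E) {k : ℕ}
    {a : FreeCGA (Sum.elim deg deg)} (ha : a ∈ kerFil deg (k + 1)) :
    contrSum hO B i a ∈ kerFil deg (k + 1) := by
  rw [contrSum, contr_apply]
  refine Submodule.sum_mem _ fun o _ => ?_
  have e : ((2 : ℚ) • polar B (xdiff deg) i o + polar B (xsum deg) i o) * pd₁ hO o a +
      ((-2 : ℚ) • polar B (xdiff deg) i o + polar B (xsum deg) i o) * pd₂ hO o a =
      (2 : ℚ) • (polar B (xdiff deg) i o * (pd₁ hO o a - pd₂ hO o a)) +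
        polar B (xsum deg) i o * (pd₁ hO o a + pd₂ hO o a) := by
    simp only [add_mul, mul_sub, mul_add, smul_mul_assoc]
    module
  rw [e]
  refine Submodule.add_mem _ (Submodule.smul_mem _ _ ?_) ?_
  · rw [add_comm]
    exact mul_mem_kerFil (polar_xdiff_mem B i o) (Submodule.sub_mem _
      ((isOddDer_partialD _ _ _).mem_kerFil_of_succ ha)
      ((isOddDer_partialD _ _ _).mem_kerFil_of_succ ha))
  · have := mul_mem_kerFil (j := 0) (a := polar B (xsum deg) i o) (by rw [kerFil_zero]; trivial)
      (pd_add_mem_kerFil hO o ha)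
    rwa [zero_add] at this

theorem topClass_mem (B : O → E → E → ℚ) (L : List O) :
    topClass hO B L ∈ kerFil deg (L.length + Fintype.card E) := by
  have key : ∀ L' : List E, (L'.map (fun i => (contrPair hO B i :
      Module.End ℚ (FreeCGA (Sum.elim deg deg))))).prod (yProd deg L) ∈
      kerFil deg (L.length + L'.length) := by
    intro L'
    induction L' with
    | nil => exact yProd_mem hO L
    | cons i L' ih =>
      rw [List.map_cons, List.prod_cons, Module.End.mul_apply, List.length_cons, ← add_assoc]
      exact contrSum_mem_kerFil hO B i (contrDiff_mem_kerFil hO B i ih)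
  have := key (Finset.univ : Finset E).toList
  rwa [Finset.length_toList, Finset.card_univ] at this

end Cocycle
end RatTC

namespace RatTC

open FreeCGA

set_option linter.unusedSectionVars false

/-! ### Second derivatives that strip odd generators, and the projection to polynomials. -/

section Detect

variable {E O : Type} [Fintype O] [DecidableEq E] [DecidableEq O]
variable {deg : E ⊕ O → ℕ} (hE : ∀ i, Even (deg (Sum.inl i))) (hO : ∀ o, Odd (deg (Sum.inr o)))

theorem pd₁_pd₁_comm (o o' : O) (a : FreeCGA (Sum.elim deg deg)) :
    pd₁ hO o (pd₁ hO o' a) = -pd₁ hO o' (pd₁ hO o a) := partialD_anticomm _ _ _ _ _ _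

theorem pd₂_pd₂_comm (o o' : O) (a : FreeCGA (Sum.elim deg deg)) :
    pd₂ hO o (pd₂ hO o' a) = -pd₂ hO o' (pd₂ hO o a) := partialD_anticomm _ _ _ _ _ _

theorem pd₁_pd₂ (o o' : O) (a : FreeCGA (Sum.elim deg deg)) :
    pd₁ hO o (pd₂ hO o' a) = -pd₂ hO o' (pd₁ hO o a) := partialD_anticomm _ _ _ _ _ _

include hO in
theorem isScalar_y₁_mul_y₂ (o : O) : IsScalar (dy₁ deg o * dy₂ deg o) where
  comm a := by
    have h1 := mul_gen_of_odd (odd_left (hO o)) a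
    have h2 := mul_gen_of_odd (odd_right (hO o)) (parity _ a)
    rw [parity_parity] at h2
    rw [← mul_assoc, h1, mul_assoc, mul_assoc, h2]
  parity := by
    rw [map_mul, parity_gen, parity_gen, (odd_left (hO o)).neg_one_pow,
      (odd_right (hO o)).neg_one_pow]
    simp

theorem pd₁_y₁y₂ {o o' : O} (h : o' ≠ o) : pd₁ hO o (dy₁ deg o' * dy₂ deg o') = 0 := by
  refine (isOddDer_partialD _ _ _).mul_eq_zero ?_ ?_ <;> rw [partialD_gen] <;> simp [h]

theorem pd₂_y₁y₂ {o o' : O} (h : o' ≠ o) : pd₂ hO o (dy₁ deg o' * dy₂ deg o') = 0 := by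
  refine (isOddDer_partialD _ _ _).mul_eq_zero ?_ ?_ <;> rw [partialD_gen] <;> simp [h]

theorem pd₁_mul {o o' : O} (h : o' ≠ o) (a : FreeCGA (Sum.elim deg deg)) :
    pd₁ hO o (dy₁ deg o' * dy₂ deg o' * a) = dy₁ deg o' * dy₂ deg o' * pd₁ hO o a :=
  (isOddDer_partialD _ _ _).scalar_mul (isScalar_y₁_mul_y₂ hO o') (pd₁_y₁y₂ hO h) a

theorem pd₂_mul {o o' : O} (h : o' ≠ o) (a : FreeCGA (Sum.elim deg deg)) :
    pd₂ hO o (dy₁ deg o' * dy₂ deg o' * a) = dy₁ deg o' * dy₂ deg o' * pd₂ hO o a :=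
  (isOddDer_partialD _ _ _).scalar_mul (isScalar_y₁_mul_y₂ hO o') (pd₂_y₁y₂ hO h) a

theorem pd₁₂_mul {o o' : O} (h : o' ≠ o) (a : FreeCGA (Sum.elim deg deg)) :
    pd₁₂ hO o (dy₁ deg o' * dy₂ deg o' * a) = dy₁ deg o' * dy₂ deg o' * pd₁₂ hO o a := by
  simp only [pd₁₂, LinearMap.comp_apply]
  rw [pd₂_mul hO h, pd₁_mul hO h]

theorem pd₁₂_mul_self (o : O) {a : FreeCGA (Sum.elim deg deg)} (h1 : pd₁ hO o a = 0)
    (h2 : pd₂ hO o a = 0) : pd₁₂ hO o (dy₁ deg o * dy₂ deg o * a) = -a := by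
  have hd1 := isOddDer_partialD (Sum.elim deg deg) _ (odd_left (hO o))
  have hd2 := isOddDer_partialD (Sum.elim deg deg) _ (odd_right (hO o))
  change partialD (Sum.elim deg deg) _ (odd_left (hO o)) a = 0 at h1
  change partialD (Sum.elim deg deg) _ (odd_right (hO o)) a = 0 at h2
  change partialD (Sum.elim deg deg) _ (odd_left (hO o))
    (partialD (Sum.elim deg deg) _ (odd_right (hO o)) _) = _
  rw [mul_assoc, hd2.mul, hd2.mul, h2, partialD_gen, partialD_gen, parity_gen,
    (odd_left (hO o)).neg_one_pow]
  simp only [reduceCtorEq, if_false, if_true, zero_mul, mul_zero, add_zero, one_mul, zero_add,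
    neg_smul, one_smul, neg_mul, map_neg]
  rw [hd1.mul, h1, partialD_gen]
  simp

theorem yProd_cons (o : O) (L : List O) :
    yProd deg (o :: L) = dy₁ deg o * dy₂ deg o * yProd deg L := by simp [yProd]

theorem pd₁_yProd_mul {o : O} {L : List O} (h : o ∉ L) {a : FreeCGA (Sum.elim deg deg)}
    (ha : pd₁ hO o a = 0) : pd₁ hO o (yProd deg L * a) = 0 := by
  induction L with
  | nil => simpa [yProd] using ha
  | cons o' L ih =>
    simp only [List.mem_cons, not_or] at h
    rw [yProd_cons, mul_assoc, pd₁_mul hO (Ne.symm h.1), ih h.2, mul_zero]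

theorem pd₂_yProd_mul {o : O} {L : List O} (h : o ∉ L) {a : FreeCGA (Sum.elim deg deg)}
    (ha : pd₂ hO o a = 0) : pd₂ hO o (yProd deg L * a) = 0 := by
  induction L with
  | nil => simpa [yProd] using ha
  | cons o' L ih =>
    simp only [List.mem_cons, not_or] at h
    rw [yProd_cons, mul_assoc, pd₂_mul hO (Ne.symm h.1), ih h.2, mul_zero]

/-- Iterated second derivatives. -/
noncomputable def pdList (L : List O) : Module.End ℚ (FreeCGA (Sum.elim deg deg)) :=
  (L.map fun o => (pd₁₂ hO o : Module.End ℚ (FreeCGA (Sum.elim deg deg)))).prod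

theorem pdList_cons (o : O) (L : List O) (a : FreeCGA (Sum.elim deg deg)) :
    pdList hO (o :: L) a = pd₁₂ hO o (pdList hO L a) := by
  rw [pdList, List.map_cons, List.prod_cons, Module.End.mul_apply]; rfl

theorem pdList_mul {o : O} {L : List O} (h : o ∉ L) (a : FreeCGA (Sum.elim deg deg)) :
    pdList hO L (dy₁ deg o * dy₂ deg o * a) = dy₁ deg o * dy₂ deg o * pdList hO L a := by
  induction L with
  | nil => simp [pdList]
  | cons o' L ih =>
    simp only [List.mem_cons, not_or] at h
    rw [pdList_cons, ih h.2, pd₁₂_mul hO h.1, pdList_cons]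

/-- Each `∂_o ∂'_o` removes its own factor `y_o y'_o`, with a sign `-1`, and passes through the
other factors, which are central and even. -/
theorem pdList_yProd {L : List O} (hL : L.Nodup) {a : FreeCGA (Sum.elim deg deg)}
    (h1 : ∀ o ∈ L, pd₁ hO o a = 0) (h2 : ∀ o ∈ L, pd₂ hO o a = 0) :
    pdList hO L (yProd deg L * a) = (-1 : ℚ) ^ L.length • a := by
  induction L with
  | nil => simp [pdList, yProd]
  | cons o L ih =>
    rw [List.nodup_cons] at hL
    rw [pdList_cons, yProd_cons, mul_assoc, pdList_mul hO hL.1,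
      ih hL.2 (fun o h => h1 o (by simp [h])) (fun o h => h2 o (by simp [h])),
      pd₁₂_mul_self, List.length_cons, pow_succ]
    · simp
    · rw [map_smul, h1 o (by simp), smul_zero]
    · rw [map_smul, h2 o (by simp), smul_zero]

theorem pd₁_pdList {o : O} {L : List O} (h : o ∈ L) (a : FreeCGA (Sum.elim deg deg)) :
    pd₁ hO o (pdList hO L a) = 0 :=
  list_prod_kill (T := pd₁₂ hO) (D := pd₁ hO) (fun i j a => pd₁_comm_pd₁₂ hO j i a)
    (fun i a => pd₁_pd₁₂ hO i a) h a

theorem pd₂_pdList {o : O} {L : List O} (h : o ∈ L) (a : FreeCGA (Sum.elim deg deg)) :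
    pd₂ hO o (pdList hO L a) = 0 :=
  list_prod_kill (T := pd₁₂ hO) (D := pd₂ hO) (fun i j a => pd₂_comm_pd₁₂ hO j i a)
    (fun i a => pd₂_pd₁₂ hO i a) h a

theorem contr_comm_pdList {p q : O → FreeCGA (Sum.elim deg deg)}
    (hp : ∀ o, p o ∈ evenPart (Sum.elim deg deg)) (hq : ∀ o, q o ∈ evenPart (Sum.elim deg deg))
    (L : List O) (a : FreeCGA (Sum.elim deg deg)) :
    contr hO p q (pdList hO L a) = pdList hO L (contr hO p q a) :=
  list_prod_comm (T := pd₁₂ hO) (fun o _ b => pd₁₂_comm_contr hO hp hq o b) a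

/-- The projection of `ΛV ⊗ ΛV` onto the polynomial algebra on its even generators. -/
noncomputable def toPoly : FreeCGA (Sum.elim deg deg) →ₐ[ℚ] MvPolynomial (E ⊕ E) ℚ :=
  lift (Sum.elim deg deg) (Sum.elim
    (Sum.elim (fun i => MvPolynomial.X (Sum.inl i)) (fun _ => 0))
    (Sum.elim (fun i => MvPolynomial.X (Sum.inr i)) (fun _ => 0))) (by
    rintro ((i | o) | (i | o)) ((j | o') | (j | o')) <;>
      simp [(hE _).neg_one_pow, pow_mul, mul_comm])

theorem toPoly_x₁ (i : E) : toPoly hE (dx₁ deg i) = MvPolynomial.X (Sum.inl i) := lift_gen _ _ _ _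
theorem toPoly_x₂ (i : E) : toPoly hE (dx₂ deg i) = MvPolynomial.X (Sum.inr i) := lift_gen _ _ _ _

end Detect

/-- The ideal generated by the squares of the variables. -/
noncomputable def squareIdeal (τ : Type) : Ideal (MvPolynomial τ ℚ) :=
  Ideal.span (Set.range fun i => MvPolynomial.X i ^ 2)

/-- The product of all the variables is divisible by no square of a variable. -/
theorem coeff_squareIdeal {τ : Type} [Fintype τ] {p : MvPolynomial τ ℚ} (hp : p ∈ squareIdeal τ) :
    p.coeff (Finsupp.equivFunOnFinite.symm fun _ => 1) = 0 := by
  classical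
  -- The arbitrary multiplier `q` lets the induction pass through multiplication by polynomials.
  have key : ∀ q : MvPolynomial τ ℚ, MvPolynomial.coeff
      (Finsupp.equivFunOnFinite.symm fun _ => 1) (q * p) = 0 := by
    refine Submodule.span_induction (p := fun p _ => ∀ q, MvPolynomial.coeff
      (Finsupp.equivFunOnFinite.symm fun _ => 1) (q * p) = 0) ?_ ?_ ?_ ?_ hp
    · rintro _ ⟨i, rfl⟩ q
      simp only [MvPolynomial.X_pow_eq_monomial]
      rw [MvPolynomial.coeff_mul_monomial', if_neg]
      intro h
      have := h i
      simp at this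
    · simp
    · intro x y _ _ hx hy q; rw [mul_add, MvPolynomial.coeff_add, hx, hy, add_zero]
    · intro r x _ hx q; rw [smul_eq_mul, ← mul_assoc]; exact hx _
  simpa using key 1

/-! ### Non-exactness of the cocycle when every `x_i²` is a boundary. -/

section DetectExtension

variable {E F : Type} [Fintype E] [Fintype F] [DecidableEq E] [DecidableEq F]
  {deg : E ⊕ (E ⊕ F) → ℕ} {B : E ⊕ F → E → E → ℚ}
  {d : Differential deg} (hd : IsPureQuadratic d B)
  (hB : ∀ e i k, B (Sum.inl e) i k = if i = e ∧ k = e then 1 else 0)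

include hB in
theorem polar_inl (v : E → FreeCGA (Sum.elim deg deg)) (i e : E) :
    polar B v i (Sum.inl e) = if i = e then v e else 0 := by
  by_cases h : i = e <;> simp [polar, hB, h]

include hB in
theorem contr_inl (p q : E ⊕ F → FreeCGA (Sum.elim deg deg)) (i : E)
    (hp : ∀ e, e ≠ i → p (Sum.inl e) = 0) (hq : ∀ e, e ≠ i → q (Sum.inl e) = 0)
    {a : FreeCGA (Sum.elim deg deg)}
    (h1 : ∀ f, pd₁ hd.odd (Sum.inr f) a = 0) (h2 : ∀ f, pd₂ hd.odd (Sum.inr f) a = 0) :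
    contr hd.odd p q a =
      p (Sum.inl i) * pd₁ hd.odd (Sum.inl i) a + q (Sum.inl i) * pd₂ hd.odd (Sum.inl i) a := by
  rw [contr_apply, Fintype.sum_sum_type, Finset.sum_eq_single i, Finset.sum_eq_zero, add_zero]
  · intro f _; rw [h1, h2]; simp
  · intro e _ he; rw [hp e he, hq e he]; simp
  · simp

include hB in
-- Without the `y_f` only the derivatives `∂`, `∂'` along the two copies of `u_i` contribute. With
-- `δ = x_i - x'_i` and `s = x_i + x'_i`, the operators are `D_i = δ (∂ + ∂')` and `S_i = 2δ (∂ -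
-- ∂') + s (∂ + ∂')`. Since `(∂ + ∂')² = 0` and `(∂ - ∂')(∂ + ∂') = 2 ∂∂'`, their composite is `4δ²
-- ∂∂'`.
theorem contrPair_inl (i : E) {a : FreeCGA (Sum.elim deg deg)}
    (h1 : ∀ f, pd₁ hd.odd (Sum.inr f) a = 0) (h2 : ∀ f, pd₂ hd.odd (Sum.inr f) a = 0) :
    contrPair hd.odd B i a =
      ((4 : ℚ) • xdiff deg i ^ 2) * pd₁₂ hd.odd (Sum.inl i) a := by
  have hE := hd.even
  have hz : ∀ (c : ℚ) e, e ≠ i → c • polar B (xdiff deg) i (Sum.inl e) +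
      polar B (xsum deg) i (Sum.inl e) = 0 := by
    intro c e he
    simp [polar_inl hB, Ne.symm he]
  have hz' : ∀ e, e ≠ i → polar B (xdiff deg) i (Sum.inl e) = 0 := by
    intro e he
    simp [polar_inl hB, Ne.symm he]
  rw [contrPair, LinearMap.comp_apply, contrSum, contr_inl hd hB _ _ i (hz 2) (hz (-2)), contrDiff]
  · rw [pd₁_anticomm_contr hd.odd (polar_mem B (xdiff_mem hE) i) (polar_mem B (xdiff_mem hE) i),
      pd₂_anticomm_contr hd.odd (polar_mem B (xdiff_mem hE) i) (polar_mem B (xdiff_mem hE) i),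
      contr_inl hd hB _ _ i hz' hz', contr_inl hd hB _ _ i hz' hz', pd₁_pd₁, pd₂_pd₂, pd₂_pd₁]
    · simp only [polar_inl hB, if_true, pd₁₂, LinearMap.comp_apply]
      generalize pd₁ hd.odd (Sum.inl i) (pd₂ hd.odd (Sum.inl i) a) = b
      simp only [mul_zero, zero_add, add_zero, mul_neg, neg_neg, add_mul, smul_mul_assoc, pow_two,
        mul_assoc]
      module
    · intro f; rw [pd₁_pd₂, h1, map_zero, neg_zero]
    · intro f; rw [pd₂_pd₂_comm, h2, map_zero, neg_zero]
    · intro f; rw [pd₁_pd₁_comm, h1, map_zero, neg_zero]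
    · intro f; rw [pd₂_pd₁, h2, map_zero, neg_zero]
  · intro f
    rw [contrDiff, pd₁_anticomm_contr hd.odd (polar_mem B (xdiff_mem hE) i)
      (polar_mem B (xdiff_mem hE) i), h1, map_zero, neg_zero]
  · intro f
    rw [contrDiff, pd₂_anticomm_contr hd.odd (polar_mem B (xdiff_mem hE) i)
      (polar_mem B (xdiff_mem hE) i), h2, map_zero, neg_zero]

include hB in
theorem contrPair_list (L : List E) {a : FreeCGA (Sum.elim deg deg)}
    (h1 : ∀ f, pd₁ hd.odd (Sum.inr f) a = 0) (h2 : ∀ f, pd₂ hd.odd (Sum.inr f) a = 0) :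
    (L.map (fun i => (contrPair hd.odd B i :
      Module.End ℚ (FreeCGA (Sum.elim deg deg))))).prod a =
      (L.map fun i => (4 : ℚ) • xdiff deg i ^ 2).prod * pdList hd.odd (L.map Sum.inl) a := by
  have hE := hd.even
  have hx : ∀ i, (4 : ℚ) • xdiff deg i ^ 2 ∈ evenPart (Sum.elim deg deg) := fun i =>
    Subalgebra.smul_mem _ (pow_mem (xdiff_mem hE i) 2) _
  have hxl : ∀ L : List E, (L.map fun i => (4 : ℚ) • xdiff deg i ^ 2).prod ∈
      evenPart (Sum.elim deg deg) := by
    intro L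
    refine list_prod_mem fun b hb => ?_
    obtain ⟨i, -, rfl⟩ := List.mem_map.1 hb
    exact hx i
  induction L with
  | nil => simp [pdList]
  | cons i L ih =>
    have hs := isScalar_of_mem_evenPart (hxl L)
    have e1 : ∀ o b, pd₁ hd.odd o ((L.map fun i => (4 : ℚ) • xdiff deg i ^ 2).prod * b) =
        (L.map fun i => (4 : ℚ) • xdiff deg i ^ 2).prod * pd₁ hd.odd o b := fun o b =>
      (isOddDer_partialD _ _ _).scalar_mul hs (partialD_eq_zero _ (hxl L)) b
    have e2 : ∀ o b, pd₂ hd.odd o ((L.map fun i => (4 : ℚ) • xdiff deg i ^ 2).prod * b) =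
        (L.map fun i => (4 : ℚ) • xdiff deg i ^ 2).prod * pd₂ hd.odd o b := fun o b =>
      (isOddDer_partialD _ _ _).scalar_mul hs (partialD_eq_zero _ (hxl L)) b
    rw [List.map_cons, List.prod_cons, Module.End.mul_apply, ih, contrPair_inl hd hB]
    · rw [List.map_cons, List.map_cons, List.prod_cons, pdList_cons]
      simp only [pd₁₂, LinearMap.comp_apply, e1, e2]
      rw [mul_assoc]
    · intro f
      rw [e1, pdList, list_prod_comm (D := pd₁ hd.odd (Sum.inr f)) (T := pd₁₂ hd.odd), h1,
        map_zero, mul_zero]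
      exact fun o _ b => pd₁_comm_pd₁₂ _ _ _ _
    · intro f
      rw [e2, pdList, list_prod_comm (D := pd₂ hd.odd (Sum.inr f)) (T := pd₁₂ hd.odd), h2,
        map_zero, mul_zero]
      exact fun o _ b => pd₂_comm_pd₁₂ _ _ _ _

include hB in
/-- The differential of an element without generators `y_f` is in the ideal of squares. -/
theorem toPoly_tensorSq_mem {a : FreeCGA (Sum.elim deg deg)}
    (h1 : ∀ f, pd₁ hd.odd (Sum.inr f) a = 0) (h2 : ∀ f, pd₂ hd.odd (Sum.inr f) a = 0) :
    toPoly hd.even ((tensorSq d).toLin a) ∈ squareIdeal (E ⊕ E) := by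
  rw [tensorSq_eq_contr hd, contr_apply, map_sum]
  refine Ideal.sum_mem _ fun o _ => ?_
  rcases o with e | f
  · have s1 : ∑ i, ∑ k, B (Sum.inl e) i k • (dx₁ deg i * dx₁ deg k) = dx₁ deg e ^ 2 := by
      rw [Finset.sum_eq_single e, Finset.sum_eq_single e] <;> simp +contextual [hB, pow_two]
    have s2 : ∑ i, ∑ k, B (Sum.inl e) i k • (dx₂ deg i * dx₂ deg k) = dx₂ deg e ^ 2 := by
      rw [Finset.sum_eq_single e, Finset.sum_eq_single e] <;> simp +contextual [hB, pow_two]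
    rw [s1, s2, map_add, map_mul, map_mul, map_pow, map_pow, toPoly_x₁, toPoly_x₂]
    exact Ideal.add_mem _ (Ideal.mul_mem_right _ _ (Ideal.subset_span ⟨_, rfl⟩))
      (Ideal.mul_mem_right _ _ (Ideal.subset_span ⟨_, rfl⟩))
  · rw [h1, h2]; simp

/-- Modulo squares of the variables, `4 (X - X')²` is `-8 X X'`, so the product is `(-8)^|E|` times
the product of all the variables, and `coeff_squareIdeal` compares the coefficients. -/
theorem coeff_prod_sq_ne_zero :
    (((Finset.univ : Finset E).toList.map fun i => (4 : ℚ) • ((MvPolynomial.X (Sum.inl i) -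
      MvPolynomial.X (Sum.inr i) : MvPolynomial (E ⊕ E) ℚ) ^ 2)).prod).coeff
      (Finsupp.equivFunOnFinite.symm fun _ => 1) ≠ 0 := by
  set m : E ⊕ E →₀ ℕ := Finsupp.equivFunOnFinite.symm fun _ => 1 with hm
  have hmod : (((Finset.univ : Finset E).toList.map fun i => (4 : ℚ) • ((MvPolynomial.X (Sum.inl i) -
      MvPolynomial.X (Sum.inr i) : MvPolynomial (E ⊕ E) ℚ) ^ 2)).prod) -
      MvPolynomial.monomial m ((-8 : ℚ) ^ Fintype.card E) ∈ squareIdeal (E ⊕ E) := by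
    rw [← Ideal.Quotient.eq, Finset.prod_map_toList]
    have hmono : MvPolynomial.monomial m ((-8 : ℚ) ^ Fintype.card E) =
        ∏ i : E, ((-8 : ℚ) • (MvPolynomial.X (Sum.inl i) * MvPolynomial.X (Sum.inr i))) := by
      have : (MvPolynomial.monomial m ((-8 : ℚ) ^ Fintype.card E) : MvPolynomial (E ⊕ E) ℚ) =
          MvPolynomial.C ((-8 : ℚ) ^ Fintype.card E) * ∏ i : E ⊕ E, MvPolynomial.X i := by
        rw [MvPolynomial.monomial_eq, Finsupp.prod_fintype]
        · simp [hm]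
        · simp
      rw [this, Fintype.prod_sum_type, ← Finset.prod_mul_distrib]
      simp only [MvPolynomial.smul_eq_C_mul]
      rw [Finset.prod_mul_distrib (f := fun _ => MvPolynomial.C (-8 : ℚ)), Finset.prod_const,
        Finset.card_univ, map_pow]
    rw [hmono, map_prod, map_prod]
    refine Finset.prod_congr rfl fun i _ => ?_
    rw [Ideal.Quotient.eq]
    have e : (4 : ℚ) • ((MvPolynomial.X (Sum.inl i) -
        MvPolynomial.X (Sum.inr i) : MvPolynomial (E ⊕ E) ℚ) ^ 2) -
        (-8 : ℚ) • (MvPolynomial.X (Sum.inl i) * MvPolynomial.X (Sum.inr i)) =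
        4 * MvPolynomial.X (Sum.inl i) ^ 2 + 4 * MvPolynomial.X (Sum.inr i) ^ 2 := by
      simp only [Algebra.smul_def, map_neg, map_ofNat]
      ring
    rw [e]
    exact Ideal.add_mem _ (Ideal.mul_mem_left _ _ (Ideal.subset_span ⟨_, rfl⟩))
      (Ideal.mul_mem_left _ _ (Ideal.subset_span ⟨_, rfl⟩))
  have h0 := coeff_squareIdeal hmod
  rw [← hm, MvPolynomial.coeff_sub, MvPolynomial.coeff_monomial, if_pos rfl, sub_eq_zero] at h0
  rw [h0]
  positivity

/-- All odd generators `u_i` and `y_f`. -/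
noncomputable def oddList (E F : Type) [Fintype E] [Fintype F] : List (E ⊕ F) :=
  (Finset.univ : Finset F).toList.map Sum.inr ++ (Finset.univ : Finset E).toList.map Sum.inl

theorem yProd_append {O : Type} {deg : E ⊕ O → ℕ} (L L' : List O) :
    yProd deg (L ++ L') = yProd deg L * yProd deg L' := by simp [yProd]

include hB in
/-- The class of `topClass` is not zero. -/
theorem topClass_not_exact (a : FreeCGA (Sum.elim deg deg)) :
    (tensorSq d).toLin a ≠ topClass hd.odd B (oddList E F) := by
  have hE := hd.even
  intro ha
  set LF : List (E ⊕ F) := (Finset.univ : Finset F).toList.map Sum.inr with hLF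
  set LE : List (E ⊕ F) := (Finset.univ : Finset E).toList.map Sum.inl with hLE
  have hnF : LF.Nodup := (Finset.nodup_toList _).map Sum.inr_injective
  have hnE : LE.Nodup := (Finset.nodup_toList _).map Sum.inl_injective
  have hmem : ∀ f, Sum.inr f ∈ LF := by simp [hLF]
  have hne : ∀ f, Sum.inr f ∉ LE := by simp [hLE]
  -- `pdList hd.odd LF` commutes with the differential, and its values no longer involve the `y_f`;
  -- hence the image of the boundary falls into the ideal of squares.
  have h1 : toPoly hE (pdList hd.odd LF ((tensorSq d).toLin a)) ∈ squareIdeal (E ⊕ E) := by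
    rw [tensorSq_eq_contr hd, ← contr_comm_pdList _ (sum_quadratic_mem_evenPart hd)
      (sum_quadratic_mem_evenPart' hd), ← tensorSq_eq_contr hd]
    exact toPoly_tensorSq_mem hd hB (fun f => pd₁_pdList _ (hmem f) _)
      (fun f => pd₂_pdList _ (hmem f) _)
  have hp1 : ∀ f, pd₁ hd.odd (Sum.inr f) (yProd deg LE) = 0 := by
    intro f
    have := pd₁_yProd_mul hd.odd (hne f) (a := 1) (isOddDer_partialD _ _ _).one
    rwa [mul_one] at this
  have hp2 : ∀ f, pd₂ hd.odd (Sum.inr f) (yProd deg LE) = 0 := by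
    intro f
    have := pd₂_yProd_mul hd.odd (hne f) (a := 1) (isOddDer_partialD _ _ _).one
    rwa [mul_one] at this
  -- The same operator also commutes with the contractions, so it first strips the factors `y_f
  -- y'_f`. On the remaining product of the `u_i u'_i` the contractions are given by
  -- `contrPair_list`.
  have h2 : pdList hd.odd LF (topClass hd.odd B (oddList E F)) =
      ((Finset.univ : Finset E).toList.map fun i => (4 : ℚ) • xdiff deg i ^ 2).prod *
        ((-1 : ℚ) ^ LF.length • (-1 : ℚ) ^ LE.length • 1) := by
    have hc : pdList hd.odd LF (topClass hd.odd B (oddList E F)) =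
        ((Finset.univ : Finset E).toList.map (fun i => (contrPair hd.odd B i :
          Module.End ℚ (FreeCGA (Sum.elim deg deg))))).prod
          (pdList hd.odd LF (yProd deg (oddList E F))) := by
      refine list_prod_comm (D := pdList hd.odd LF) (T := contrPair hd.odd B) (fun i _ b => ?_) _
      simp only [contrPair, LinearMap.comp_apply, contrSum, contrDiff]
      rw [contr_comm_pdList _ (polar_mem B (xdiff_mem hE) i) (polar_mem B (xdiff_mem hE) i),
        contr_comm_pdList _ (contrSum_mem hE B 2 i) (contrSum_mem hE B (-2) i)]
    rw [hc, oddList, yProd_append, ← hLF, ← hLE, pdList_yProd]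
    · rw [map_smul, contrPair_list hd hB _ hp1 hp2, ← hLE]
      have := pdList_yProd hd.odd hnE (a := 1) (fun o _ => (isOddDer_partialD _ _ _).one)
        (fun o _ => (isOddDer_partialD _ _ _).one)
      rw [mul_one] at this
      rw [this]
      simp only [mul_smul_comm]
    · exact hnF
    · intro o ho
      obtain ⟨f, -, rfl⟩ := List.mem_map.1 ho
      exact hp1 f
    · intro o ho
      obtain ⟨f, -, rfl⟩ := List.mem_map.1 ho
      exact hp2 f
  rw [ha, h2, map_mul, map_smul, map_smul, map_one, mul_smul_comm, mul_smul_comm, mul_one,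
    map_list_prod, List.map_map] at h1
  have h3 := coeff_squareIdeal h1
  rw [MvPolynomial.coeff_smul, MvPolynomial.coeff_smul, smul_eq_mul, smul_eq_mul] at h3
  refine coeff_prod_sq_ne_zero (E := E) ?_
  have e : (⇑(toPoly hE) ∘ fun i => (4 : ℚ) • xdiff deg i ^ 2) = fun i =>
      (4 : ℚ) • ((MvPolynomial.X (Sum.inl i) -
      MvPolynomial.X (Sum.inr i) : MvPolynomial (E ⊕ E) ℚ) ^ 2) := by
    funext i
    simp only [Function.comp_apply, map_smul, map_pow, xdiff, map_sub, toPoly_x₁, toPoly_x₂]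
  rw [e] at h3
  simpa using h3

end DetectExtension
end RatTC

namespace RatTC

open FreeCGA

/-! ### A pigeonhole principle for powers of sums of ideals. -/

section Pigeonhole

/-- In the binomial expansion every term contains `P` at least `a + 1` times or `D` at least `c + 1`
times. -/
theorem sup_pow_le {A : Type} [Ring A] [Algebra ℚ A] {P D J : Submodule ℚ A} (hc : Commute P D)
    (hP : P * ⊤ ≤ P) (hJ : ⊤ * J ≤ J) (hJ' : J * ⊤ ≤ J) {a c : ℕ} (hD : D ^ (c + 1) ≤ J) :
    (P + D) ^ (a + c + 1) ≤ P ^ (a + 1) + J := by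
  rw [hc.add_pow]
  have hle : ∀ (s : Finset ℕ) (f : ℕ → Submodule ℚ A) (T : Submodule ℚ A),
      (∀ i ∈ s, f i ≤ T) → ∑ i ∈ s, f i ≤ T := by
    intro s f T h
    induction s using Finset.induction_on with
    | empty => simp
    | insert i s hi ih =>
      rw [Finset.sum_insert hi]
      exact sup_le (h i (by simp)) (ih fun j hj => h j (by simp [hj]))
  refine hle _ _ _ fun i hi => ?_
  rw [Finset.mem_range] at hi
  rw [mul_assoc]
  by_cases hi' : a + 1 ≤ i
  · refine le_trans ?_ le_sup_left
    obtain ⟨e, rfl⟩ := Nat.exists_eq_add_of_le hi'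
    rw [pow_add, mul_assoc]
    calc P ^ (a + 1) * _ ≤ P ^ (a + 1) * ⊤ := mul_le_mul' le_rfl le_top
      _ = P ^ a * (P * ⊤) := by rw [pow_succ, mul_assoc]
      _ ≤ P ^ a * P := mul_le_mul' le_rfl hP
      _ = P ^ (a + 1) := (pow_succ _ _).symm
  · refine le_trans ?_ le_sup_right
    obtain ⟨e, he⟩ := Nat.exists_eq_add_of_le (show c + 1 ≤ a + c + 1 - i by omega)
    rw [he, pow_add]
    calc P ^ i * (D ^ (c + 1) * D ^ e * _) ≤ ⊤ * (J * ⊤ * ⊤) :=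
          mul_le_mul' le_top (mul_le_mul' (mul_le_mul' hD le_top) le_top)
      _ ≤ ⊤ * (J * ⊤) := mul_le_mul' le_rfl (mul_le_mul' hJ' le_rfl)
      _ ≤ ⊤ * J := mul_le_mul' le_rfl hJ'
      _ ≤ J := hJ

/-- The pigeonhole principle for powers of a sum of commuting ideals. -/
theorem add_list_sum_pow_le {A τ : Type} [Ring A] [Algebra ℚ A] {P J : Submodule ℚ A}
    {D : τ → Submodule ℚ A} {c : τ → ℕ} (hPD : ∀ i, Commute P (D i))
    (hDD : ∀ i j, Commute (D i) (D j)) (hP : P * ⊤ ≤ P) (hDt : ∀ i, D i * ⊤ ≤ D i)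
    (hJ : ⊤ * J ≤ J) (hJ' : J * ⊤ ≤ J) (hD : ∀ i, D i ^ (c i + 1) ≤ J) (a : ℕ) (L : List τ) :
    (P + (L.map D).sum) ^ (a + (L.map c).sum + 1) ≤ P ^ (a + 1) + J := by
  induction L with
  | nil => simp
  | cons i L ih =>
    have hS : ∀ L : List τ, (L.map D).sum * ⊤ ≤ (L.map D).sum := by
      intro L
      induction L with
      | nil => simp
      | cons i L ih =>
        rw [List.map_cons, List.sum_cons, add_mul]
        exact add_le_add (hDt i) ih
    have hcS : ∀ (L : List τ) j, Commute (L.map D).sum (D j) := by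
      intro L j
      induction L with
      | nil => exact Commute.zero_left _
      | cons i L ih => rw [List.map_cons, List.sum_cons]; exact (hDD i j).add_left ih
    have h := sup_pow_le (P := P + (L.map D).sum) (a := a + (L.map c).sum)
      ((hPD i).add_left (hcS L i)) (by rw [add_mul]; exact add_le_add hP (hS L)) hJ hJ' (hD i)
    rw [List.map_cons, List.sum_cons, List.map_cons, List.sum_cons, add_comm (D i), ← add_assoc,
      add_comm (c i), ← add_assoc a]
    refine h.trans ?_
    calc _ ≤ P ^ (a + 1) + J + J := add_le_add ih le_rfl
      _ = _ := by rw [add_assoc, add_idem]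

end Pigeonhole

/-! ### Generators `v ⊗ 1 - 1 ⊗ v` of `ker μ`. -/

section DiffIdeal

variable {ι : Type}

/-- The elements `v ⊗ 1 - 1 ⊗ v`. -/
noncomputable def genDiff (deg : ι → ℕ) (i : ι) : FreeCGA (Sum.elim deg deg) :=
  gen _ (Sum.inl i) - gen _ (Sum.inr i)

/-- The ideal generated by `v ⊗ 1 - 1 ⊗ v`. -/
noncomputable def diffIdeal (deg : ι → ℕ) (i : ι) : Submodule ℚ (FreeCGA (Sum.elim deg deg)) :=
  ⊤ * Submodule.span ℚ {genDiff deg i}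

theorem top_mul_top_eq {A : Type} [Ring A] [Algebra ℚ A] :
    (⊤ : Submodule ℚ A) * ⊤ = ⊤ :=
  top_le_iff.1 fun a _ => by
    simpa using Submodule.mul_mem_mul (Submodule.mem_top (x := 1) (R := ℚ))
      (Submodule.mem_top (x := a) (R := ℚ))

/-- A homogeneous element commutes with words up to sign, so the left and right ideals it generates
coincide. -/
theorem FreeCGA.commute_span_top {deg : ι → ℕ} {p : ℕ} {h : FreeCGA deg} (hh : h ∈ homog deg p) :
    Commute (Submodule.span ℚ {h}) ⊤ := by
  refine le_antisymm (Submodule.mul_le.2 ?_) (Submodule.mul_le.2 ?_)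
  · intro a ha b hb'
    clear hb'
    obtain ⟨c, rfl⟩ := Submodule.mem_span_singleton.1 ha
    rw [smul_mul_assoc]
    refine Submodule.smul_mem _ _ ?_
    induction b using word_induction with
    | h0 => simp
    | hadd a b ha hb => rw [mul_add]; exact Submodule.add_mem _ ha hb
    | hsmul c a ha => rw [mul_smul_comm]; exact Submodule.smul_mem _ _ ha
    | hw l =>
      rw [FreeCGA.comm deg hh (word_mem deg l)]
      exact Submodule.smul_mem _ _ (Submodule.mul_mem_mul trivial
        (Submodule.mem_span_singleton_self _))
  · intro b hb' a ha
    clear hb'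
    obtain ⟨c, rfl⟩ := Submodule.mem_span_singleton.1 ha
    rw [mul_smul_comm]
    refine Submodule.smul_mem _ _ ?_
    induction b using word_induction with
    | h0 => simp
    | hadd a b ha hb => rw [add_mul]; exact Submodule.add_mem _ ha hb
    | hsmul c a ha => rw [smul_mul_assoc]; exact Submodule.smul_mem _ _ ha
    | hw l =>
      rw [FreeCGA.comm deg (word_mem deg l) hh]
      exact Submodule.smul_mem _ _ (Submodule.mul_mem_mul
        (Submodule.mem_span_singleton_self _) trivial)

theorem genDiff_mem_homog (deg : ι → ℕ) (i : ι) :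
    genDiff deg i ∈ homog (Sum.elim deg deg) (deg i) :=
  Submodule.sub_mem _ (gen_mem (Sum.elim deg deg) (Sum.inl i))
    (gen_mem (Sum.elim deg deg) (Sum.inr i))

theorem commute_diffIdeal_top (deg : ι → ℕ) (i : ι) : Commute (diffIdeal deg i) ⊤ :=
  Commute.mul_left (Commute.refl _) (commute_span_top (genDiff_mem_homog deg i))

theorem commute_diffIdeal (deg : ι → ℕ) (i j : ι) :
    Commute (diffIdeal deg i) (diffIdeal deg j) := by
  refine Commute.mul_right (commute_diffIdeal_top deg i) (Commute.mul_left
    (commute_span_top (genDiff_mem_homog deg j)).symm ?_)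
  rw [Commute, SemiconjBy, Submodule.span_mul_span, Submodule.span_mul_span,
    Set.singleton_mul_singleton, Set.singleton_mul_singleton,
    FreeCGA.comm _ (genDiff_mem_homog deg i) (genDiff_mem_homog deg j)]
  exact Submodule.span_singleton_smul_eq
    (IsUnit.mk0 ((-1 : ℚ) ^ (deg i * deg j)) (by positivity)) _

theorem diffIdeal_mul_top (deg : ι → ℕ) (i : ι) : diffIdeal deg i * ⊤ = diffIdeal deg i := by
  rw [(commute_diffIdeal_top deg i).eq, diffIdeal, ← mul_assoc, top_mul_top_eq]

/-- Since the generator commutes with `⊤` as a subspace, the power of the ideal is generated by the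
power of the generator, and nilpotency can be tested on that one element. -/
theorem diffIdeal_pow_le (deg : ι → ℕ) (i : ι) {J : Submodule ℚ (FreeCGA (Sum.elim deg deg))}
    (hJ : ⊤ * J ≤ J) {c : ℕ} (h : genDiff deg i ^ c ∈ J) : diffIdeal deg i ^ c ≤ J := by
  have hc : Commute (⊤ : Submodule ℚ (FreeCGA (Sum.elim deg deg)))
    (Submodule.span ℚ {genDiff deg i}) := (commute_span_top (genDiff_mem_homog deg i)).symm
  rw [diffIdeal, hc.mul_pow, Submodule.span_pow, Set.singleton_pow]
  refine le_trans (mul_le_mul' le_top ?_) hJ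
  rwa [Submodule.span_singleton_le_iff_mem]

/-- The kernel of `μ` is generated by the elements `v ⊗ 1 - 1 ⊗ v`. -/
theorem kerMul_le {deg : ι → ℕ} {T : Submodule ℚ (FreeCGA (Sum.elim deg deg))}
    (hT : ⊤ * T ≤ T) (hT' : T * ⊤ ≤ T) (h : ∀ i, genDiff deg i ∈ T) : kerMul deg ≤ T := by
  -- Modulo `T` every right-hand generator may be replaced by its left-hand copy, so `a` is
  -- congruent to `μ(a) ⊗ 1`.
  have key : ∀ a, a - inLeft deg (mulAlgHom deg a) ∈ T := by
    intro a
    induction a using word_induction with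
    | h0 => simp
    | hadd a b ha hb =>
      have e : a + b - inLeft deg (mulAlgHom deg (a + b)) =
        (a - inLeft deg (mulAlgHom deg a)) + (b - inLeft deg (mulAlgHom deg b)) := by
        rw [map_add, map_add]; abel
      rw [e]; exact Submodule.add_mem _ ha hb
    | hsmul c a ha =>
      rw [map_smul, map_smul, ← smul_sub]; exact Submodule.smul_mem _ _ ha
    | hw l =>
      induction l with
      | nil => simp [word_nil]
      | cons g l ih =>
        rw [word_cons, map_mul, map_mul]
        have e : ∀ g w g' w' : FreeCGA (Sum.elim deg deg),
          g * w - g' * w' = (g - g') * w + g' * (w - w') := by intros; noncomm_ring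
        rw [e]
        refine Submodule.add_mem _ ?_ (hT (Submodule.mul_mem_mul trivial ih))
        refine hT' (Submodule.mul_mem_mul ?_ trivial)
        rcases g with g | g
        · rw [mulAlgHom_inl, inLeft_gen, sub_self]; exact Submodule.zero_mem _
        · rw [mulAlgHom_inr, inLeft_gen, ← neg_sub]
          exact Submodule.neg_mem _ (h g)
  intro a ha
  have := key a
  rwa [mem_kerMul.1 ha, map_zero, sub_zero] at this

theorem genDiff_mem_diffIdeal (deg : ι → ℕ) (i : ι) : genDiff deg i ∈ diffIdeal deg i := by
  rw [diffIdeal]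
  simpa using Submodule.mul_mem_mul (Submodule.mem_top (x := 1) (R := ℚ))
    (Submodule.mem_span_singleton_self (R := ℚ) (genDiff deg i))

theorem le_list_sum {A τ : Type} [Ring A] [Algebra ℚ A] {D : τ → Submodule ℚ A} {L : List τ}
    {i : τ} (hi : i ∈ L) : D i ≤ (L.map D).sum := by
  induction L with
  | nil => simp at hi
  | cons j L ih =>
    rw [List.map_cons, List.sum_cons]
    rcases List.mem_cons.1 hi with rfl | h
    · exact le_sup_left
    · exact (ih h).trans le_sup_right

end DiffIdeal

/-! ### Acyclicity of the ideal generated by the `x_p²` and `u_p`. -/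

section SquareIdeal

variable {ι τ : Type} {deg : ι → ℕ} {x u : τ → ι}

/-- The left ideal generated by `x_p²` and `u_p` for `p ∈ S`. -/
noncomputable def sqIdeal (deg : ι → ℕ) (x u : τ → ι) (S : List τ) : Ideal (FreeCGA deg) :=
  Ideal.span {a | ∃ p ∈ S, a = gen deg (x p) ^ 2 ∨ a = gen deg (u p)}

theorem sq_mem_sqIdeal {S : List τ} {p : τ} (hp : p ∈ S) :
    gen deg (x p) ^ 2 ∈ sqIdeal deg x u S := Ideal.subset_span ⟨p, hp, Or.inl rfl⟩

theorem gen_mem_sqIdeal {S : List τ} {p : τ} (hp : p ∈ S) :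
    gen deg (u p) ∈ sqIdeal deg x u S := Ideal.subset_span ⟨p, hp, Or.inr rfl⟩

theorem sqIdeal_mono {S S' : List τ} (h : ∀ p ∈ S, p ∈ S') :
    sqIdeal deg x u S ≤ sqIdeal deg x u S' :=
  Ideal.span_mono fun _ ⟨p, hp, ha⟩ => ⟨p, h p hp, ha⟩

variable (hx : ∀ p, Even (deg (x p))) (hu : ∀ p, Odd (deg (u p)))

include hx hu in
theorem sqIdeal_mul_mem {S : List τ} {a : FreeCGA deg} (ha : a ∈ sqIdeal deg x u S)
    (b : FreeCGA deg) : a * b ∈ sqIdeal deg x u S := by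
  refine Submodule.span_induction (p := fun a _ => a * b ∈ sqIdeal deg x u S) ?_ ?_ ?_ ?_ ha
  · rintro _ ⟨p, hp, rfl | rfl⟩
    · have h := (isScalar_gen (hx p)).mul (isScalar_gen (hx p))
      rw [pow_two, h.comm, ← pow_two]
      exact Ideal.mul_mem_left _ _ (sq_mem_sqIdeal hp)
    · have := mul_gen_of_odd (hu p) (parity deg b)
      rw [parity_parity] at this
      rw [← this]
      exact Ideal.mul_mem_left _ _ (gen_mem_sqIdeal hp)
  · rw [zero_mul]; exact Ideal.zero_mem _
  · intro y z _ _ hy hz; rw [add_mul]; exact Ideal.add_mem _ hy hz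
  · intro r y _ hy; rw [smul_eq_mul, mul_assoc]; exact Ideal.mul_mem_left _ _ hy

theorem sqIdeal_map_mem {S : List τ} (φ : FreeCGA deg →ₐ[ℚ] FreeCGA deg)
    (h1 : ∀ p ∈ S, φ (gen deg (x p)) = gen deg (x p))
    (h2 : ∀ p ∈ S, φ (gen deg (u p)) = gen deg (u p)) {a : FreeCGA deg}
    (ha : a ∈ sqIdeal deg x u S) : φ a ∈ sqIdeal deg x u S := by
  refine Submodule.span_induction (p := fun a _ => φ a ∈ sqIdeal deg x u S) ?_ ?_ ?_ ?_ ha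
  · rintro _ ⟨p, hp, rfl | rfl⟩
    · rw [map_pow, h1 p hp]; exact sq_mem_sqIdeal hp
    · rw [h2 p hp]; exact gen_mem_sqIdeal hp
  · rw [map_zero]; exact Ideal.zero_mem _
  · intro y z _ _ hy hz; rw [map_add]; exact Ideal.add_mem _ hy hz
  · intro r y _ hy; rw [smul_eq_mul, map_mul]; exact Ideal.mul_mem_left _ _ hy

/-- The expansion in powers of a generator of even degree. -/
noncomputable def expandGen [DecidableEq ι] (deg : ι → ℕ) (k : ι) (hk : Even (deg k)) :
    FreeCGA deg →ₐ[ℚ] Polynomial (FreeCGA deg) :=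
  lift deg (fun i => if i = k then Polynomial.X else Polynomial.C (gen deg i)) (by
    intro i j
    by_cases hi : i = k
    · subst hi
      simp only [if_true, pow_mul, hk.neg_one_pow, one_pow, one_smul]
      exact Polynomial.X_mul
    · by_cases hj : j = k
      · subst hj
        simp only [if_true, mul_comm (deg i), pow_mul, hk.neg_one_pow, one_pow, one_smul]
        exact Polynomial.X_mul.symm
      · simp only [hi, hj, if_false]
        rw [← Polynomial.C_mul, ← Polynomial.C_mul, gen_comm, Polynomial.smul_C])

theorem expandGen_gen [DecidableEq ι] (k : ι) (hk : Even (deg k)) (i : ι) :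
    expandGen deg k hk (gen deg i) =
      if i = k then Polynomial.X else Polynomial.C (gen deg i) := lift_gen _ _ _ _

theorem eval_expandGen [DecidableEq ι] (k : ι) (hk : Even (deg k)) (a : FreeCGA deg) :
    (expandGen deg k hk a).eval (gen deg k) = a := by
  induction a using word_induction with
  | h0 => simp
  | hadd a b ha hb => rw [map_add, Polynomial.eval_add, ha, hb]
  | hsmul c a ha => rw [map_smul, Polynomial.eval_smul, ha]
  | hw l =>
    induction l with
    | nil => simp [word_nil]
    | cons i l ih =>
      rw [word_cons, map_mul, expandGen_gen]
      split_ifs with h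
      · rw [h, Polynomial.X_mul, Polynomial.eval_mul_X, ih, (isScalar_gen hk).comm]
      · rw [Polynomial.eval_C_mul, ih]

include hx in
/-- A generator `x_q` is not a zero divisor modulo the other `x_p²` and `u_p`. -/
theorem mem_sqIdeal_of_mul_mem [DecidableEq ι] (hxi : Function.Injective x)
    (hu : ∀ p, Odd (deg (u p))) {S : List τ} {q : τ}
    (hq : q ∉ S) {a : FreeCGA deg} (ha : gen deg (x q) * a ∈ sqIdeal deg x u S) :
    a ∈ sqIdeal deg x u S := by
  -- The generators indexed by `S` do not involve `x_q`, so membership in the ideal can be tested on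
  -- the coefficients of the powers of `x_q`; multiplication by `x_q` merely shifts these.
  have key : ∀ b ∈ sqIdeal deg x u S, ∀ n,
      (expandGen deg (x q) (hx q) b).coeff n ∈ sqIdeal deg x u S := by
    intro b hb
    refine Submodule.span_induction (p := fun b _ => ∀ n,
      (expandGen deg (x q) (hx q) b).coeff n ∈ sqIdeal deg x u S) ?_ ?_ ?_ ?_ hb
    · rintro _ ⟨p, hp, rfl | rfl⟩ n
      · have hne : x p ≠ x q := fun h => hq (hxi h ▸ hp)
        rw [map_pow, expandGen_gen, if_neg hne, ← Polynomial.C_pow, Polynomial.coeff_C]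
        split_ifs
        · exact sq_mem_sqIdeal hp
        · exact Ideal.zero_mem _
      · have hne : u p ≠ x q := fun h => Nat.not_even_iff_odd.2 (hu p) (h ▸ hx q)
        rw [expandGen_gen, if_neg hne, Polynomial.coeff_C]
        split_ifs
        · exact gen_mem_sqIdeal hp
        · exact Ideal.zero_mem _
    · intro n; rw [map_zero, Polynomial.coeff_zero]; exact Ideal.zero_mem _
    · intro y z _ _ hy hz n
      rw [map_add, Polynomial.coeff_add]; exact Ideal.add_mem _ (hy n) (hz n)
    · intro r y _ hy n
      rw [smul_eq_mul, map_mul, Polynomial.coeff_mul]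
      exact Ideal.sum_mem _ fun _ _ => Ideal.mul_mem_left _ _ (hy _)
  have h := key _ ha
  rw [← eval_expandGen (x q) (hx q) a, Polynomial.eval_eq_sum, Polynomial.sum]
  refine Ideal.sum_mem _ fun n _ => ?_
  have hs : ∀ b n, gen deg (x q) ^ n * b = b * gen deg (x q) ^ n := by
    intro b n
    exact ((show Commute (gen deg (x q)) b from (isScalar_gen (hx q)).comm b).pow_left n).eq
  rw [← hs]
  refine Ideal.mul_mem_left _ _ ?_
  have := h (n + 1)
  rwa [map_mul, expandGen_gen, if_pos rfl, Polynomial.coeff_X_mul] at this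

variable {d : Differential deg} (hdx : ∀ p, d.toLin (gen deg (x p)) = 0)
  (hdu : ∀ p, d.toLin (gen deg (u p)) = gen deg (x p) ^ 2)
  (hd : ∀ i, d.toLin (gen deg i) ∈ evenPart deg)

include hdx hdu in
theorem d_mem_sqIdeal {S : List τ} {a : FreeCGA deg} (ha : a ∈ sqIdeal deg x u S) :
    d.toLin a ∈ sqIdeal deg x u S := by
  refine Submodule.span_induction (p := fun a _ => d.toLin a ∈ sqIdeal deg x u S) ?_ ?_ ?_ ?_ ha
  · rintro _ ⟨p, hp, rfl | rfl⟩
    · rw [pow_two, d.isOddDer.mul, hdx]; simp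
    · rw [hdu]; exact sq_mem_sqIdeal hp
  · simp
  · intro y z _ _ hy hz; rw [map_add]; exact Ideal.add_mem _ hy hz
  · intro r y hy' hy
    rw [smul_eq_mul, d.isOddDer.mul]
    exact Ideal.add_mem _ (Ideal.mul_mem_left _ _ hy') (Ideal.mul_mem_left _ _ hy)

include hd in
theorem partialD_anticomm_d [DecidableEq ι] {k : ι} (hk : Odd (deg k)) (a : FreeCGA deg) :
    partialD deg k hk (d.toLin a) = -d.toLin (partialD deg k hk a) := by
  refine (isOddDer_partialD deg k hk).anticomm d.isOddDer (fun i => ?_) a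
  rw [partialD_eq_zero hk (hd i), partialD_gen]
  split_ifs <;> simp [d.isOddDer.one]

include hx hu hdx hdu hd in
-- Koszul elimination of one pair `X = x_q`, `U = u_q`. Modulo the smaller ideal the cocycle is `X²
-- P + U R` with `P`, `R` free of `U`. Applying the differential shows that `X² (dP + R)` is in the
-- smaller ideal, hence so is `dP + R`, as `X` is not a zero divisor there. Finally `X² P + U R -
-- d(U P) = U (dP + R)`.
theorem sqIdeal_step [DecidableEq ι] (hxi : Function.Injective x) (hui : Function.Injective u)
    {S : List τ} {q : τ} (hq : q ∉ S) {a : FreeCGA deg} (ha : a ∈ sqIdeal deg x u (q :: S))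
    (hda : d.toLin a = 0) : ∃ b ∈ sqIdeal deg x u (q :: S), a - d.toLin b ∈ sqIdeal deg x u S := by
  set U := gen deg (u q) with hU
  set X := gen deg (x q) with hX
  set ε := killGen deg (u q) with hε
  have hXs := isScalar_gen (deg := deg) (hx q)
  have hcentral : ∀ b, X ^ 2 * b = b * X ^ 2 := fun b => by
    rw [pow_two]; exact (hXs.mul hXs).comm b
  have hUU : U * U = 0 := gen_sq_of_odd (hu q)
  have hne : x q ≠ u q := fun h => Nat.not_even_iff_odd.2 (hu q) (h ▸ hx q)
  -- the form of an element of the ideal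
  obtain ⟨p, r, j, hj, rfl⟩ : ∃ p r, ∃ j ∈ sqIdeal deg x u S, a = p * X ^ 2 + r * U + j := by
    have hset : {a | ∃ p ∈ q :: S, a = gen deg (x p) ^ 2 ∨ a = gen deg (u p)} =
        insert (X ^ 2) (insert U {a | ∃ p ∈ S, a = gen deg (x p) ^ 2 ∨ a = gen deg (u p)}) := by
      ext b
      simp only [List.mem_cons, exists_eq_or_imp, Set.mem_insert_iff, Set.mem_ofPred_eq, or_assoc,
        hU, hX]
    rw [sqIdeal, hset] at ha
    obtain ⟨p, z, hz, rfl⟩ := Ideal.mem_span_insert.1 ha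
    obtain ⟨r, j, hj, rfl⟩ := Ideal.mem_span_insert.1 hz
    exact ⟨p, r, j, hj, by rw [add_assoc]⟩
  have hεx : ε X = X := by rw [hε, hX, killGen_gen, if_neg hne]
  have hεU : ε U = 0 := by rw [hε, hU, killGen_gen, if_pos rfl]
  have hεS : ∀ b ∈ sqIdeal deg x u S, ε b ∈ sqIdeal deg x u S := by
    refine fun b hb => sqIdeal_map_mem _ (fun p hp => ?_) (fun p hp => ?_) hb
    · rw [killGen_gen, if_neg]
      exact fun h => Nat.not_even_iff_odd.2 (hu q) (h ▸ hx p)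
    · rw [killGen_gen, if_neg]
      exact fun h => hq (hui h ▸ hp)
  have hsplit := killGen_add deg (u q) (hu q)
  set P := ε p with hP
  -- The part of `p` divisible by `U` contributes `X² U ∂p`, which is moved into the coefficient of
  -- `U`; applying `ε` changes nothing after multiplication by `U`, because `U² = 0`.
  set R := ε (parity deg r + X ^ 2 * partialD deg (u q) (hu q) p) with hR
  have h1 : p * X ^ 2 + r * U = X ^ 2 * P + U * R := by
    have e1 : U * R = U * (parity deg r + X ^ 2 * partialD deg (u q) (hu q) p) := by
      have eb : ∀ b, U * ε b = U * b := by
        intro b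
        nth_rewrite 2 [← hsplit b]
        rw [mul_add, ← mul_assoc U, ← hU, hUU, zero_mul, add_zero]
      exact eb _
    have e2 : r * U = U * parity deg r := mul_gen_of_odd (hu q) r
    rw [e1, e2, ← hcentral, mul_add, ← mul_assoc, ← hcentral]
    nth_rewrite 1 [← hsplit p]
    rw [mul_add, ← hε, ← hP, ← hU, mul_assoc]
    abel
  rw [h1] at hda
  have hX0 : ∀ b, d.toLin (X ^ 2 * b) = X ^ 2 * d.toLin b := by
    intro b
    have : d.toLin (X ^ 2) = 0 := by rw [pow_two, d.isOddDer.mul, hdx]; simp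
    rw [d.isOddDer.mul, this, map_pow, hXs.parity]; simp [hX]
  have hU0 : ∀ b, d.toLin (U * b) = X ^ 2 * b - U * d.toLin b := by
    intro b
    rw [d.isOddDer.mul, hdu, parity_gen, (hu q).neg_one_pow]
    simp [hU, sub_eq_add_neg, hX]
  have hdP : ε (d.toLin P) = d.toLin P := by
    have := hsplit (d.toLin P)
    rwa [partialD_anticomm_d hd, hP, partialD_killGen, map_zero, neg_zero, mul_zero, add_zero] at this
  have hεε : ∀ b, ε (ε b) = ε b := by
    intro b
    have := hsplit (ε b)
    rwa [hε, partialD_killGen, mul_zero, add_zero] at this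
  have h2 : d.toLin P + R ∈ sqIdeal deg x u S := by
    have h3 : X ^ 2 * d.toLin P + (X ^ 2 * R - U * d.toLin R) ∈ sqIdeal deg x u S := by
      have e : X ^ 2 * d.toLin P + (X ^ 2 * R - U * d.toLin R) = -d.toLin j := by
        rw [map_add, map_add, hX0, hU0] at hda
        exact eq_neg_of_add_eq_zero_left hda
      rw [e]
      exact neg_mem (d_mem_sqIdeal hdx hdu hj)
    -- `ε` kills `U` and fixes `X`, `dP` and `R`, so it isolates `X² (dP + R)`.
    have h4 := hεS _ h3
    rw [map_add, map_sub, map_mul, map_mul, map_mul, map_pow, hεx, hεU, hdP, zero_mul, sub_zero,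
      hR, hεε, ← hR, ← mul_add, pow_two, mul_assoc] at h4
    exact mem_sqIdeal_of_mul_mem hx hxi hu hq (mem_sqIdeal_of_mul_mem hx hxi hu hq h4)
  refine ⟨U * P, ?_, ?_⟩
  · have : U * P = parity deg P * U := by
      have := mul_gen_of_odd (hu q) (parity deg P)
      rw [parity_parity] at this
      exact this.symm
    rw [this]
    exact Ideal.mul_mem_left _ _ (gen_mem_sqIdeal (by simp))
  · have e : p * X ^ 2 + r * U + j - d.toLin (U * P) = U * (d.toLin P + R) + j := by
      rw [h1, hU0, mul_add]; abel
    rw [e]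
    exact Ideal.add_mem _ (Ideal.mul_mem_left _ _ h2) hj

include hx hu hdx hdu hd in
/-- The ideal generated by the `x_p²` and `u_p` is acyclic. -/
theorem sqIdeal_acyclic [DecidableEq ι] (hxi : Function.Injective x) (hui : Function.Injective u)
    {S : List τ} (hS : S.Nodup) {a : FreeCGA deg} (ha : a ∈ sqIdeal deg x u S)
    (hda : d.toLin a = 0) : ∃ b ∈ sqIdeal deg x u S, d.toLin b = a := by
  induction S generalizing a with
  | nil =>
    refine ⟨0, Ideal.zero_mem _, ?_⟩
    have : {a | ∃ p ∈ ([] : List τ), a = gen deg (x p) ^ 2 ∨ a = gen deg (u p)} = ∅ := by simp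
    rw [sqIdeal, this, Ideal.span_empty] at ha
    rw [map_zero, (Submodule.mem_bot _).1 ha]
  | cons q S ih =>
    rw [List.nodup_cons] at hS
    obtain ⟨b, hb, hab⟩ := sqIdeal_step hx hu hdx hdu hd hxi hui hS.1 ha hda
    obtain ⟨c, hc, hcb⟩ := ih hS.2 hab (by rw [map_sub, hda, d.sq, sub_zero])
    exact ⟨b + c, Ideal.add_mem _ hb (sqIdeal_mono (fun p hp => by simp [hp]) hc), by
      rw [map_add, hcb]; abel⟩

include hx hu in
theorem sqIdeal_isTwoSided (S : List τ) : (sqIdeal deg x u S).IsTwoSided :=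
  ⟨fun b ha => sqIdeal_mul_mem hx hu ha b⟩

include hdx hdu in
theorem sqIdeal_isDGIdeal (S : List τ) :
    CDGA.IsDGIdeal (free d) (sqIdeal deg x u S) where
  homogeneous := by
    intro a ha
    refine Submodule.span_induction (p := fun a _ => a ∈ ⨆ p,
      (sqIdeal deg x u S).restrictScalars ℚ ⊓ homog deg p) ?_ ?_ ?_ ?_ ha
    · rintro _ ⟨p, hp, rfl | rfl⟩
      · refine Submodule.mem_iSup_of_mem (deg (x p) + deg (x p)) ⟨sq_mem_sqIdeal hp, ?_⟩
        rw [pow_two]; exact FreeCGA.mul_mem deg (gen_mem _ _) (gen_mem _ _)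
      · exact Submodule.mem_iSup_of_mem _ ⟨gen_mem_sqIdeal hp, gen_mem _ _⟩
    · exact Submodule.zero_mem _
    · intro y z _ _ hy hz; exact Submodule.add_mem _ hy hz
    · intro r y hy' hy
      clear hy'
      rw [smul_eq_mul]
      induction r using word_induction with
      | h0 => rw [zero_mul]; exact Submodule.zero_mem _
      | hadd a b ha hb => rw [add_mul]; exact Submodule.add_mem _ ha hb
      | hsmul c a ha => rw [smul_mul_assoc]; exact Submodule.smul_mem _ _ ha
      | hw l =>
        induction hy using Submodule.iSup_induction' with
        | zero => rw [mul_zero]; exact Submodule.zero_mem _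
        | add a b _ _ ha hb => rw [mul_add]; exact Submodule.add_mem _ ha hb
        | mem p b hb =>
          exact Submodule.mem_iSup_of_mem _ ⟨Ideal.mul_mem_left _ _ hb.1,
            FreeCGA.mul_mem deg (word_mem deg l) hb.2⟩
  d_mem := fun _ ha => d_mem_sqIdeal hdx hdu ha

end SquareIdeal

end RatTC

namespace RatTC

/-! ### Homogeneous components and an elementwise form of quasi-isomorphisms. -/

section Graded

namespace CDGA

variable (A : CDGA)

/-- Induction on elements of a cdga by homogeneous ones. -/
theorem induction_gr {p : A.carrier → Prop} (h0 : p 0) (hadd : ∀ a b, p a → p b → p (a + b))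
    (hm : ∀ n, ∀ a ∈ A.gr n, p a) (a : A.carrier) : p a := by
  have ha : a ∈ ⨆ n, A.gr n := by rw [A.iSup_gr]; trivial
  induction ha using Submodule.iSup_induction' with
  | zero => exact h0
  | add x y _ _ hx hy => exact hadd _ _ hx hy
  | mem n x hx => exact hm n x hx

theorem proj_mem (p : ℕ) (a : A.carrier) : A.proj p a ∈ A.gr p := Subtype.property _

/-- Stated for all large `n`, so that two elements can share one range of summation. -/
theorem exists_proj_sum (a : A.carrier) :
    ∃ N, ∀ n, N ≤ n → ∑ p ∈ Finset.range n, A.proj p a = a := by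
  induction a using A.induction_gr with
  | h0 => exact ⟨0, fun n _ => by simp⟩
  | hadd a b ha hb =>
    obtain ⟨N, hN⟩ := ha
    obtain ⟨M, hM⟩ := hb
    refine ⟨max N M, fun n hn => ?_⟩
    simp only [map_add, Finset.sum_add_distrib]
    rw [hN n (le_trans (le_max_left _ _) hn), hM n (le_trans (le_max_right _ _) hn)]
  | hm q a ha =>
    refine ⟨q + 1, fun n hn => ?_⟩
    rw [Finset.sum_eq_single q, A.proj_same ha]
    · intro p _ hp; exact A.proj_ne hp ha
    · intro h; exact absurd (Finset.mem_range.2 (by omega)) h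

theorem d_proj (p : ℕ) (a : A.carrier) : A.d (A.proj p a) = A.proj (p + 1) (A.d a) := by
  induction a using A.induction_gr with
  | h0 => simp
  | hadd a b ha hb => simp only [map_add, ha, hb]
  | hm q a ha =>
    by_cases h : p = q
    · subst h; rw [A.proj_same ha, A.proj_same (A.d_mem ha)]
    · rw [A.proj_ne h ha, A.proj_ne (by omega) (A.d_mem ha), map_zero]

theorem proj_zero_d (a : A.carrier) : A.proj 0 (A.d a) = 0 := by
  induction a using A.induction_gr with
  | h0 => simp
  | hadd a b ha hb => simp only [map_add, ha, hb, add_zero]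
  | hm q a ha => rw [A.proj_ne (by omega) (A.d_mem ha)]

variable {A}

theorem Hom.map_proj {B : CDGA} (f : A.Hom B) (p : ℕ) (a : A.carrier) :
    f.toAlgHom (A.proj p a) = B.proj p (f.toAlgHom a) := by
  induction a using A.induction_gr with
  | h0 => simp
  | hadd a b ha hb => simp only [map_add, ha, hb]
  | hm q a ha =>
    by_cases h : p = q
    · subst h; rw [A.proj_same ha, B.proj_same (f.map_gr ha)]
    · rw [A.proj_ne h ha, B.proj_ne h (f.map_gr ha), map_zero]

/-- The composition of morphisms. -/
def Hom.comp {B C : CDGA} (g : B.Hom C) (f : A.Hom B) : A.Hom C where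
  toAlgHom := g.toAlgHom.comp f.toAlgHom
  map_gr := fun ha => g.map_gr (f.map_gr ha)
  map_d := fun a => (congrArg g.toAlgHom (f.map_d a)).trans (g.map_d _)

/-- A quasi-isomorphism in terms of elements. -/
theorem Hom.quasiIso_iff {B : CDGA} (f : A.Hom B) : f.QuasiIso ↔
    (∀ a, A.d a = 0 → ∀ b, B.d b = f.toAlgHom a → ∃ c, A.d c = a) ∧
    ∀ b, B.d b = 0 → ∃ a, A.d a = 0 ∧ ∃ c, B.d c = b - f.toAlgHom a := by
  refine and_congr ⟨fun h a ha b hb => ?_, fun h => ?_⟩ ⟨fun h b hb => ?_, fun h x => ?_⟩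
  · have h0 : f.onCohomology (Submodule.Quotient.mk (p := A.coboundaries) ⟨a, ha⟩) =
        f.onCohomology 0 := by
      rw [map_zero]
      exact (Submodule.Quotient.mk_eq_zero _).2 ⟨b, hb⟩
    exact (Submodule.Quotient.mk_eq_zero A.coboundaries).1 (h h0)
  · refine (injective_iff_map_eq_zero f.onCohomology).2 fun x hx => ?_
    obtain ⟨⟨a, ha⟩, rfl⟩ := Submodule.Quotient.mk_surjective _ x
    obtain ⟨b, hb⟩ := (Submodule.Quotient.mk_eq_zero B.coboundaries).1 hx
    exact (Submodule.Quotient.mk_eq_zero _).2 (h a ha b hb)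
  · obtain ⟨x, hx⟩ := h (Submodule.Quotient.mk (p := B.coboundaries) ⟨b, hb⟩)
    obtain ⟨⟨a, ha⟩, rfl⟩ := Submodule.Quotient.mk_surjective _ x
    obtain ⟨c, hc⟩ := (Submodule.Quotient.eq B.coboundaries).1 hx.symm
    exact ⟨a, ha, c, hc⟩
  · obtain ⟨⟨b, hb⟩, rfl⟩ := Submodule.Quotient.mk_surjective _ x
    obtain ⟨a, ha, c, hc⟩ := h b hb
    exact ⟨Submodule.Quotient.mk ⟨a, ha⟩, ((Submodule.Quotient.eq B.coboundaries).2 ⟨c, hc⟩).symm⟩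

theorem Hom.QuasiIso.comp {B C : CDGA} {g : B.Hom C} {f : A.Hom B} (hg : g.QuasiIso)
    (hf : f.QuasiIso) : (g.comp f).QuasiIso := by
  have h : ⇑(g.comp f).onCohomology = g.onCohomology ∘ f.onCohomology := by
    funext x
    obtain ⟨a, rfl⟩ := Submodule.Quotient.mk_surjective _ x
    rfl
  rw [Hom.QuasiIso, h]
  exact Function.Bijective.comp hg hf

end CDGA

end Graded

/-! ### Fibre products of cdgas. -/

section Pullback

variable {A B Q : CDGA} (f : A.Hom Q) (g : B.Hom Q)

/-- The underlying algebra of the fibre product. -/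
def pullbackAlg : Subalgebra ℚ (A.carrier × B.carrier) :=
  AlgHom.equalizer (f.toAlgHom.comp (AlgHom.fst ℚ A.carrier B.carrier))
    (g.toAlgHom.comp (AlgHom.snd ℚ A.carrier B.carrier))

theorem mem_pullbackAlg {x : A.carrier × B.carrier} :
    x ∈ pullbackAlg f g ↔ f.toAlgHom x.1 = g.toAlgHom x.2 := Iff.rfl

/-- The projections of the fibre product on its homogeneous components. -/
noncomputable def pullbackProj (p : ℕ) : pullbackAlg f g →ₗ[ℚ] pullbackAlg f g :=
  LinearMap.codRestrict (Subalgebra.toSubmodule (pullbackAlg f g))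
    (((A.proj p).prodMap (B.proj p)) ∘ₗ (pullbackAlg f g).val.toLinearMap) (fun x => by
      change f.toAlgHom (A.proj p x.1.1) = g.toAlgHom (B.proj p x.1.2)
      rw [f.map_proj, g.map_proj, (mem_pullbackAlg f g).1 x.2])

/-- The fibre product of cdgas. -/
noncomputable def pullback : CDGA where
  carrier := pullbackAlg f g
  gr p := ((A.gr p).prod (B.gr p)).comap (pullbackAlg f g).val.toLinearMap
  isInternal := by
    refine isInternal_of_proj _ (pullbackProj f g) ?_ ?_ ?_
    · rintro p x ⟨h1, h2⟩
      exact Subtype.ext (Prod.ext (A.proj_same h1) (B.proj_same h2))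
    · rintro p q h x ⟨h1, h2⟩
      exact Subtype.ext (Prod.ext (A.proj_ne h h1) (B.proj_ne h h2))
    · rw [eq_top_iff]
      rintro x -
      obtain ⟨N, hN⟩ := A.exists_proj_sum x.1.1
      obtain ⟨M, hM⟩ := B.exists_proj_sum x.1.2
      have e : ∑ p ∈ Finset.range (max N M), pullbackProj f g p x = x := by
        have h := hN (max N M) (le_max_left _ _)
        have h' := hM (max N M) (le_max_right _ _)
        refine Subtype.ext (Prod.ext ?_ ?_)
        · refine Eq.trans ?_ h
          exact map_sum ((LinearMap.fst ℚ A.carrier B.carrier) ∘ₗ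
            (pullbackAlg f g).val.toLinearMap) _ _
        · refine Eq.trans ?_ h'
          exact map_sum ((LinearMap.snd ℚ A.carrier B.carrier) ∘ₗ
            (pullbackAlg f g).val.toLinearMap) _ _
      rw [← e]
      exact Submodule.sum_mem _ fun p _ => Submodule.mem_iSup_of_mem p
        ⟨A.proj_mem p _, B.proj_mem p _⟩
  one_mem := ⟨A.one_mem, B.one_mem⟩
  mul_mem := fun ha hb => ⟨A.mul_mem ha.1 hb.1, B.mul_mem ha.2 hb.2⟩
  comm := fun ha hb => Subtype.ext (Prod.ext (A.comm ha.1 hb.1) (B.comm ha.2 hb.2))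
  d := LinearMap.codRestrict (Subalgebra.toSubmodule (pullbackAlg f g))
    ((A.d.prodMap B.d) ∘ₗ (pullbackAlg f g).val.toLinearMap) (fun x => by
      change f.toAlgHom (A.d x.1.1) = g.toAlgHom (B.d x.1.2)
      rw [f.map_d, g.map_d, (mem_pullbackAlg f g).1 x.2])
  d_mem := fun ha => ⟨A.d_mem ha.1, B.d_mem ha.2⟩
  d_d := fun a => Subtype.ext (Prod.ext (A.d_d _) (B.d_d _))
  leibniz := fun b ha => Subtype.ext (Prod.ext (A.leibniz _ ha.1) (B.leibniz _ ha.2))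

/-- The first projection of the fibre product. -/
noncomputable def pullbackFst : (pullback f g).Hom A where
  toAlgHom := (AlgHom.fst ℚ A.carrier B.carrier).comp (pullbackAlg f g).val
  map_gr := fun ha => ha.1
  map_d := fun _ => rfl

/-- The second projection of the fibre product. -/
noncomputable def pullbackSnd : (pullback f g).Hom B where
  toAlgHom := (AlgHom.snd ℚ A.carrier B.carrier).comp (pullbackAlg f g).val
  map_gr := fun ha => ha.2
  map_d := fun _ => rfl

/-- The universal property of the fibre product. -/
noncomputable def pullbackLift {C : CDGA} (φ : C.Hom A) (ψ : C.Hom B)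
    (h : ∀ c, f.toAlgHom (φ.toAlgHom c) = g.toAlgHom (ψ.toAlgHom c)) : C.Hom (pullback f g) where
  toAlgHom := (φ.toAlgHom.prod ψ.toAlgHom).codRestrict (pullbackAlg f g) h
  map_gr := fun ha => ⟨φ.map_gr ha, ψ.map_gr ha⟩
  map_d := fun a => Subtype.ext (Prod.ext (φ.map_d a) (ψ.map_d a))

/-- A base change of a surjection with acyclic kernel is a quasi-isomorphism. -/
theorem pullbackSnd_quasiIso (hf : Function.Surjective f.toAlgHom)
    (hk : ∀ a, f.toAlgHom a = 0 → A.d a = 0 → ∃ b, f.toAlgHom b = 0 ∧ A.d b = a) :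
    (pullbackSnd f g).QuasiIso := by
  rw [CDGA.Hom.quasiIso_iff]
  constructor
  · rintro ⟨⟨a, b⟩, hab⟩ hd β hβ
    have hda : A.d a = 0 := congrArg (fun x : pullbackAlg f g => x.1.1) hd
    change B.d β = b at hβ
    obtain ⟨α, hα⟩ := hf (g.toAlgHom β)
    have hab' : f.toAlgHom a = g.toAlgHom b := hab
    obtain ⟨j, hj, hdj⟩ := hk (a - A.d α) (by
      rw [map_sub, f.map_d, hα, ← g.map_d, hβ, hab', sub_self]) (by
      rw [map_sub, A.d_d, hda, sub_zero])
    refine ⟨⟨(α + j, β), ?_⟩, Subtype.ext (Prod.ext ?_ hβ)⟩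
    · change f.toAlgHom (α + j) = g.toAlgHom β
      rw [map_add, hj, add_zero, hα]
    · change A.d (α + j) = a
      rw [map_add, hdj]; abel
  · intro b hb
    obtain ⟨a, ha⟩ := hf (g.toAlgHom b)
    obtain ⟨j, hj, hdj⟩ := hk (A.d a) (by rw [f.map_d, ha, ← g.map_d, hb, map_zero]) (A.d_d a)
    refine ⟨⟨(a - j, b), ?_⟩, Subtype.ext (Prod.ext ?_ hb), 0, ?_⟩
    · change f.toAlgHom (a - j) = g.toAlgHom b
      rw [map_sub, hj, sub_zero, ha]
    · change A.d (a - j) = 0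
      rw [map_sub, hdj, sub_self]
    · rw [map_zero]; exact (sub_self b).symm

end Pullback

end RatTC

namespace RatTC

open FreeCGA

/-! ### Morphisms out of `ΛV` and low degrees. -/

section Maps

variable {ι κ τ : Type}

namespace FreeCGA

/-- A left inverse sends the generators outside the image of `e` to zero, which is compatible with
graded commutativity. -/
theorem rename_injective {deg : ι → ℕ} {deg' : κ → ℕ} (e : ι → κ)
    (he : ∀ i, deg' (e i) = deg i) (hi : Function.Injective e) :
    Function.Injective (rename e he) := by
  classical
  let g : κ → FreeCGA deg := fun j => if h : ∃ i, e i = j then gen deg h.choose else 0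
  have hg : ∀ i, g (e i) = gen deg i := by
    intro i
    have h : ∃ i', e i' = e i := ⟨i, rfl⟩
    simp only [g, dif_pos h]
    rw [hi h.choose_spec]
  have hcomm : ∀ i j, g i * g j = ((-1 : ℚ) ^ (deg' i * deg' j)) • (g j * g i) := by
    intro i j
    by_cases h : ∃ i', e i' = i
    · by_cases h' : ∃ j', e j' = j
      · obtain ⟨i, rfl⟩ := h
        obtain ⟨j, rfl⟩ := h'
        rw [hg, hg, he, he, gen_comm]
      · simp [g, dif_neg h']
    · simp [g, dif_neg h]
  refine Function.LeftInverse.injective (g := lift deg' g hcomm) fun a => ?_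
  exact algHom_ext (f := (lift deg' g hcomm).comp (rename e he)) (g := AlgHom.id ℚ _)
    (fun i => by rw [AlgHom.comp_apply, rename_gen, lift_gen, hg]; rfl) a

theorem homog_zero {deg : ι → ℕ} (hpos : ∀ i, 0 < deg i) {a : FreeCGA deg}
    (ha : a ∈ homog deg 0) : ∃ q : ℚ, a = q • 1 := by
  induction ha using Submodule.span_induction with
  | zero => exact ⟨0, by simp⟩
  | add x y _ _ hx hy =>
    obtain ⟨q, rfl⟩ := hx
    obtain ⟨q', rfl⟩ := hy
    exact ⟨q + q', by rw [add_smul]⟩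
  | smul c x _ hx => obtain ⟨q, rfl⟩ := hx; exact ⟨c * q, by rw [smul_smul]⟩
  | mem x hx =>
    obtain ⟨l, hl, rfl⟩ := hx
    cases l with
    | nil => exact ⟨1, by simp [word_nil]⟩
    | cons i l =>
      have := hpos i
      simp only [List.map_cons, List.sum_cons] at hl
      omega

theorem word_degree_one {deg : ι → ℕ} (hpos : ∀ i, 0 < deg i) {l : List ι}
    (hl : (l.map deg).sum = 1) : ∃ i, deg i = 1 ∧ l = [i] := by
  cases l with
  | nil => simp at hl
  | cons i l =>
    have h := hpos i
    simp only [List.map_cons, List.sum_cons] at hl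
    cases l with
    | nil => exact ⟨i, by simpa using hl, rfl⟩
    | cons j l =>
      have h' := hpos j
      simp only [List.map_cons, List.sum_cons] at hl
      omega

end FreeCGA

theorem CDGA.d_one (C : CDGA) : C.d 1 = 0 := by
  have h := C.leibniz 1 C.one_mem
  simpa using h

namespace FreeCGA

theorem algHom_map_gr {deg : ι → ℕ} (C : CDGA) (φ : FreeCGA deg →ₐ[ℚ] C.carrier)
    (hgr : ∀ i, φ (gen deg i) ∈ C.gr (deg i)) {p : ℕ} {a : FreeCGA deg} (ha : a ∈ homog deg p) :
    φ a ∈ C.gr p := by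
  induction ha using Submodule.span_induction with
  | zero => rw [map_zero]; exact Submodule.zero_mem _
  | add x y _ _ hx hy => rw [map_add]; exact Submodule.add_mem _ hx hy
  | smul c x _ hx => rw [map_smul]; exact Submodule.smul_mem _ _ hx
  | mem x hx =>
    obtain ⟨l, rfl, rfl⟩ := hx
    induction l with
    | nil => rw [word_nil, map_one]; exact C.one_mem
    | cons i l ih =>
      rw [word_cons, map_mul, List.map_cons, List.sum_cons]
      exact C.mul_mem (hgr i) ih

theorem algHom_map_d {deg : ι → ℕ} (D : Differential deg) (C : CDGA)
    (φ : FreeCGA deg →ₐ[ℚ] C.carrier) (hgr : ∀ i, φ (gen deg i) ∈ C.gr (deg i))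
    (hd : ∀ i, φ (D.toLin (gen deg i)) = C.d (φ (gen deg i))) (a : FreeCGA deg) :
    φ (D.toLin a) = C.d (φ a) := by
  refine ext_word deg (f := φ.toLinearMap ∘ₗ D.toLin) (g := C.d ∘ₗ φ.toLinearMap) (fun l => ?_) a
  simp only [LinearMap.comp_apply, AlgHom.toLinearMap_apply]
  induction l with
  | nil => rw [word_nil, D.isOddDer.one, map_zero, map_one, C.d_one]
  | cons i l ih =>
    rw [word_cons, D.leibniz _ (gen_mem deg i), map_mul, C.leibniz _ (hgr i), map_add, map_smul,
      map_mul, map_mul, ih, hd]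

end FreeCGA

end Maps

/-! ### One stage of the relative Sullivan model. -/

section Stage

/-- A morphism `(ΛV, d) → C`, injective on cocycles of degree one, with `V` in positive degrees. -/
structure Stage (C : CDGA) : Type 1 where
  ι : Type
  deg : ι → ℕ
  d : Differential deg
  f : FreeCGA deg →ₐ[ℚ] C.carrier
  f_gr : ∀ i, f (gen deg i) ∈ C.gr (deg i)
  f_d : ∀ a, f (d.toLin a) = C.d (f a)
  pos : ∀ i, 0 < deg i
  inj : ∀ a ∈ homog deg 1, d.toLin a = 0 → f a = 0 → a = 0

namespace Stage

variable {C : CDGA} (s : Stage C)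

/-- The cocycles of degree `q + 1` of the mapping cone. -/
def coneZ (q : ℕ) : Submodule ℚ (FreeCGA s.deg × C.carrier) where
  -- A pair `(a, c)` prescribes a new generator `z` with `dz = a` and image `c`. The offset gives
  -- `z` degree `q + 1 ≥ 1`, so all generators stay in positive degrees.
  carrier := {x | x.1 ∈ homog s.deg (q + 2) ∧ x.2 ∈ C.gr (q + 1) ∧ s.d.toLin x.1 = 0 ∧
    s.f x.1 = C.d x.2}
  zero_mem' := ⟨Submodule.zero_mem _, Submodule.zero_mem _, map_zero _,
    (map_zero s.f).trans (map_zero C.d).symm⟩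
  add_mem' := fun {x y} hx hy => ⟨Submodule.add_mem _ hx.1 hy.1, Submodule.add_mem _ hx.2.1 hy.2.1,
    by rw [Prod.fst_add, map_add, hx.2.2.1, hy.2.2.1, add_zero],
    (map_add s.f x.1 y.1).trans
      ((congrArg₂ (· + ·) hx.2.2.2 hy.2.2.2).trans (map_add C.d _ _).symm)⟩
  smul_mem' := fun c x hx => ⟨Submodule.smul_mem _ _ hx.1, Submodule.smul_mem _ _ hx.2.1,
    by rw [Prod.smul_fst, map_smul, hx.2.2.1, smul_zero],
    (map_smul s.f c x.1).trans
      ((congrArg (c • ·) hx.2.2.2).trans (map_smul C.d _ _).symm)⟩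

/-- The differential of the mapping cone. -/
noncomputable def coneD : FreeCGA s.deg × C.carrier →ₗ[ℚ] FreeCGA s.deg × C.carrier :=
  (s.d.toLin ∘ₗ LinearMap.fst ℚ _ _).prod
    (s.f.toLinearMap.coprod C.d)

theorem coneD_apply (a : FreeCGA s.deg) (b : C.carrier) :
    s.coneD (a, b) = (s.d.toLin a, s.f a + C.d b) := rfl

/-- The coboundaries of degree `q + 1` of the mapping cone. -/
noncomputable def coneB (q : ℕ) : Submodule ℚ (FreeCGA s.deg × C.carrier) :=
  ((homog s.deg (q + 1)).prod (C.gr q)).map s.coneD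

theorem coneB_le (q : ℕ) : s.coneB q ≤ s.coneZ q := by
  rintro _ ⟨⟨a, b⟩, ⟨ha, hb⟩, rfl⟩
  refine ⟨s.d.mem ha, Submodule.add_mem _ (algHom_map_gr C s.f s.f_gr ha) (C.d_mem hb), s.d.sq a, ?_⟩
  exact (s.f_d a).trans (by rw [coneD_apply, map_add, C.d_d, add_zero])

/-- A complement in the whole space, cut down to the cocycles, still works by the modular law. -/
theorem exists_complement (q : ℕ) : ∃ N : Submodule ℚ (FreeCGA s.deg × C.carrier),
    N ≤ s.coneZ q ∧ Disjoint (s.coneB q) N ∧ s.coneZ q ≤ s.coneB q ⊔ N := by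
  obtain ⟨K, hK⟩ := Submodule.exists_isCompl (s.coneB q)
  refine ⟨K ⊓ s.coneZ q, inf_le_right, hK.disjoint.mono_right inf_le_left, ?_⟩
  rw [← sup_inf_assoc_of_le _ (s.coneB_le q), hK.sup_eq_top, top_inf_eq]

/-- A complement of the coboundaries in the cocycles of the mapping cone. -/
noncomputable def compl (q : ℕ) : Submodule ℚ (FreeCGA s.deg × C.carrier) :=
  (s.exists_complement q).choose

theorem compl_le (q : ℕ) : s.compl q ≤ s.coneZ q := (s.exists_complement q).choose_spec.1
theorem compl_disjoint (q : ℕ) : Disjoint (s.coneB q) (s.compl q) :=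
  (s.exists_complement q).choose_spec.2.1
theorem le_compl (q : ℕ) : s.coneZ q ≤ s.coneB q ⊔ s.compl q :=
  (s.exists_complement q).choose_spec.2.2

/-- The generators killing the cohomology of the mapping cone. -/
abbrev NewGen : Type := Σ q : ℕ, Module.Basis.ofVectorSpaceIndex ℚ (s.compl q)

/-- The degrees of the new generators. -/
def newDeg (z : s.NewGen) : ℕ := z.1 + 1

/-- The cone cocycles killed by the new generators. -/
noncomputable def newCone (z : s.NewGen) : FreeCGA s.deg × C.carrier :=
  (Module.Basis.ofVectorSpace ℚ (s.compl z.1) z.2 : FreeCGA s.deg × C.carrier)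

theorem newCone_mem (z : s.NewGen) : s.newCone z ∈ s.coneZ z.1 :=
  s.compl_le _ (Subtype.property _)

/-- The degrees of the generators of the next stage. -/
abbrev nextDeg : s.ι ⊕ s.NewGen → ℕ := Sum.elim s.deg s.newDeg

/-- The inclusion in the next stage. -/
noncomputable def toNext : FreeCGA s.deg →ₐ[ℚ] FreeCGA s.nextDeg := baseIncl s.deg s.newDeg

theorem toNext_gen (i : s.ι) : s.toNext (gen s.deg i) = gen s.nextDeg (Sum.inl i) :=
  rename_gen Sum.inl (fun _ => rfl) i

/-- The values on generators of the differential of the next stage. -/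
noncomputable def nextGen : s.ι ⊕ s.NewGen → FreeCGA s.nextDeg :=
  Sum.elim (fun i => s.toNext (s.d.toLin (gen s.deg i))) (fun z => s.toNext (s.newCone z).1)

theorem nextGen_mem (i : s.ι ⊕ s.NewGen) : s.nextGen i ∈ homog s.nextDeg (s.nextDeg i + 1) := by
  rcases i with i | z
  · exact rename_mem Sum.inl (fun _ => rfl) (s.d.mem (gen_mem s.deg i))
  · exact rename_mem Sum.inl (fun _ => rfl) (s.newCone_mem z).1

theorem derivation_toNext (a : FreeCGA s.deg) :
    derivation s.nextDeg s.nextGen s.nextGen_mem (s.toNext a) = s.toNext (s.d.toLin a) :=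
  Differential.rename_comm (deg := s.deg) Sum.inl (fun _ => rfl) s.d
    (derivation _ s.nextGen s.nextGen_mem)
    (derivation_one _ _ _) (derivation_leibniz _ _ _)
    (fun i => derivation_gen _ s.nextGen s.nextGen_mem (Sum.inl i)) a

/-- The differential of the next stage. -/
noncomputable def nextD : Differential s.nextDeg :=
  Differential.ofGen _ s.nextGen s.nextGen_mem (by
    rintro (i | z)
    · exact (s.derivation_toNext _).trans ((congrArg _ (s.d.sq _)).trans (map_zero _))
    · exact (s.derivation_toNext _).trans
        ((congrArg _ (s.newCone_mem z).2.2.1).trans (map_zero _)))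

theorem nextD_toNext (a : FreeCGA s.deg) : s.nextD.toLin (s.toNext a) = s.toNext (s.d.toLin a) :=
  s.derivation_toNext a

theorem nextD_new (z : s.NewGen) :
    s.nextD.toLin (gen s.nextDeg (Sum.inr z)) = s.toNext (s.newCone z).1 :=
  derivation_gen _ _ _ _

theorem nextGenVal_mem (i : s.ι ⊕ s.NewGen) :
    (Sum.elim (fun i => s.f (gen s.deg i)) (fun z => (s.newCone z).2) i : C.carrier) ∈
      C.gr (s.nextDeg i) := by
  rcases i with i | z
  · exact s.f_gr i
  · exact (s.newCone_mem z).2.1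

/-- The map on the next stage, as an algebra map. -/
noncomputable def nextAlgHom : FreeCGA s.nextDeg →ₐ[ℚ] C.carrier :=
  lift s.nextDeg (Sum.elim (fun i => s.f (gen s.deg i)) (fun z => (s.newCone z).2))
    (fun i j => C.comm (s.nextGenVal_mem i) (s.nextGenVal_mem j))

theorem nextAlgHom_toNext (a : FreeCGA s.deg) :
    s.nextAlgHom (s.toNext a) = s.f a :=
  algHom_ext (f := s.nextAlgHom.comp s.toNext) (g := s.f) (fun i => by
    rw [AlgHom.comp_apply, toNext_gen]; exact lift_gen _ _ _ _) a

theorem nextAlgHom_new (z : s.NewGen) :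
    s.nextAlgHom (gen s.nextDeg (Sum.inr z)) = (s.newCone z).2 := lift_gen _ _ _ _

theorem nextAlgHom_gr (i : s.ι ⊕ s.NewGen) : s.nextAlgHom (gen s.nextDeg i) ∈ C.gr (s.nextDeg i) := by
  have h : s.nextAlgHom (gen s.nextDeg i) = _ := lift_gen _ _ _ _
  rw [h]
  exact s.nextGenVal_mem i

theorem nextAlgHom_d (a : FreeCGA s.nextDeg) :
    s.nextAlgHom (s.nextD.toLin a) = C.d (s.nextAlgHom a) := by
  refine algHom_map_d s.nextD C s.nextAlgHom s.nextAlgHom_gr ?_ a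
  rintro (i | z)
  · rw [← toNext_gen, nextD_toNext, nextAlgHom_toNext, nextAlgHom_toNext]
    exact s.f_d _
  · rw [nextD_new, nextAlgHom_toNext, nextAlgHom_new]
    exact (s.newCone_mem z).2.2.2

/-- The linear extension of the new generators. -/
noncomputable def newLin (q : ℕ) : s.compl q →ₗ[ℚ] FreeCGA s.nextDeg :=
  (Module.Basis.ofVectorSpace ℚ (s.compl q)).constr ℚ
    (fun i => gen s.nextDeg (Sum.inr ⟨q, i⟩))

theorem newLin_basis (q : ℕ) (i : Module.Basis.ofVectorSpaceIndex ℚ (s.compl q)) :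
    s.newLin q (Module.Basis.ofVectorSpace ℚ (s.compl q) i) = gen s.nextDeg (Sum.inr ⟨q, i⟩) :=
  Module.Basis.constr_basis _ _ _ _

theorem nextD_newLin (q : ℕ) (n : s.compl q) : s.nextD.toLin (s.newLin q n) = s.toNext n.1.1 := by
  have h : s.nextD.toLin ∘ₗ s.newLin q =
      s.toNext.toLinearMap ∘ₗ LinearMap.fst ℚ _ _ ∘ₗ (s.compl q).subtype :=
    (Module.Basis.ofVectorSpace ℚ (s.compl q)).ext fun i => by
      rw [LinearMap.comp_apply, newLin_basis, nextD_new]; rfl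
  exact LinearMap.congr_fun h n

theorem nextAlgHom_newLin (q : ℕ) (n : s.compl q) : s.nextAlgHom (s.newLin q n) = n.1.2 := by
  have h : s.nextAlgHom.toLinearMap ∘ₗ s.newLin q =
      LinearMap.snd ℚ _ _ ∘ₗ (s.compl q).subtype :=
    (Module.Basis.ofVectorSpace ℚ (s.compl q)).ext fun i => by
      rw [LinearMap.comp_apply, newLin_basis]; exact s.nextAlgHom_new _
  exact LinearMap.congr_fun h n

theorem nextDeg_pos (i : s.ι ⊕ s.NewGen) : 0 < s.nextDeg i := by
  rcases i with i | z
  · exact s.pos i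
  · exact Nat.succ_pos _

/-- With generators in positive degrees a word of degree one is a single letter, old or new, and a
new one of degree one comes from `q = 0`. -/
theorem homog_one_le : homog s.nextDeg 1 ≤
    (homog s.deg 1).map s.toNext.toLinearMap ⊔ LinearMap.range (s.newLin 0) := by
  refine Submodule.span_le.2 ?_
  rintro _ ⟨l, hl, rfl⟩
  obtain ⟨i, hi, rfl⟩ := word_degree_one s.nextDeg_pos hl
  rw [word_cons, word_nil, mul_one]
  rcases i with i | ⟨q, i⟩
  · refine Submodule.mem_sup_left ⟨gen s.deg i, ?_, s.toNext_gen i⟩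
    have h := gen_mem s.deg i
    have hi' : s.deg i = 1 := hi
    rwa [hi'] at h
  · have hq : q = 0 := by
      have : q + 1 = 1 := hi
      omega
    subst hq
    exact Submodule.mem_sup_right ⟨_, s.newLin_basis 0 i⟩

/-- Adjoining generators which kill the cohomology of the mapping cone. -/
noncomputable def next : Stage C where
  ι := s.ι ⊕ s.NewGen
  deg := s.nextDeg
  d := s.nextD
  f := s.nextAlgHom
  f_gr := s.nextAlgHom_gr
  f_d := s.nextAlgHom_d
  pos := s.nextDeg_pos
  inj := by
    intro a ha hda hfa
    obtain ⟨_, ⟨a0, ha0, rfl⟩, _, ⟨n, rfl⟩, rfl⟩ := Submodule.mem_sup.1 (s.homog_one_le ha)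
    change s.nextD.toLin (s.toNext a0 + s.newLin 0 n) = 0 at hda
    change s.nextAlgHom (s.toNext a0 + s.newLin 0 n) = 0 at hfa
    rw [map_add, nextD_toNext, nextD_newLin, ← map_add] at hda
    rw [map_add, nextAlgHom_toNext, nextAlgHom_newLin] at hfa
    have hda' := (map_eq_zero_iff s.toNext
      (rename_injective Sum.inl (fun _ => rfl) Sum.inl_injective)).1 hda
    -- If `a0 + z` is a cocycle mapping to zero, the cone cocycle `n` behind `z` is the boundary of
    -- `(-a0, 0)`. It also lies in the chosen complement of the boundaries, so it vanishes, and
    -- injectivity is inherited from the previous stage. This is why complements of boundaries are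
    -- used rather than all cone cocycles.
    have hn : n.1 ∈ s.coneB 0 := by
      refine ⟨(-a0, 0), ⟨Submodule.neg_mem _ ha0, Submodule.zero_mem _⟩, ?_⟩
      rw [coneD_apply]
      refine Prod.ext ?_ ?_
      · change s.d.toLin (-a0) = n.1.1
        rw [map_neg]; exact neg_eq_of_add_eq_zero_right hda'
      · change s.f (-a0) + C.d 0 = n.1.2
        rw [map_zero, add_zero]
        exact (map_neg s.f a0).trans (neg_eq_of_add_eq_zero_right hfa)
    have hn0 : n = 0 := Subtype.ext (Submodule.disjoint_def.1 (s.compl_disjoint 0) _ hn n.2)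
    subst hn0
    have e1 : s.d.toLin a0 = 0 := by simpa using hda'
    have e2 : s.f a0 = 0 := by simpa using hfa
    rw [s.inj a0 ha0 e1 e2, map_zero, map_zero, add_zero]

/-- Cone cocycles of a stage are coboundaries in the next one. -/
theorem cone_exact {q : ℕ} {x : FreeCGA s.deg × C.carrier} (hx : x ∈ s.coneZ q) :
    ∃ (a : FreeCGA s.nextDeg) (b : C.carrier), s.nextD.toLin a = s.toNext x.1 ∧
      s.nextAlgHom a + C.d b = x.2 := by
  obtain ⟨_, ⟨⟨a, b⟩, -, rfl⟩, n, hn, rfl⟩ := Submodule.mem_sup.1 (s.le_compl q hx)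
  refine ⟨s.toNext a + s.newLin q ⟨n, hn⟩, b, ?_, ?_⟩
  · rw [map_add, nextD_toNext, nextD_newLin, ← map_add]; rfl
  · rw [map_add, nextAlgHom_toNext, nextAlgHom_newLin, coneD_apply, Prod.snd_add]
    exact add_right_comm _ _ _

end Stage

end Stage

end RatTC

namespace RatTC

open FreeCGA

/-! ### The limit of the stages and existence of relative Sullivan models. -/

section Tower

namespace Stage

variable {C : CDGA} (s : Stage C)

/-- The iterated stages. -/
noncomputable def tower : ℕ → Stage C
  | 0 => s
  | k + 1 => (tower k).next

/-- All the adjoined generators. -/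
abbrev AllGen : Type := Σ k : ℕ, (s.tower k).NewGen

/-- The degrees of all the adjoined generators. -/
noncomputable def allGenDeg (z : s.AllGen) : ℕ := (s.tower z.1).newDeg z.2

/-- The degrees of all the generators. -/
noncomputable abbrev limDeg : s.ι ⊕ s.AllGen → ℕ := Sum.elim s.deg s.allGenDeg

/-- The generators of a stage among all the generators. -/
def incl : (k : ℕ) → (s.tower k).ι → s.ι ⊕ s.AllGen
  | 0 => Sum.inl
  | k + 1 => Sum.elim (incl k) (fun z => Sum.inr ⟨k, z⟩)

theorem incl_deg (k : ℕ) (i : (s.tower k).ι) : s.limDeg (s.incl k i) = (s.tower k).deg i := by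
  induction k with
  | zero => rfl
  | succ k ih =>
    rcases i with i | z
    · exact ih i
    · rfl

/-- Generators present at stage `k` were adjoined at earlier stages; this yields the strict decrease
of heights in the KS condition. -/
theorem incl_eq_inr {k : ℕ} {i : (s.tower k).ι} {z : s.AllGen} (h : s.incl k i = Sum.inr z) :
    z.1 < k := by
  induction k with
  | zero => exact absurd h Sum.inl_ne_inr
  | succ k ih =>
    rcases i with i | z'
    · exact (ih h).trans (Nat.lt_succ_self k)
    · obtain rfl : (⟨k, z'⟩ : s.AllGen) = z := Sum.inr_injective h
      exact Nat.lt_succ_self k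

theorem incl_injective (k : ℕ) : Function.Injective (s.incl k) := by
  induction k with
  | zero => exact Sum.inl_injective
  | succ k ih =>
    rintro (i | z) (i' | z') h
    · exact congrArg Sum.inl (ih h)
    · exact absurd (s.incl_eq_inr (z := ⟨k, z'⟩) (i := i) h) (lt_irrefl k)
    · exact absurd (s.incl_eq_inr (z := ⟨k, z⟩) (i := i') h.symm) (lt_irrefl k)
    · have h' : (⟨k, z⟩ : s.AllGen) = ⟨k, z'⟩ := Sum.inr_injective h
      simp only [Sigma.mk.injEq, heq_eq_eq, true_and] at h'
      exact congrArg Sum.inr h'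

/-- The inclusion of a stage in the limit. -/
noncomputable def toLim (k : ℕ) : FreeCGA (s.tower k).deg →ₐ[ℚ] FreeCGA s.limDeg :=
  rename (s.incl k) (s.incl_deg k)

theorem toLim_injective (k : ℕ) : Function.Injective (s.toLim k) :=
  rename_injective _ _ (s.incl_injective k)

theorem toLim_gen (k : ℕ) (i : (s.tower k).ι) :
    s.toLim k (gen (s.tower k).deg i) = gen s.limDeg (s.incl k i) := rename_gen _ _ _

/-- The inclusion of the successor of a stage in the limit. -/
noncomputable def toLimNext (k : ℕ) : FreeCGA (s.tower k).nextDeg →ₐ[ℚ] FreeCGA s.limDeg :=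
  s.toLim (k + 1)

theorem toLimNext_gen (k : ℕ) (i : (s.tower k).ι ⊕ (s.tower k).NewGen) :
    s.toLimNext k (gen (s.tower k).nextDeg i) = gen s.limDeg (s.incl (k + 1) i) :=
  s.toLim_gen (k + 1) i

theorem toLim_toNext (k : ℕ) (a : FreeCGA (s.tower k).deg) :
    s.toLim (k + 1) ((s.tower k).toNext a) = s.toLim k a :=
  algHom_ext (f := (s.toLimNext k).comp (s.tower k).toNext) (g := s.toLim k) (fun i => by
    rw [AlgHom.comp_apply, toNext_gen, toLim_gen, toLimNext_gen]
    rfl) a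

theorem exists_toLim_of_le {k k' : ℕ} (h : k ≤ k') (a : FreeCGA (s.tower k).deg) :
    ∃ a', s.toLim k' a' = s.toLim k a := by
  induction h with
  | refl => exact ⟨a, rfl⟩
  | step _ ih =>
    obtain ⟨a', ha'⟩ := ih
    exact ⟨_, (s.toLim_toNext _ a').trans ha'⟩

theorem exists_toLim (a : FreeCGA s.limDeg) : ∃ k a', s.toLim k a' = a := by
  induction a using word_induction with
  | h0 => exact ⟨0, 0, map_zero _⟩
  | hadd a b ha hb =>
    obtain ⟨k, a, rfl⟩ := ha
    obtain ⟨k', b, rfl⟩ := hb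
    obtain ⟨a', ha'⟩ := s.exists_toLim_of_le (le_max_left k k') a
    obtain ⟨b', hb'⟩ := s.exists_toLim_of_le (le_max_right k k') b
    exact ⟨max k k', a' + b', by rw [map_add, ha', hb']⟩
  | hsmul c a ha =>
    obtain ⟨k, a, rfl⟩ := ha
    exact ⟨k, c • a, map_smul _ _ _⟩
  | hw l =>
    induction l with
    | nil => exact ⟨0, 1, by rw [map_one, word_nil]⟩
    | cons i l ih =>
      have hi : ∃ k a', s.toLim k a' = gen s.limDeg i := by
        rcases i with i | ⟨k, z⟩
        · exact ⟨0, _, s.toLim_gen 0 i⟩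
        · exact ⟨k + 1, _, s.toLim_gen (k + 1) (Sum.inr z)⟩
      obtain ⟨k, a, ha⟩ := hi
      obtain ⟨k', b, hb⟩ := ih
      obtain ⟨a', ha'⟩ := s.exists_toLim_of_le (le_max_left k k') a
      obtain ⟨b', hb'⟩ := s.exists_toLim_of_le (le_max_right k k') b
      exact ⟨max k k', a' * b', by rw [map_mul, ha', hb', ha, hb, word_cons]⟩

/-- The values on generators of the differential of the limit. -/
noncomputable def limGen : s.ι ⊕ s.AllGen → FreeCGA s.limDeg :=
  Sum.elim (fun i => s.toLim 0 (s.d.toLin (gen s.deg i)))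
    (fun z => s.toLim z.1 ((s.tower z.1).newCone z.2).1)

theorem limGen_mem (i : s.ι ⊕ s.AllGen) : s.limGen i ∈ homog s.limDeg (s.limDeg i + 1) := by
  rcases i with i | z
  · exact rename_mem (s.incl 0) (s.incl_deg 0) (s.d.mem (gen_mem s.deg i))
  · exact rename_mem (s.incl z.1) (s.incl_deg z.1) ((s.tower z.1).newCone_mem z.2).1

theorem derivation_toLim (k : ℕ) (a : FreeCGA (s.tower k).deg) :
    derivation s.limDeg s.limGen s.limGen_mem (s.toLim k a) =
      s.toLim k ((s.tower k).d.toLin a) := by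
  induction k with
  | zero =>
    exact Differential.rename_comm (deg := s.deg) (s.incl 0) (s.incl_deg 0) s.d
      (derivation _ s.limGen s.limGen_mem) (derivation_one _ _ _) (derivation_leibniz _ _ _)
      (fun i => derivation_gen _ s.limGen s.limGen_mem (Sum.inl i)) a
  | succ k ih =>
    refine Differential.rename_comm (deg := (s.tower k).nextDeg) (s.incl (k + 1))
      (s.incl_deg (k + 1)) (s.tower k).nextD
      (derivation _ s.limGen s.limGen_mem) (derivation_one _ _ _) (derivation_leibniz _ _ _)
      ?_ a
    rintro (i | z)
    · have h := ih (gen _ i)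
      rw [toLim_gen, ← toLim_toNext, ← nextD_toNext, toNext_gen] at h
      exact h
    · rw [nextD_new]
      exact (derivation_gen _ s.limGen s.limGen_mem (Sum.inr ⟨k, z⟩)).trans
        (s.toLim_toNext k _).symm

/-- The differential of the limit. -/
noncomputable def limD : Differential s.limDeg :=
  Differential.ofGen _ s.limGen s.limGen_mem (by
    rintro (i | z)
    · exact (s.derivation_toLim 0 _).trans ((congrArg _ (s.d.sq _)).trans (map_zero _))
    · exact (s.derivation_toLim z.1 _).trans
        ((congrArg _ ((s.tower z.1).newCone_mem z.2).2.2.1).trans (map_zero _)))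

theorem limD_toLim (k : ℕ) (a : FreeCGA (s.tower k).deg) :
    s.limD.toLin (s.toLim k a) = s.toLim k ((s.tower k).d.toLin a) := s.derivation_toLim k a

theorem limGenVal_mem (i : s.ι ⊕ s.AllGen) :
    (Sum.elim (fun i => s.f (gen s.deg i)) (fun z => ((s.tower z.1).newCone z.2).2) i :
      C.carrier) ∈ C.gr (s.limDeg i) := by
  rcases i with i | z
  · exact s.f_gr i
  · exact ((s.tower z.1).newCone_mem z.2).2.1

/-- The map on the limit. -/
noncomputable def limAlgHom : FreeCGA s.limDeg →ₐ[ℚ] C.carrier :=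
  lift s.limDeg (Sum.elim (fun i => s.f (gen s.deg i))
    (fun z => ((s.tower z.1).newCone z.2).2))
    (fun i j => C.comm (s.limGenVal_mem i) (s.limGenVal_mem j))

theorem limAlgHom_gr (i : s.ι ⊕ s.AllGen) : s.limAlgHom (gen s.limDeg i) ∈ C.gr (s.limDeg i) := by
  have h : s.limAlgHom (gen s.limDeg i) = _ := lift_gen _ _ _ _
  rw [h]
  exact s.limGenVal_mem i

theorem limAlgHom_toLim (k : ℕ) (a : FreeCGA (s.tower k).deg) :
    s.limAlgHom (s.toLim k a) = (s.tower k).f a := by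
  induction k with
  | zero =>
    exact algHom_ext (f := s.limAlgHom.comp (s.toLim 0)) (g := s.f) (fun i => by
      rw [AlgHom.comp_apply]
      exact (congrArg s.limAlgHom (s.toLim_gen 0 i)).trans (lift_gen _ _ _ (Sum.inl i))) a
  | succ k ih =>
    refine algHom_ext (deg := (s.tower k).nextDeg) (f := s.limAlgHom.comp (s.toLimNext k))
      (g := (s.tower k).nextAlgHom) ?_ a
    rintro (i | z)
    · rw [← toNext_gen, nextAlgHom_toNext, AlgHom.comp_apply]
      exact (congrArg s.limAlgHom (s.toLim_toNext k _)).trans (ih _)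
    · rw [nextAlgHom_new, AlgHom.comp_apply, toLimNext_gen]
      exact lift_gen s.limDeg _ _ (Sum.inr ⟨k, z⟩)

theorem limAlgHom_d (a : FreeCGA s.limDeg) : s.limAlgHom (s.limD.toLin a) = C.d (s.limAlgHom a) := by
  obtain ⟨k, a, rfl⟩ := s.exists_toLim a
  rw [limD_toLim, limAlgHom_toLim, limAlgHom_toLim, (s.tower k).f_d]

theorem exists_toLim_homog {p : ℕ} {a : FreeCGA s.limDeg} (ha : a ∈ homog s.limDeg p) :
    ∃ k, ∃ a' ∈ homog (s.tower k).deg p, s.toLim k a' = a := by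
  obtain ⟨k, a, rfl⟩ := s.exists_toLim a
  let F : (free (s.tower k).d).Hom (free s.limD) :=
    { toAlgHom := s.toLim k
      map_gr := fun ha => rename_mem _ _ ha
      map_d := fun a => (s.limD_toLim k a).symm }
  exact ⟨k, (free (s.tower k).d).proj p a, (free (s.tower k).d).proj_mem p a,
    (F.map_proj p a).trans ((free s.limD).proj_same ha)⟩

/-- A cone cocycle involves finitely many generators, so it lives at a finite stage and becomes a
coboundary at the next one. -/
theorem lim_cone_exact {q : ℕ} {a : FreeCGA s.limDeg} (ha : a ∈ homog s.limDeg (q + 2))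
    (hda : s.limD.toLin a = 0) {c : C.carrier} (hc : c ∈ C.gr (q + 1))
    (hac : s.limAlgHom a = C.d c) :
    ∃ (a' : FreeCGA s.limDeg) (b : C.carrier), s.limD.toLin a' = a ∧
      s.limAlgHom a' + C.d b = c := by
  obtain ⟨k, a, ha', rfl⟩ := s.exists_toLim_homog ha
  rw [limD_toLim, map_eq_zero_iff _ (s.toLim_injective k)] at hda
  rw [limAlgHom_toLim] at hac
  obtain ⟨a', b, h1, h2⟩ := (s.tower k).cone_exact (x := (a, c)) ⟨ha', hc, hda, hac⟩
  exact ⟨s.toLim (k + 1) a', b,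
    (s.limD_toLim (k + 1) a').trans ((congrArg _ h1).trans (s.toLim_toNext k a)),
    (congrArg (· + C.d b) (s.limAlgHom_toLim (k + 1) a')).trans h2⟩

theorem lim_inj {a : FreeCGA s.limDeg} (ha : a ∈ homog s.limDeg 1)
    (hda : s.limD.toLin a = 0) (h : s.limAlgHom a = 0) : a = 0 := by
  obtain ⟨k, a, ha', rfl⟩ := s.exists_toLim_homog ha
  rw [limD_toLim, map_eq_zero_iff _ (s.toLim_injective k)] at hda
  rw [limAlgHom_toLim] at h
  rw [(s.tower k).inj a ha' hda h, map_zero]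

/-- The morphism on the limit. -/
noncomputable def limHom : (free s.limD).Hom C where
  toAlgHom := s.limAlgHom
  map_gr := fun ha => algHom_map_gr C s.limAlgHom s.limAlgHom_gr ha
  map_d := s.limAlgHom_d

theorem limDeg_pos (i : s.ι ⊕ s.AllGen) : 0 < s.limDeg i := by
  rcases i with i | z
  · exact s.pos i
  · exact Nat.succ_pos _

/-- Argued degree by degree. The cone argument gives injectivity in cohomology only from degree two
on. In degree zero the source consists of scalars and `1 ≠ 0`; in degree one the differential of `C`
vanishes on scalars, so a cocycle with exact image maps to zero and `lim_inj` applies. -/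
theorem limHom_quasiIso (h0 : ∀ c ∈ C.gr 0, ∃ q : ℚ, c = q • 1) (h1 : (1 : C.carrier) ≠ 0) :
    s.limHom.QuasiIso := by
  rw [CDGA.Hom.quasiIso_iff]
  constructor
  · intro a ha b hb
    have key : ∀ p, ∃ c, s.limD.toLin c = (free s.limD).proj p a := by
      intro p
      have hda : s.limD.toLin ((free s.limD).proj p a) = 0 :=
        ((free s.limD).d_proj p a).trans ((congrArg _ ha).trans (map_zero _))
      have hf : s.limAlgHom ((free s.limD).proj p a) = C.proj p (C.d b) :=
        (s.limHom.map_proj p a).trans (congrArg _ hb.symm)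
      have hm : (free s.limD).proj p a ∈ homog s.limDeg p := (free s.limD).proj_mem p a
      match p with
      | 0 =>
        obtain ⟨q, hq⟩ := homog_zero s.limDeg_pos hm
        rw [hq, C.proj_zero_d, map_smul, map_one, smul_eq_zero] at hf
        exact ⟨0, by rw [hq, hf.resolve_right h1, zero_smul, map_zero]⟩
      | 1 =>
        obtain ⟨q, hq⟩ := h0 _ (C.proj_mem 0 b)
        rw [← C.d_proj, hq, map_smul, C.d_one, smul_zero] at hf
        exact ⟨0, by rw [s.lim_inj hm hda hf, map_zero]⟩
      | p + 2 =>
        rw [← C.d_proj] at hf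
        obtain ⟨c, _, hc, -⟩ := s.lim_cone_exact hm hda (C.proj_mem (p + 1) b) hf
        exact ⟨c, hc⟩
    choose c hc using key
    obtain ⟨N, hN⟩ := (free s.limD).exists_proj_sum a
    refine ⟨∑ p ∈ Finset.range N, c p, ?_⟩
    refine Eq.trans ?_ (hN N le_rfl)
    exact (map_sum s.limD.toLin _ _).trans (Finset.sum_congr rfl fun p _ => hc p)
  · intro b hb
    have key : ∀ p, ∃ (a : FreeCGA s.limDeg) (c : C.carrier), s.limD.toLin a = 0 ∧
        C.d c = C.proj p b - s.limAlgHom a := by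
      intro p
      match p with
      | 0 =>
        obtain ⟨q, hq⟩ := h0 _ (C.proj_mem 0 b)
        refine ⟨q • 1, 0, ?_, ?_⟩
        · rw [map_smul, s.limD.isOddDer.one, smul_zero]
        · rw [hq, map_smul, map_one, sub_self, map_zero]
      | p + 1 =>
        -- A cocycle of `C` is a cone cocycle with zero first component, so cone exactness also
        -- gives surjectivity in positive degrees.
        obtain ⟨a, c, ha, hc⟩ := s.lim_cone_exact (q := p) (a := 0) (Submodule.zero_mem _)
          (map_zero _) (C.proj_mem (p + 1) b) (by rw [map_zero, C.d_proj, hb, map_zero])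
        exact ⟨a, c, ha, by rw [← hc]; abel⟩
    choose a c ha hc using key
    obtain ⟨N, hN⟩ := C.exists_proj_sum b
    refine ⟨∑ p ∈ Finset.range N, a p, ?_, ∑ p ∈ Finset.range N, c p, ?_⟩
    · exact (map_sum s.limD.toLin _ _).trans (Finset.sum_eq_zero fun p _ => ha p)
    · refine Eq.trans ?_ (congrArg₂ (· - ·) (hN N le_rfl) (map_sum s.limAlgHom a _).symm)
      rw [map_sum, Finset.sum_congr rfl fun p _ => hc p, Finset.sum_sub_distrib]

/-- The height of a generator is the stage at which it was adjoined: its differential is an element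
of that stage, hence involves only base generators and generators adjoined before. -/
theorem lim_isKSExtension : IsKSExtension s.d s.limD := by
  refine ⟨fun a => s.limD_toLim 0 a, fun z => z.1, fun z => ?_⟩
  have h : s.limD.toLin (gen s.limDeg (Sum.inr z)) = s.toLim z.1 ((s.tower z.1).newCone z.2).1 :=
    derivation_gen _ s.limGen s.limGen_mem (Sum.inr z)
  rw [h]
  generalize ((s.tower z.1).newCone z.2).1 = a
  induction a using word_induction with
  | h0 => rw [map_zero]; exact Subalgebra.zero_mem _
  | hadd a b ha hb => rw [map_add]; exact Subalgebra.add_mem _ ha hb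
  | hsmul c a ha => rw [map_smul]; exact Subalgebra.smul_mem _ ha c
  | hw l =>
    induction l with
    | nil => rw [word_nil, map_one]; exact Subalgebra.one_mem _
    | cons i l ih =>
      rw [word_cons, map_mul, toLim_gen]
      refine Subalgebra.mul_mem _ (Algebra.subset_adjoin ?_) ih
      rcases hi : s.incl z.1 i with j | z'
      · exact Or.inl ⟨j, rfl⟩
      · exact Or.inr ⟨z', s.incl_eq_inr hi, rfl⟩

end Stage

/-- Existence of relative Sullivan models. -/
theorem exists_relativeSullivanModel {ι : Type} {deg : ι → ℕ} (d : Differential deg) {C : CDGA}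
    (f : (free d).Hom C) (pos : ∀ i, 0 < deg i)
    (inj : ∀ a ∈ homog deg 1, d.toLin a = 0 → f.toAlgHom a = 0 → a = 0)
    (h0 : ∀ c ∈ C.gr 0, ∃ q : ℚ, c = q • 1) (h1 : (1 : C.carrier) ≠ 0) :
    ∃ (κ : Type) (degZ : κ → ℕ) (D : Differential (Sum.elim deg degZ)),
      IsKSExtension d D ∧ ∃ ξ : (free D).Hom C, ξ.QuasiIso ∧
        ∀ a : FreeCGA deg, ξ.toAlgHom (baseIncl deg degZ a) = f.toAlgHom a := by
  let s : Stage C :=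
    { ι := ι
      deg := deg
      d := d
      f := f.toAlgHom
      f_gr := fun i => f.map_gr (gen_mem deg i)
      f_d := f.map_d
      pos := pos
      inj := inj }
  exact ⟨s.AllGen, s.allGenDeg, s.limD, s.lim_isKSExtension, s.limHom, s.limHom_quasiIso h0 h1,
    s.limAlgHom_toLim 0⟩

end Tower

end RatTC

namespace RatTC

open FreeCGA

set_option linter.unusedSectionVars false

/-! ### A homotopy retraction from an acyclic ideal. -/

section Retraction

variable {ι : Type} {deg : ι → ℕ}

/-- The morphism `A / K → A / J` for `K ≤ J`. -/
def CDGA.factorHom (A : CDGA) {K J : Ideal A.carrier} [K.IsTwoSided] [J.IsTwoSided]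
    (hK : A.IsDGIdeal K) (hJ : A.IsDGIdeal J) (h : K ≤ J) : (A.quot K hK).Hom (A.quot J hJ) where
  toAlgHom := Ideal.Quotient.factorₐ ℚ h
  map_gr := by
    rintro p _ ⟨a, ha, rfl⟩
    exact ⟨a, ha, rfl⟩
  map_d := fun a => by
    obtain ⟨a, rfl⟩ := Ideal.Quotient.mk_surjective a
    rfl

/-- The identity morphism. -/
def CDGA.idHom (A : CDGA) : A.Hom A where
  toAlgHom := AlgHom.id ℚ A.carrier
  map_gr := fun ha => ha
  map_d := fun _ => rfl

theorem smul_one_mem_iff {A : Type} [Ring A] [Algebra ℚ A] {J : Ideal A} (h1 : (1 : A) ∉ J)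
    {q : ℚ} (h : q • (1 : A) ∈ J) : q = 0 := by
  by_contra hq
  refine h1 ?_
  have := (J.restrictScalars ℚ).smul_mem q⁻¹ h
  rwa [smul_smul, inv_mul_cancel₀ hq, one_smul] at this

/-- The projection `A → A / K` admits a homotopy retraction if `K` is contained in an acyclic
ideal. -/
theorem hasHomotopyRetraction_quotHom (d : Differential deg) (pos : ∀ i, 0 < deg i)
    (K J : Ideal (free d).carrier) [K.IsTwoSided] [J.IsTwoSided] (hK : (free d).IsDGIdeal K)
    (hJ : (free d).IsDGIdeal J) (hKJ : K ≤ J) (h1 : (1 : (free d).carrier) ∉ J)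
    (hac : ∀ a ∈ J, (free d).d a = 0 → ∃ b ∈ J, (free d).d b = a) :
    HasHomotopyRetraction ((free d).quotHom K hK) := by
  -- The target of the model is `A ×_{A/J} A/K`. It receives `A` by the identity and the projection;
  -- its second projection is a quasi-isomorphism because `J` is acyclic, and its first projection
  -- composed with the model map is the retraction.
  let f := (free d).quotHom J hJ
  let g := (free d).factorHom hK hJ hKJ
  let φ := pullbackLift f g (free d).idHom ((free d).quotHom K hK) (fun _ => rfl)
  -- In degree zero both components are scalars, and they agree in `A/J`; as `1 ∉ J`, they are the
  -- same scalar.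
  have hgr0 : ∀ c ∈ (pullback f g).gr 0, ∃ q : ℚ, c = q • 1 := by
    rintro ⟨⟨a, b⟩, hab⟩ ⟨ha, hb⟩
    obtain ⟨q, rfl⟩ := homog_zero pos ha
    obtain ⟨b, hb', rfl⟩ := hb
    obtain ⟨q', rfl⟩ := homog_zero pos hb'
    have hJ' : (q • 1 : (free d).carrier) - q' • 1 ∈ J := Ideal.Quotient.eq.1 hab
    rw [← sub_smul] at hJ'
    obtain rfl := sub_eq_zero.1 (smul_one_mem_iff h1 hJ')
    refine ⟨q, Subtype.ext (Prod.ext rfl ?_)⟩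
    change Ideal.Quotient.mkₐ ℚ K (q • 1) = q • 1
    rw [map_smul, map_one]
  have hne : (1 : (pullback f g).carrier) ≠ 0 := by
    intro h
    have h' : (1 : (free d).carrier) = 0 := congrArg (fun x : pullbackAlg f g => x.1.1) h
    exact h1 (h' ▸ J.zero_mem)
  obtain ⟨κ, degZ, D, hKS, ξ, hξ, hξi⟩ := exists_relativeSullivanModel d φ pos
    (fun a _ _ h => congrArg (fun x : pullbackAlg f g => x.1.1) h) hgr0 hne
  refine ⟨κ, degZ, D, hKS, ⟨(pullbackSnd f g).comp ξ, ?_, fun a => ?_⟩,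
    (pullbackFst f g).comp ξ, fun a => ?_⟩
  · refine CDGA.Hom.QuasiIso.comp (pullbackSnd_quasiIso f g
      (Ideal.Quotient.mkₐ_surjective ℚ J) fun a ha hda => ?_) hξ
    obtain ⟨b, hb, hdb⟩ := hac a (Ideal.Quotient.eq_zero_iff_mem.1 ha) hda
    exact ⟨b, Ideal.Quotient.eq_zero_iff_mem.2 hb, hdb⟩
  · exact congrArg (pullbackSnd f g).toAlgHom (hξi a)
  · exact congrArg (pullbackFst f g).toAlgHom (hξi a)

theorem one_not_mem_sqIdeal {τ : Type} (x u : τ → ι) (S : List τ) :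
    (1 : FreeCGA deg) ∉ sqIdeal deg x u S := by
  intro h
  let ε : FreeCGA deg →ₐ[ℚ] ℚ := lift deg (fun _ => 0) (by simp)
  have hle : sqIdeal deg x u S ≤ RingHom.ker ε := by
    refine Ideal.span_le.2 ?_
    rintro _ ⟨p, -, rfl | rfl⟩
    · change ε (gen deg (x p) ^ 2) = 0
      rw [map_pow]
      exact (congrArg (· ^ 2) (lift_gen _ _ _ _)).trans (by simp)
    · exact lift_gen _ _ _ _
  have h' : ε 1 = 0 := hle h
  rw [map_one] at h'
  exact one_ne_zero h'

theorem FreeCGA.mul_self_of_odd {p : ℕ} (hp : Odd p) {a : FreeCGA deg} (ha : a ∈ homog deg p) :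
    a * a = 0 := by
  have h := FreeCGA.comm deg ha ha
  rw [(hp.mul hp).neg_one_pow, neg_one_smul] at h
  have h2 : (2 : ℚ) • (a * a) = 0 := by
    rw [two_smul]
    nth_rewrite 1 [h]
    exact neg_add_cancel _
  exact (smul_eq_zero.1 h2).resolve_left two_ne_zero

/-- Regroups the binomial expansion so that every term is a left multiple of `x²` or `y²`; the
exponent three is the least for which this is possible with independent commuting variables. -/
theorem sub_pow_three {A : Type} [Ring A] {x y : A} (h : y * x - x * y = 0) :
    (x - y) ^ 3 = (x - 3 * y) * x ^ 2 + (3 * x - y) * y ^ 2 := by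
  have e : (x - y) ^ 3 - ((x - 3 * y) * x ^ 2 + (3 * x - y) * y ^ 2) =
      2 * ((y * x - x * y) * x) + x * (y * x - x * y) + y * (y * x - x * y) +
        2 * ((y * x - x * y) * y) := by
    noncomm_ring
  rw [h] at e
  simpa [sub_eq_zero] using e

end Retraction

/-! ### The upper bound `TC(ΛW) ≤ dim W`. -/

section UpperBound

section

variable {ι τ : Type} {deg : ι → ℕ}

theorem list_sum_diffIdeal_mul_top (deg : ι → ℕ) (f : τ → ι) (L : List τ) :
    (L.map (fun t => diffIdeal deg (f t))).sum * ⊤ = (L.map (fun t => diffIdeal deg (f t))).sum := by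
  rw [← List.sum_map_mul_right]
  simp only [diffIdeal_mul_top]

theorem commute_list_sum_diffIdeal {T : Submodule ℚ (FreeCGA (Sum.elim deg deg))} (f : τ → ι)
    (hT : ∀ i, Commute (diffIdeal deg i) T) (L : List τ) :
    Commute (L.map (fun t => diffIdeal deg (f t))).sum T :=
  Commute.list_sum_left _ _ fun a ha => by
    obtain ⟨t, -, rfl⟩ := List.mem_map.1 ha
    exact hT _

end

variable {E F : Type} [Fintype E] [Fintype F] [DecidableEq E] [DecidableEq F]
  {deg : E ⊕ (E ⊕ F) → ℕ} {B : E ⊕ F → E → E → ℚ}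
  {d : Differential deg} (hd : IsPureQuadratic d B)
  (hB : ∀ e i k, B (Sum.inl e) i k = if i = e ∧ k = e then 1 else 0)

/-- The ideal of `ΛW ⊗ ΛW` generated by the `x_i²` and the `u_i`. -/
noncomputable def extIdeal (deg : E ⊕ (E ⊕ F) → ℕ) : Ideal (FreeCGA (Sum.elim deg deg)) :=
  sqIdeal (Sum.elim deg deg) (Sum.map Sum.inl Sum.inl)
    (Sum.map (fun e => Sum.inr (Sum.inl e)) (fun e => Sum.inr (Sum.inl e)))
    (Finset.univ : Finset (E ⊕ E)).toList

include hd in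
-- Pigeonhole on the generators `v - v'` of `ker μ`: a product of more of them than the total of the
-- largest exponents not known to vanish modulo the ideal must lie in it.
theorem kerFil_le_extIdeal :
    kerFil deg (2 * Fintype.card E + Fintype.card F + 1) ≤ (extIdeal deg).restrictScalars ℚ := by
  have hE : ∀ p : E ⊕ E, Even (Sum.elim deg deg (Sum.map Sum.inl Sum.inl p)) := by
    rintro (i | i) <;> exact hd.even i
  have hU : ∀ p : E ⊕ E, Odd (Sum.elim deg deg (Sum.map (fun e => Sum.inr (Sum.inl e))
      (fun e => Sum.inr (Sum.inl e)) p)) := by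
    rintro (i | i) <;> exact hd.odd (Sum.inl i)
  set J := (extIdeal deg).restrictScalars ℚ with hJ
  have hJt : ⊤ * J ≤ J := Submodule.mul_le.2 fun a _ b hb => Ideal.mul_mem_left _ a hb
  have hJt' : J * ⊤ ≤ J := Submodule.mul_le.2 fun a ha b _ => sqIdeal_mul_mem hE hU ha b
  -- Modulo the ideal, `(x - x')³`, `u - u'` and `(y - y')²` vanish, so the exponents `2`, `0`, `1`
  -- are the ones to allow; their total is `2|E| + |F|`.
  let c : E ⊕ (E ⊕ F) → ℕ := Sum.elim (fun _ => 2) (Sum.elim (fun _ => 0) (fun _ => 1))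
  have hx : ∀ p : E ⊕ E, gen (Sum.elim deg deg) (Sum.map Sum.inl Sum.inl p) ^ 2 ∈ J := fun p =>
    sq_mem_sqIdeal (Finset.mem_toList.2 (Finset.mem_univ p))
  have hu : ∀ p : E ⊕ E, gen (Sum.elim deg deg) (Sum.map (fun e => Sum.inr (Sum.inl e))
      (fun e => Sum.inr (Sum.inl e)) p) ∈ J := fun p =>
    gen_mem_sqIdeal (Finset.mem_toList.2 (Finset.mem_univ p))
  have hD : ∀ i, diffIdeal deg i ^ (c i + 1) ≤ J := by
    intro i
    refine diffIdeal_pow_le deg i hJt ?_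
    rcases i with i | i | f
    · change genDiff deg (Sum.inl i) ^ 3 ∈ J
      rw [genDiff, sub_pow_three]
      · exact Submodule.add_mem _ (Ideal.mul_mem_left _ _ (hx (Sum.inl i)))
          (Ideal.mul_mem_left _ _ (hx (Sum.inr i)))
      · rw [(isScalar_gen (deg := Sum.elim deg deg) (i := Sum.inl (Sum.inl i)) (hd.even i)).comm,
          sub_self]
    · change genDiff deg (Sum.inr (Sum.inl i)) ^ 1 ∈ J
      rw [pow_one, genDiff]
      exact Submodule.sub_mem _ (hu (Sum.inl i)) (hu (Sum.inr i))
    · change genDiff deg (Sum.inr (Sum.inr f)) ^ 2 ∈ J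
      rw [pow_two, mul_self_of_odd (hd.odd (Sum.inr f)) (genDiff_mem_homog deg _)]
      exact Submodule.zero_mem _
  have hcard : ((Finset.univ : Finset (E ⊕ (E ⊕ F))).toList.map c).sum =
      2 * Fintype.card E + Fintype.card F := by
    rw [Finset.sum_map_toList]
    simp [c, mul_comm]
  have hsum := add_list_sum_pow_le (P := 0) (J := J) (D := diffIdeal deg) (c := c)
    (fun i => Commute.zero_left _) (commute_diffIdeal deg) (by simp)
    (fun i => (diffIdeal_mul_top deg i).le) hJt hJt' hD 0
    (Finset.univ : Finset (E ⊕ (E ⊕ F))).toList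
  rw [zero_add, zero_add, zero_add, zero_pow one_ne_zero, zero_add, hcard] at hsum
  refine le_trans ?_ hsum
  rw [kerFil_succ']
  refine pow_le_pow_left' ?_ _
  have h1 := list_sum_diffIdeal_mul_top deg id (Finset.univ : Finset (E ⊕ (E ⊕ F))).toList
  have h2 := commute_list_sum_diffIdeal id (commute_diffIdeal_top deg)
    (Finset.univ : Finset (E ⊕ (E ⊕ F))).toList
  exact kerMul_le (h2.eq ▸ h1).le h1.le fun i =>
    le_list_sum (Finset.mem_toList.2 (Finset.mem_univ i)) (genDiff_mem_diffIdeal deg i)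

include hd hB in
/-- The projection `ρ_k` for `k = dim W` admits a homotopy retraction. -/
theorem hasHomotopyRetraction_rho :
    HasHomotopyRetraction (rho d (2 * Fintype.card E + Fintype.card F)) := by
  have hE : ∀ p : E ⊕ E, Even (Sum.elim deg deg (Sum.map Sum.inl Sum.inl p)) := by
    rintro (i | i) <;> exact hd.even i
  have hU : ∀ p : E ⊕ E, Odd (Sum.elim deg deg (Sum.map (fun e => Sum.inr (Sum.inl e))
      (fun e => Sum.inr (Sum.inl e)) p)) := by
    rintro (i | i) <;> exact hd.odd (Sum.inl i)
  have hdx : ∀ p : E ⊕ E, (tensorSq d).toLin (gen (Sum.elim deg deg)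
      (Sum.map Sum.inl Sum.inl p)) = 0 := by
    rintro (i | i)
    · exact tensorSq_x₁ hd i
    · exact tensorSq_x₂ hd i
  have hsq : ∀ (A : Type) [Ring A] [Algebra ℚ A] (x : E → A) (e : E),
      ∑ i, ∑ k, B (Sum.inl e) i k • (x i * x k) = x e ^ 2 := by
    intro A _ _ x e
    rw [Finset.sum_eq_single e, Finset.sum_eq_single e]
    · simp [hB, pow_two]
    · intro k _ hk; simp [hB, hk]
    · simp
    · intro i _ hi; simp [hB, hi]
    · simp
  have hdu : ∀ p : E ⊕ E, (tensorSq d).toLin (gen (Sum.elim deg deg)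
      (Sum.map (fun e => Sum.inr (Sum.inl e)) (fun e => Sum.inr (Sum.inl e)) p)) =
      gen (Sum.elim deg deg) (Sum.map Sum.inl Sum.inl p) ^ 2 := by
    rintro (i | i)
    · exact (tensorSq_y₁ hd (Sum.inl i)).trans (hsq _ (dx₁ deg) i)
    · exact (tensorSq_y₂ hd (Sum.inl i)).trans (hsq _ (dx₂ deg) i)
  have heven : ∀ i, (tensorSq d).toLin (gen (Sum.elim deg deg) i) ∈
      evenPart (Sum.elim deg deg) := by
    rintro ((i | o) | (i | o))
    · rw [tensorSq_x₁ hd i]; exact zero_mem _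
    · rw [tensorSq_y₁ hd o]; exact sum_quadratic_mem_evenPart hd o
    · rw [tensorSq_x₂ hd i]; exact zero_mem _
    · rw [tensorSq_y₂ hd o]; exact sum_quadratic_mem_evenPart' hd o
  let J : Ideal (free (tensorSq d)).carrier := extIdeal deg
  have : J.IsTwoSided := sqIdeal_isTwoSided hE hU _
  have hxi : Function.Injective (Sum.map Sum.inl Sum.inl :
      E ⊕ E → (E ⊕ (E ⊕ F)) ⊕ (E ⊕ (E ⊕ F))) :=
    Sum.map_injective.2 ⟨Sum.inl_injective, Sum.inl_injective⟩
  have hui : Function.Injective (Sum.map (fun e => Sum.inr (Sum.inl e))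
      (fun e => Sum.inr (Sum.inl e)) : E ⊕ E → (E ⊕ (E ⊕ F)) ⊕ (E ⊕ (E ⊕ F))) :=
    Sum.map_injective.2 ⟨Sum.inr_injective.comp Sum.inl_injective,
      Sum.inr_injective.comp Sum.inl_injective⟩
  refine hasHomotopyRetraction_quotHom (tensorSq d) ?_ (kerPow d _) J
    (kerPow_isDGIdeal d _) (sqIdeal_isDGIdeal hdx hdu _) ?_ (one_not_mem_sqIdeal _ _ _) ?_
  · rintro (i | i) <;> exact hd.pos i
  · intro a ha
    exact kerFil_le_extIdeal hd (mem_kerFil_of_mem_kerPow d ha)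
  · intro a ha hda
    exact sqIdeal_acyclic hE hU hdx hdu heven hxi hui (Finset.nodup_toList _) ha hda

end UpperBound

end RatTC

namespace RatTC

open FreeCGA

/-! ### Adjoining odd generators to an acyclic ideal. -/

section OddExtension

variable {ι σ τ : Type} {deg : ι → ℕ} {degS : σ → ℕ}

/-- The subspace `⨁ u_p … u_q K` over the subsets of `S`. -/
noncomputable def oddExt (deg : ι → ℕ) (u : τ → ι) (K : Submodule ℚ (FreeCGA deg)) :
    List τ → Submodule ℚ (FreeCGA deg)
  | [] => K
  | q :: S => oddExt deg u K S ⊔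
      (oddExt deg u K S).map (LinearMap.mulLeft ℚ (gen deg (u q)))

theorem mem_oddExt_cons {u : τ → ι} {K : Submodule ℚ (FreeCGA deg)} {q : τ} {S : List τ}
    {x : FreeCGA deg} : x ∈ oddExt deg u K (q :: S) ↔
      ∃ a ∈ oddExt deg u K S, ∃ b ∈ oddExt deg u K S, x = a + gen deg (u q) * b := by
  rw [oddExt, Submodule.mem_sup]
  constructor
  · rintro ⟨a, ha, _, ⟨b, hb, rfl⟩, rfl⟩
    exact ⟨a, ha, b, hb, rfl⟩
  · rintro ⟨a, ha, b, hb, rfl⟩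
    exact ⟨a, ha, _, ⟨b, hb, rfl⟩, rfl⟩

theorem le_oddExt (u : τ → ι) (K : Submodule ℚ (FreeCGA deg)) (S : List τ) :
    K ≤ oddExt deg u K S := by
  induction S with
  | nil => exact le_rfl
  | cons q S ih => exact ih.trans le_sup_left

theorem gen_mul_mem_oddExt {u : τ → ι} {K : Submodule ℚ (FreeCGA deg)} {i : ι}
    (hi : ∀ k ∈ K, gen deg i * k ∈ K) (S : List τ) :
    ∀ k ∈ oddExt deg u K S, gen deg i * k ∈ oddExt deg u K S := by
  induction S with
  | nil => exact hi
  | cons q S ih =>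
    intro x hx
    obtain ⟨a, ha, b, hb, rfl⟩ := mem_oddExt_cons.1 hx
    refine mem_oddExt_cons.2 ⟨_, ih a ha,
      ((-1 : ℚ) ^ (deg i * deg (u q))) • (gen deg i * b), Submodule.smul_mem _ _ (ih b hb), ?_⟩
    rw [mul_add, ← mul_assoc, gen_comm deg i, smul_mul_assoc, mul_smul_comm, mul_assoc]

/-- For the adjoined generator itself, `u² = 0` gives `u (a + u b) = u a`. Together with
`gen_mul_mem_oddExt` this makes `oddExt` a left ideal once all generators are covered. -/
theorem odd_gen_mul_mem_oddExt {u : τ → ι} (hu : ∀ p, Odd (deg (u p)))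
    {K : Submodule ℚ (FreeCGA deg)} {S : List τ} {p : τ} (hp : p ∈ S) :
    ∀ k ∈ oddExt deg u K S, gen deg (u p) * k ∈ oddExt deg u K S := by
  induction S with
  | nil => simp at hp
  | cons q S ih =>
    intro x hx
    obtain ⟨a, ha, b, hb, rfl⟩ := mem_oddExt_cons.1 hx
    rcases List.mem_cons.1 hp with rfl | hp
    · refine mem_oddExt_cons.2 ⟨0, Submodule.zero_mem _, a, ha, ?_⟩
      rw [mul_add, ← mul_assoc, mul_self_of_odd (hu p) (gen_mem deg _)]
      simp
    · refine mem_oddExt_cons.2 ⟨_, ih hp a ha,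
        ((-1 : ℚ) ^ (deg (u p) * deg (u q))) • (gen deg (u p) * b),
        Submodule.smul_mem _ _ (ih hp b hb), ?_⟩
      rw [mul_add, ← mul_assoc, gen_comm deg (u p), smul_mul_assoc, mul_smul_comm, mul_assoc]

variable {e : σ → ι} {he : ∀ i, deg (e i) = degS i} {K : Submodule ℚ (FreeCGA deg)}

theorem mul_mem_of_gen_mul_mem {K : Submodule ℚ (FreeCGA deg)}
    (hK : ∀ i, ∀ k ∈ K, gen deg i * k ∈ K) (w : FreeCGA deg) {k : FreeCGA deg} (hk : k ∈ K) :
    w * k ∈ K := by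
  induction w using word_induction with
  | h0 => rw [zero_mul]; exact Submodule.zero_mem _
  | hadd a b ha hb => rw [add_mul]; exact Submodule.add_mem _ ha hb
  | hsmul c a ha => rw [smul_mul_assoc]; exact Submodule.smul_mem _ _ ha
  | hw l =>
    induction l with
    | nil => rwa [word_nil, one_mul]
    | cons i l ih => rw [word_cons, mul_assoc]; exact hK i _ ih

theorem rename_mul_mem {K : Submodule ℚ (FreeCGA deg)}
    (hK : ∀ i, ∀ k ∈ K, gen deg (e i) * k ∈ K) (w : FreeCGA degS) {k : FreeCGA deg} (hk : k ∈ K) :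
    rename e he w * k ∈ K := by
  induction w using word_induction with
  | h0 => rw [map_zero, zero_mul]; exact Submodule.zero_mem _
  | hadd a b ha hb => rw [map_add, add_mul]; exact Submodule.add_mem _ ha hb
  | hsmul c a ha => rw [map_smul, smul_mul_assoc]; exact Submodule.smul_mem _ _ ha
  | hw l =>
    induction l with
    | nil => rwa [word_nil, map_one, one_mul]
    | cons i l ih =>
      rw [word_cons, map_mul, rename_gen, mul_assoc]; exact hK i _ ih

variable [DecidableEq ι] {u : τ → ι} (hu : ∀ p, Odd (deg (u p))) (hui : Function.Injective u)

include hui in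
theorem partialD_oddExt (hK : ∀ p, ∀ k ∈ K, partialD deg (u p) (hu p) k = 0) {S : List τ} {p : τ}
    (hp : p ∉ S) : ∀ k ∈ oddExt deg u K S, partialD deg (u p) (hu p) k = 0 := by
  induction S with
  | nil => exact hK p
  | cons q S ih =>
    intro x hx
    obtain ⟨a, ha, b, hb, rfl⟩ := mem_oddExt_cons.1 hx
    have hp' := List.not_mem_of_not_mem_cons hp
    rw [map_add, ih hp' a ha, zero_add]
    refine (isOddDer_partialD deg (u p) (hu p)).mul_eq_zero ?_ (ih hp' b hb)
    rw [partialD_gen, if_neg]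
    exact fun h => hp (hui h ▸ List.mem_cons_self)

include hui in
/-- Acyclicity of an ideal is preserved by the adjunction of odd generators. -/
theorem oddExt_acyclic {D : Differential deg}
    (hK : ∀ p, ∀ k ∈ K, partialD deg (u p) (hu p) k = 0)
    (hD : ∀ p i, partialD deg (u p) (hu p) (D.toLin (gen deg i)) = 0)
    (hKe : ∀ i, ∀ k ∈ K, gen deg (e i) * k ∈ K)
    (hDu : ∀ p, ∃ w, D.toLin (gen deg (u p)) = rename e he w)
    (hac : ∀ a ∈ K, D.toLin a = 0 → ∃ b ∈ K, D.toLin b = a) {S : List τ} (hS : S.Nodup)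
    {a : FreeCGA deg} (h : a ∈ oddExt deg u K S) (hda : D.toLin a = 0) :
    ∃ b ∈ oddExt deg u K S, D.toLin b = a := by
  induction S generalizing a with
  | nil => exact hac a h hda
  | cons q S ih =>
    obtain ⟨hq, hS'⟩ := List.nodup_cons.1 hS
    obtain ⟨a, ha, b, hb, rfl⟩ := mem_oddExt_cons.1 h
    have hpar := isOddDer_partialD deg (u q) (hu q)
    have h0 := partialD_oddExt hu hui hK hq
    -- The coefficient of `u_q` is recovered by differentiation, which anticommutes with `D`; hence
    -- `b` is a cocycle, and a primitive `l` exists by induction.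
    have e1 : partialD deg (u q) (hu q) (a + gen deg (u q) * b) = b := by
      rw [map_add, h0 a ha, hpar.mul, partialD_gen, if_pos rfl, h0 b hb]
      simp
    have hdb : D.toLin b = 0 := by
      have h := hpar.anticomm D.isOddDer (fun i => by
        rw [hD, partialD_gen]
        split_ifs <;> simp [D.isOddDer.one]) (a + gen deg (u q) * b)
      rw [e1, hda, map_zero] at h
      exact neg_eq_zero.1 h.symm
    obtain ⟨l, hl, rfl⟩ := ih hS' hb hdb
    have e2 : D.toLin (gen deg (u q) * l) =
        D.toLin (gen deg (u q)) * l - gen deg (u q) * D.toLin l := by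
      rw [D.isOddDer.mul, parity_gen, (hu q).neg_one_pow]
      simp [sub_eq_add_neg]
    have hml : D.toLin (gen deg (u q)) * l ∈ oddExt deg u K S := by
      obtain ⟨w, hw⟩ := hDu q
      rw [hw]
      exact rename_mul_mem (fun i => gen_mul_mem_oddExt (hKe i) S) w hl
    -- Adding `D(u_q l)` trades `u_q b` for `(D u_q) l`, leaving a cocycle without `u_q`, to which
    -- induction applies again.
    have hda' : D.toLin (a + D.toLin (gen deg (u q)) * l) = 0 := by
      have h : a + D.toLin (gen deg (u q)) * l =
          (a + gen deg (u q) * D.toLin l) + D.toLin (gen deg (u q) * l) := by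
        rw [e2]; abel
      rw [h, map_add, hda, D.sq, add_zero]
    obtain ⟨l', hl', hdl'⟩ := ih hS' (Submodule.add_mem _ ha hml) hda'
    refine ⟨l' - gen deg (u q) * l, ?_, ?_⟩
    · exact mem_oddExt_cons.2 ⟨l', hl', -l, Submodule.neg_mem _ hl, by
        rw [mul_neg, sub_eq_add_neg]⟩
    · rw [map_sub, hdl', e2]; abel

end OddExtension

/-! ### Base change of relative models and retractions along `ΛV → ΛW`. -/

section Transport

/-- A primitive `c` of `a` maps to a cocycle, which is the image of a cocycle `a'` up to a boundary.
Surjectivity lifts that boundary, and subtracting both from `c` moves the primitive into the kernel.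
-/
theorem exists_of_quasiIso {A B : CDGA} {ξ : A.Hom B} (hξ : ξ.QuasiIso)
    (hs : Function.Surjective ξ.toAlgHom) {a : A.carrier} (ha : ξ.toAlgHom a = 0)
    (hda : A.d a = 0) : ∃ b, ξ.toAlgHom b = 0 ∧ A.d b = a := by
  obtain ⟨h1, h2⟩ := ξ.quasiIso_iff.1 hξ
  obtain ⟨c, rfl⟩ := h1 a hda 0 (by rw [map_zero, ha])
  obtain ⟨a', ha', c', hc'⟩ := h2 (ξ.toAlgHom c) (by rw [← ξ.map_d, ha])
  obtain ⟨f, rfl⟩ := hs c'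
  refine ⟨c - a' - A.d f, ?_, ?_⟩
  · rw [map_sub, map_sub, ξ.map_d, hc', sub_self]
  · rw [map_sub, map_sub, ha', A.d_d, sub_zero, sub_zero]

variable {ι ι' τ κ : Type} {deg : ι → ℕ} {deg' : ι' → ℕ} {j : ι → ι'}
  (hj : ∀ i, deg' (j i) = deg i) {d : Differential deg} {d' : Differential deg'}
  (hd : ∀ a, d'.toLin (rename j hj a) = rename j hj (d.toLin a))

theorem tensorSq_gen_inl {ι : Type} {deg : ι → ℕ} (d : Differential deg) (i : ι) :
    (tensorSq d).toLin (gen (Sum.elim deg deg) (Sum.inl i)) = inLeft deg (d.toLin (gen deg i)) :=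
  derivation_gen _ (sqGen d) (sqGen_mem d) (Sum.inl i)

theorem tensorSq_gen_inr {ι : Type} {deg : ι → ℕ} (d : Differential deg) (i : ι) :
    (tensorSq d).toLin (gen (Sum.elim deg deg) (Sum.inr i)) = inRight deg (d.toLin (gen deg i)) :=
  derivation_gen _ (sqGen d) (sqGen_mem d) (Sum.inr i)

include hj in
theorem sqMap_deg (i : ι ⊕ ι) : Sum.elim deg' deg' (Sum.map j j i) = Sum.elim deg deg i := by
  rcases i with i | i <;> exact hj i

/-- The map of tensor squares induced by a map of bases. -/
noncomputable def sqMap : FreeCGA (Sum.elim deg deg) →ₐ[ℚ] FreeCGA (Sum.elim deg' deg') :=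
  rename (Sum.map j j) (sqMap_deg hj)

theorem sqMap_gen (i : ι ⊕ ι) :
    sqMap hj (gen (Sum.elim deg deg) i) = gen (Sum.elim deg' deg') (Sum.map j j i) :=
  rename_gen _ _ _

theorem sqMap_inLeft (a : FreeCGA deg) : sqMap hj (inLeft deg a) = inLeft deg' (rename j hj a) :=
  algHom_ext (f := (sqMap hj).comp (inLeft deg)) (g := (inLeft deg').comp (rename j hj))
    (fun i => by
      rw [AlgHom.comp_apply, AlgHom.comp_apply, inLeft_gen, sqMap_gen, rename_gen, inLeft_gen]
      rfl) a

theorem sqMap_inRight (a : FreeCGA deg) :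
    sqMap hj (inRight deg a) = inRight deg' (rename j hj a) :=
  algHom_ext (f := (sqMap hj).comp (inRight deg)) (g := (inRight deg').comp (rename j hj))
    (fun i => by
      rw [AlgHom.comp_apply, AlgHom.comp_apply, inRight_gen, sqMap_gen, rename_gen, inRight_gen]
      rfl) a

include hd in
theorem tensorSq_sqMap (a : FreeCGA (Sum.elim deg deg)) :
    (tensorSq d').toLin (sqMap hj a) = sqMap hj ((tensorSq d).toLin a) := by
  refine Differential.rename_comm (Sum.map j j) (sqMap_deg hj) (tensorSq d) (tensorSq d').toLin
    (tensorSq d').isOddDer.one (tensorSq d').leibniz ?_ a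
  rintro (i | i)
  · rw [tensorSq_gen_inl]
    refine (tensorSq_gen_inl d' (j i)).trans ?_
    rw [← rename_gen j hj i, hd]
    exact (sqMap_inLeft hj _).symm
  · rw [tensorSq_gen_inr]
    refine (tensorSq_gen_inr d' (j i)).trans ?_
    rw [← rename_gen j hj i, hd]
    exact (sqMap_inRight hj _).symm

variable {degZ : κ → ℕ}

include hj in
theorem extMap_deg (i : (ι ⊕ ι) ⊕ κ) :
    Sum.elim (Sum.elim deg' deg') degZ (Sum.map (Sum.map j j) id i) =
      Sum.elim (Sum.elim deg deg) degZ i := by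
  rcases i with i | i
  · exact sqMap_deg hj i
  · rfl

/-- The map of relative models induced by a map of bases. -/
noncomputable def extMap (degZ : κ → ℕ) : FreeCGA (Sum.elim (Sum.elim deg deg) degZ) →ₐ[ℚ]
    FreeCGA (Sum.elim (Sum.elim deg' deg') degZ) :=
  rename (Sum.map (Sum.map j j) id) (extMap_deg hj)

theorem extMap_gen (i : (ι ⊕ ι) ⊕ κ) : extMap hj degZ (gen _ i) =
    gen (Sum.elim (Sum.elim deg' deg') degZ) (Sum.map (Sum.map j j) id i) :=
  rename_gen _ _ _

theorem baseIncl_gen {ι κ : Type} (deg : ι → ℕ) (degZ : κ → ℕ) (i : ι) :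
    baseIncl deg degZ (gen deg i) = gen (Sum.elim deg degZ) (Sum.inl i) :=
  rename_gen Sum.inl (fun _ => rfl) i

theorem extMap_baseIncl (a : FreeCGA (Sum.elim deg deg)) :
    extMap hj degZ (baseIncl _ degZ a) = baseIncl _ degZ (sqMap hj a) :=
  algHom_ext (f := (extMap hj degZ).comp (baseIncl _ degZ))
    (g := (baseIncl _ degZ).comp (sqMap hj)) (fun i => by
      rw [AlgHom.comp_apply, AlgHom.comp_apply, baseIncl_gen, extMap_gen, sqMap_gen, baseIncl_gen]
      rfl) a

section Extension

variable (D : Differential (Sum.elim (Sum.elim deg deg) degZ)) (d')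

/-- The values on generators of the differential extended to more generators. -/
noncomputable def extGen : (ι' ⊕ ι') ⊕ κ → FreeCGA (Sum.elim (Sum.elim deg' deg') degZ) :=
  Sum.elim (fun i => baseIncl _ degZ ((tensorSq d').toLin (gen _ i)))
    (fun z => extMap hj degZ (D.toLin (gen _ (Sum.inr z))))

theorem extGen_mem (i : (ι' ⊕ ι') ⊕ κ) : extGen hj d' D i ∈
    homog (Sum.elim (Sum.elim deg' deg') degZ) (Sum.elim (Sum.elim deg' deg') degZ i + 1) := by
  rcases i with i | z
  · exact rename_mem Sum.inl (fun _ => rfl) ((tensorSq d').mem (gen_mem _ i))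
  · exact rename_mem _ (extMap_deg hj) (D.mem (gen_mem _ (Sum.inr z)))

theorem derivation_baseIncl (a : FreeCGA (Sum.elim deg' deg')) :
    derivation _ (extGen hj d' D) (extGen_mem hj d' D) (baseIncl _ degZ a) =
      baseIncl _ degZ ((tensorSq d').toLin a) :=
  Differential.rename_comm (deg := Sum.elim deg' deg') Sum.inl (fun _ => rfl) (tensorSq d')
    (derivation _ (extGen hj d' D) (extGen_mem hj d' D)) (derivation_one _ _ _)
    (derivation_leibniz _ _ _)
    (fun i => derivation_gen _ (extGen hj d' D) (extGen_mem hj d' D) (Sum.inl i)) a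

variable {d'} (hD : ∀ a, D.toLin (baseIncl _ degZ a) = baseIncl _ degZ ((tensorSq d).toLin a))

include hd hD in
theorem derivation_extMap (a : FreeCGA (Sum.elim (Sum.elim deg deg) degZ)) :
    derivation _ (extGen hj d' D) (extGen_mem hj d' D) (extMap hj degZ a) =
      extMap hj degZ (D.toLin a) := by
  refine Differential.rename_comm _ (extMap_deg hj) D
    (derivation _ (extGen hj d' D) (extGen_mem hj d' D)) (derivation_one _ _ _)
    (derivation_leibniz _ _ _) ?_ a
  rintro (i | z)
  · rw [← baseIncl_gen, hD]
    refine (derivation_gen _ (extGen hj d' D) (extGen_mem hj d' D)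
      (Sum.inl (Sum.map j j i))).trans ?_
    refine Eq.trans ?_ (extMap_baseIncl hj _).symm
    rw [← tensorSq_sqMap hj hd, sqMap_gen]
    rfl
  · exact derivation_gen _ (extGen hj d' D) (extGen_mem hj d' D) (Sum.inr z)

/-- The differential extended to more generators. -/
noncomputable def extD : Differential (Sum.elim (Sum.elim deg' deg') degZ) :=
  Differential.ofGen _ (extGen hj d' D) (extGen_mem hj d' D) (by
    rintro (i | z)
    · exact (derivation_baseIncl hj d' D _).trans
        ((congrArg _ ((tensorSq d').sq _)).trans (map_zero _))
    · exact (derivation_extMap hj hd D hD _).trans ((congrArg _ (D.sq _)).trans (map_zero _)))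

theorem extD_baseIncl (a : FreeCGA (Sum.elim deg' deg')) :
    (extD hj hd D hD).toLin (baseIncl _ degZ a) = baseIncl _ degZ ((tensorSq d').toLin a) :=
  derivation_baseIncl hj d' D a

theorem extD_extMap (a : FreeCGA (Sum.elim (Sum.elim deg deg) degZ)) :
    (extD hj hd D hD).toLin (extMap hj degZ a) = extMap hj degZ (D.toLin a) :=
  derivation_extMap hj hd D hD a

variable (r : FreeCGA (Sum.elim (Sum.elim deg deg) degZ) →ₐ[ℚ] FreeCGA (Sum.elim deg deg))
  (hrg : ∀ z, r (gen _ (Sum.inr z)) ∈ homog (Sum.elim deg deg) (degZ z))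

include hrg in
theorem extRetraction_mem (i : (ι' ⊕ ι') ⊕ κ) :
    (Sum.elim (gen (Sum.elim deg' deg')) (fun z => sqMap hj (r (gen _ (Sum.inr z)))) i :
      FreeCGA (Sum.elim deg' deg')) ∈
      homog (Sum.elim deg' deg') (Sum.elim (Sum.elim deg' deg') degZ i) := by
  rcases i with i | z
  · exact gen_mem _ i
  · exact rename_mem _ (sqMap_deg hj) (hrg z)

/-- The retraction extended to more generators. -/
noncomputable def extRetraction :
    FreeCGA (Sum.elim (Sum.elim deg' deg') degZ) →ₐ[ℚ] FreeCGA (Sum.elim deg' deg') :=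
  lift _ (Sum.elim (gen (Sum.elim deg' deg'))
      (fun z => sqMap hj (r (gen _ (Sum.inr z)))))
    (fun i i' => FreeCGA.comm _ (extRetraction_mem hj r hrg i) (extRetraction_mem hj r hrg i'))

theorem extRetraction_baseIncl (a : FreeCGA (Sum.elim deg' deg')) :
    extRetraction hj r hrg (baseIncl _ degZ a) = a :=
  algHom_ext (f := (extRetraction hj r hrg).comp (baseIncl _ degZ)) (g := AlgHom.id ℚ _)
    (fun i => by
      rw [AlgHom.comp_apply, baseIncl_gen]
      exact lift_gen _ _ _ (Sum.inl i)) a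

variable (hr : ∀ a, r (baseIncl _ degZ a) = a)
  (hrd : ∀ a, r (D.toLin a) = (tensorSq d).toLin (r a))

include hr in
theorem extRetraction_extMap (a : FreeCGA (Sum.elim (Sum.elim deg deg) degZ)) :
    extRetraction hj r hrg (extMap hj degZ a) = sqMap hj (r a) := by
  refine algHom_ext (f := (extRetraction hj r hrg).comp (extMap hj degZ))
    (g := (sqMap hj).comp r) ?_ a
  rintro (i | z)
  · rw [AlgHom.comp_apply, AlgHom.comp_apply, extMap_gen, ← baseIncl_gen]
    refine (lift_gen _ _ _ (Sum.inl (Sum.map j j i))).trans ?_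
    rw [hr, sqMap_gen]
    rfl
  · rw [AlgHom.comp_apply, AlgHom.comp_apply, extMap_gen]
    exact lift_gen _ _ _ (Sum.inr z)

theorem extRetraction_gen_mem (i : (ι' ⊕ ι') ⊕ κ) : extRetraction hj r hrg (gen _ i) ∈
    homog (Sum.elim deg' deg') (Sum.elim (Sum.elim deg' deg') degZ i) := by
  have h : extRetraction hj r hrg (gen _ i) = _ := lift_gen _ _ _ i
  rw [h]
  exact extRetraction_mem hj r hrg i

include hr hrd in
-- Compatibility is checked on generators: on those of `ΛW ⊗ ΛW` the map is the identity, and on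
-- those of `Z` it is inherited from `r`.
theorem extRetraction_extD (a : FreeCGA (Sum.elim (Sum.elim deg' deg') degZ)) :
    extRetraction hj r hrg ((extD hj hd D hD).toLin a) =
      (tensorSq d').toLin (extRetraction hj r hrg a) := by
  have key : ∀ i, extRetraction hj r hrg ((extD hj hd D hD).toLin (gen _ i)) =
      (tensorSq d').toLin (extRetraction hj r hrg (gen _ i)) := by
    rintro (i | z)
    · rw [← baseIncl_gen, extD_baseIncl, extRetraction_baseIncl, extRetraction_baseIncl]
    · have h := extD_extMap hj hd D hD (gen _ (Sum.inr z))
      have h' := extRetraction_extMap hj r hrg hr (gen _ (Sum.inr z))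
      rw [extMap_gen] at h h'
      refine (congrArg (extRetraction hj r hrg) h).trans ?_
      refine Eq.trans ?_ (congrArg (tensorSq d').toLin h').symm
      rw [tensorSq_sqMap hj hd, extRetraction_extMap hj r hrg hr, hrd]
  exact algHom_map_d (extD hj hd D hD) (free (tensorSq d')) (extRetraction hj r hrg)
    (extRetraction_gen_mem hj r hrg) key a

end Extension

end Transport

end RatTC

namespace RatTC

open FreeCGA

/-! ### Powers of `ker μ` after adjoining odd generators. -/

section PowersOfKernel

variable {ι ι' τ : Type} {deg : ι → ℕ} {deg' : ι' → ℕ}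

theorem FreeCGA.commute_span_range_top {f : τ → FreeCGA deg} {p : τ → ℕ}
    (hf : ∀ t, f t ∈ homog deg (p t)) :
    Commute (Submodule.span ℚ (Set.range f)) ⊤ := by
  rw [Submodule.span_range_eq_iSup]
  rw [Commute, SemiconjBy, Submodule.iSup_mul, Submodule.mul_iSup]
  exact iSup_congr fun t => (commute_span_top (hf t)).eq

/-- The powers of the kernel of the multiplication, after adjoining odd generators `u_p`. -/
theorem kerFil_le_top_mul_map [Fintype ι] [Fintype τ] {j : ι → ι'} (hj : ∀ i, deg' (j i) = deg i)
    {u : τ → ι'} (hu : ∀ p, Odd (deg' (u p))) (hcov : ∀ i', (∃ i, j i = i') ∨ ∃ p, u p = i')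
    (k : ℕ) : kerFil deg' (k + Fintype.card τ + 1) ≤
      ⊤ * (kerFil deg (k + 1)).map (sqMap hj).toLinearMap := by
  set X := Submodule.span ℚ (Set.range fun i => genDiff deg' (j i)) with hX
  have hXt : Commute ⊤ X :=
    (commute_span_range_top (fun i => genDiff_mem_homog deg' (j i))).symm
  set P := ((Finset.univ : Finset ι).toList.map (fun i => diffIdeal deg' (j i))).sum with hP
  set Q := ((Finset.univ : Finset τ).toList.map (fun p => diffIdeal deg' (u p))).sum with hQ
  have hPX : P ≤ ⊤ * X := by
    rw [hP]
    generalize (Finset.univ : Finset ι).toList = L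
    induction L with
    | nil => simp
    | cons i L ih =>
      rw [List.map_cons, List.sum_cons]
      refine sup_le (mul_le_mul' le_rfl (Submodule.span_mono ?_)) ih
      rintro _ rfl
      exact ⟨i, rfl⟩
  have hXk : X ≤ (kerMul deg).map (sqMap hj).toLinearMap := by
    refine Submodule.span_le.2 ?_
    rintro _ ⟨i, rfl⟩
    refine ⟨genDiff deg i, diff_mem_kerMul deg i, ?_⟩
    rw [AlgHom.toLinearMap_apply, genDiff, map_sub, sqMap_gen, sqMap_gen]
    rfl
  have hPQ : kerMul deg' ≤ P + Q := by
    have h1 : (P + Q) * ⊤ = P + Q := by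
      rw [add_mul, list_sum_diffIdeal_mul_top, list_sum_diffIdeal_mul_top]
    have h2 : Commute (P + Q) ⊤ :=
      (commute_list_sum_diffIdeal _ (commute_diffIdeal_top deg') _).add_left
        (commute_list_sum_diffIdeal _ (commute_diffIdeal_top deg') _)
    refine kerMul_le (h2.eq ▸ h1).le h1.le fun i' => ?_
    rcases hcov i' with ⟨i, rfl⟩ | ⟨p, rfl⟩
    · exact Submodule.mem_sup_left (le_list_sum (D := fun i => diffIdeal deg' (j i))
        (Finset.mem_toList.2 (Finset.mem_univ i)) (genDiff_mem_diffIdeal deg' _))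
    · exact Submodule.mem_sup_right (le_list_sum (D := fun p => diffIdeal deg' (u p))
        (Finset.mem_toList.2 (Finset.mem_univ p)) (genDiff_mem_diffIdeal deg' _))
  -- Here the error ideal is zero: `(u - u')² = 0`, so each adjoined generator can account for at
  -- most one factor, and at least `k + 1` factors come from `ΛV`.
  have hsum := add_list_sum_pow_le (P := P) (J := 0) (D := fun p => diffIdeal deg' (u p))
    (c := fun _ => 1)
    (fun p => commute_list_sum_diffIdeal _ (fun i => commute_diffIdeal deg' i _) _)
    (fun p q => commute_diffIdeal deg' _ _) (list_sum_diffIdeal_mul_top _ _ _).le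
    (fun p => (diffIdeal_mul_top deg' _).le) (by simp) (by simp)
    (fun p => diffIdeal_pow_le deg' _ (by simp) (by
      rw [pow_two, mul_self_of_odd (hu p) (genDiff_mem_homog deg' _)]
      exact Submodule.zero_mem _)) k (Finset.univ : Finset τ).toList
  have hcard : ((Finset.univ : Finset τ).toList.map (fun _ => 1)).sum = Fintype.card τ := by
    rw [Finset.sum_map_toList]
    simp
  rw [hcard, add_zero] at hsum
  rw [kerFil_succ', kerFil_succ']
  calc kerMul deg' ^ (k + Fintype.card τ + 1) ≤ (P + Q) ^ (k + Fintype.card τ + 1) :=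
        pow_le_pow_left' hPQ _
    _ ≤ P ^ (k + 1) := hsum
    _ ≤ (⊤ * X) ^ (k + 1) := pow_le_pow_left' hPX _
    _ = ⊤ ^ (k + 1) * X ^ (k + 1) := hXt.mul_pow _
    _ ≤ ⊤ * ((kerMul deg).map (sqMap hj).toLinearMap) ^ (k + 1) :=
        mul_le_mul' le_top (pow_le_pow_left' hXk _)
    _ = ⊤ * (kerMul deg ^ (k + 1)).map (sqMap hj).toLinearMap := by rw [Submodule.map_pow]

end PowersOfKernel

/-! ### Exactness of cocycles forced by a homotopy retraction. -/

section Exactness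

/-- If `ρ_k` has a homotopy retraction, the cocycles of `(ker μ)^(k+1)` are exact. -/
theorem exact_of_hasHomotopyRetraction {ι : Type} {deg : ι → ℕ} {d : Differential deg} {k : ℕ}
    (h : HasHomotopyRetraction (rho d k)) {ω : FreeCGA (Sum.elim deg deg)}
    (hω : ω ∈ kerFil deg (k + 1)) (hdω : (tensorSq d).toLin ω = 0) :
    ∃ c, (tensorSq d).toLin c = ω := by
  obtain ⟨κ, degZ, D, ⟨hD, -⟩, ⟨ξ, hξ, hξi⟩, r, hr⟩ := h
  have h0 : (rho d k).toAlgHom ω = 0 :=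
    Ideal.Quotient.eq_zero_iff_mem.2 (mem_kerPow_of_mem_kerFil d hω)
  -- The cocycle is zero in the quotient, so it bounds in the relative model; applying the
  -- retraction to a primitive gives one in `ΛV ⊗ ΛV`.
  obtain ⟨c, hc⟩ := (ξ.quasiIso_iff.1 hξ).1 (baseIncl _ degZ ω)
    ((hD ω).trans ((congrArg (baseIncl _ degZ) hdω).trans (map_zero _))) 0 (by rw [map_zero]; exact ((hξi ω).trans h0).symm)
  exact ⟨r.toAlgHom c, (r.map_d c).symm.trans ((congrArg _ hc).trans (hr ω))⟩

variable {ι ι' τ : Type} [Fintype ι] [Fintype τ] [DecidableEq ι'] {deg : ι → ℕ} {deg' : ι' → ℕ}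
  {d : Differential deg} {d' : Differential deg'}

/-- If `ρ_k` for `ΛV` has a homotopy retraction and `ΛW` is obtained from `ΛV` by adjoining odd
generators with differentials in `ΛV`, the cocycles of `(ker μ)^(k+1+n)` are exact, with `n` the
number of these generators. -/
theorem exact_of_hasHomotopyRetraction_of_extension {j : ι → ι'} (hj : ∀ i, deg' (j i) = deg i)
    (hji : Function.Injective j) (hd : ∀ a, d'.toLin (rename j hj a) = rename j hj (d.toLin a))
    {u : τ → ι'} (hu : ∀ p, Odd (deg' (u p))) (hui : Function.Injective u)
    (hdis : ∀ i p, j i ≠ u p) (hcov : ∀ i', (∃ i, j i = i') ∨ ∃ p, u p = i')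
    (hdu : ∀ p, ∃ w, d'.toLin (gen deg' (u p)) = rename j hj w) {k : ℕ}
    (h : HasHomotopyRetraction (rho d k)) {ω : FreeCGA (Sum.elim deg' deg')}
    (hω : ω ∈ kerFil deg' (k + Fintype.card τ + 1)) (hdω : (tensorSq d').toLin ω = 0) :
    ∃ c, (tensorSq d').toLin c = ω := by
  classical
  obtain ⟨κ, degZ, D, ⟨hD, -⟩, ⟨ξ, hξ, hξi⟩, r, hr⟩ := h
  set D' := extD hj hd D hD with hD'
  set v : τ ⊕ τ → (ι' ⊕ ι') ⊕ κ := fun p => Sum.inl (Sum.map u u p) with hv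
  have hvo : ∀ p, Odd (Sum.elim (Sum.elim deg' deg') degZ (v p)) := by
    rintro (p | p) <;> exact hu p
  have hvi : Function.Injective v :=
    Sum.inl_injective.comp (Sum.map_injective.2 ⟨hui, hui⟩)
  have hei : Function.Injective (Sum.map (Sum.map j j) id :
      (ι ⊕ ι) ⊕ κ → (ι' ⊕ ι') ⊕ κ) :=
    Sum.map_injective.2 ⟨Sum.map_injective.2 ⟨hji, hji⟩, Function.injective_id⟩
  have hRi : Function.Injective (extMap hj degZ (deg := deg) (deg' := deg')) :=
    rename_injective _ _ hei
  have hdis' : ∀ i p, (Sum.map (Sum.map j j) id i : (ι' ⊕ ι') ⊕ κ) ≠ v p := by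
    rintro ((i | i) | z) (p | p) <;> simp [hv, hdis]
  have hcov' : ∀ i', (∃ i, (Sum.map (Sum.map j j) id i : (ι' ⊕ ι') ⊕ κ) = i') ∨
      ∃ p, v p = i' := by
    rintro ((i | i) | z)
    · rcases hcov i with ⟨i, rfl⟩ | ⟨p, rfl⟩
      · exact Or.inl ⟨Sum.inl (Sum.inl i), rfl⟩
      · exact Or.inr ⟨Sum.inl p, rfl⟩
    · rcases hcov i with ⟨i, rfl⟩ | ⟨p, rfl⟩
      · exact Or.inl ⟨Sum.inl (Sum.inr i), rfl⟩
      · exact Or.inr ⟨Sum.inr p, rfl⟩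
    · exact Or.inl ⟨Sum.inr z, rfl⟩
  have hDv : ∀ p, ∃ w, D'.toLin (gen _ (v p)) = extMap hj degZ w := by
    have key : ∀ i a, (tensorSq d').toLin (gen (Sum.elim deg' deg') i) = sqMap hj a →
        D'.toLin (gen _ (Sum.inl i)) = extMap hj degZ (baseIncl _ degZ a) := by
      intro i a ha
      rw [extMap_baseIncl, ← ha, ← baseIncl_gen]
      exact extD_baseIncl hj hd D hD _
    rintro (p | p) <;> obtain ⟨w, hw⟩ := hdu p
    · exact ⟨_, key (Sum.inl (u p)) (inLeft deg w)
        ((tensorSq_gen_inl d' _).trans (by rw [hw, sqMap_inLeft]))⟩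
    · exact ⟨_, key (Sum.inr (u p)) (inRight deg w)
        ((tensorSq_gen_inr d' _).trans (by rw [hw, sqMap_inRight]))⟩
  have hDi : ∀ i, ∃ w, D'.toLin (gen _ i) = extMap hj degZ w := by
    intro i
    rcases hcov' i with ⟨i, rfl⟩ | ⟨p, rfl⟩
    · refine ⟨D.toLin (gen _ i), ?_⟩
      rw [← extMap_gen hj]
      exact extD_extMap hj hd D hD _
    · exact hDv p
  have hpd : ∀ p w, partialD _ (v p) (hvo p) (extMap hj degZ w) = 0 := by
    intro p w
    refine (isOddDer_partialD _ (v p) (hvo p)).rename_eq_zero _ (extMap_deg hj) (fun i => ?_) w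
    rw [partialD_gen, if_neg (hdis' i p)]
  -- The kernel of the model map is acyclic, since that map is a surjective quasi-isomorphism. Its
  -- image `K`, multiplied by products of the adjoined `u`, `u'`, spans a left ideal `T` of the
  -- extended model that is again acyclic.
  let I : Submodule ℚ (FreeCGA (Sum.elim (Sum.elim deg deg) degZ)) :=
    LinearMap.ker ξ.toAlgHom.toLinearMap
  have hI : ∀ {x}, x ∈ I ↔ ξ.toAlgHom x = 0 := Iff.rfl
  set K := I.map (extMap hj degZ).toLinearMap with hK
  set T := oddExt (Sum.elim (Sum.elim deg' deg') degZ) v K (Finset.univ : Finset (τ ⊕ τ)).toList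
    with hT
  have hKe : ∀ i, ∀ x ∈ K, gen (Sum.elim (Sum.elim deg' deg') degZ) (Sum.map (Sum.map j j) id i) * x
      ∈ K := by
    rintro i _ ⟨x, hx, rfl⟩
    refine ⟨gen _ i * x, ?_, ?_⟩
    · have hx' : ξ.toAlgHom x = 0 := hx
      exact (map_mul ξ.toAlgHom (gen _ i) x).trans
        ((congrArg (ξ.toAlgHom (gen _ i) * ·) hx').trans (mul_zero _))
    · rw [AlgHom.toLinearMap_apply, map_mul, extMap_gen]; rfl
  have hTi : ∀ i, ∀ x ∈ T, gen (Sum.elim (Sum.elim deg' deg') degZ) i * x ∈ T := by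
    intro i
    rcases hcov' i with ⟨i, rfl⟩ | ⟨p, rfl⟩
    · exact gen_mul_mem_oddExt (hKe i) _
    · exact odd_gen_mul_mem_oddExt hvo (Finset.mem_toList.2 (Finset.mem_univ p))
  have hsurj : Function.Surjective ξ.toAlgHom := by
    intro b
    obtain ⟨a, rfl⟩ := Ideal.Quotient.mk_surjective b
    exact ⟨_, hξi a⟩
  -- Up to left multiples, the cocycle is a sum of images of elements of `(ker μ)^(k+1)` over `ΛV`,
  -- which the model map kills.
  have hmem : baseIncl _ degZ ω ∈ T := by
    have hω' := kerFil_le_top_mul_map hj hu hcov k hω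
    refine Submodule.mul_induction_on hω' ?_ ?_
    · rintro t - _ ⟨y, hy, rfl⟩
      rw [map_mul]
      refine mul_mem_of_gen_mul_mem hTi _ (le_oddExt v K _ ⟨baseIncl _ degZ y, ?_, ?_⟩)
      · exact (hξi y).trans
          (Ideal.Quotient.eq_zero_iff_mem.2 (mem_kerPow_of_mem_kerFil d hy))
      · exact extMap_baseIncl hj y
    · intro a b ha hb
      rw [map_add]
      exact Submodule.add_mem _ ha hb
  have hac : ∀ a ∈ K, D'.toLin a = 0 → ∃ b ∈ K, D'.toLin b = a := by
    rintro _ ⟨a, ha, rfl⟩ hda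
    have hda' : D.toLin a = 0 := by
      have h := (extD_extMap hj hd D hD a).symm.trans hda
      rwa [map_eq_zero_iff _ hRi] at h
    obtain ⟨b, hb, hdb⟩ := exists_of_quasiIso hξ hsurj ha hda'
    exact ⟨_, ⟨b, hb, rfl⟩, (extD_extMap hj hd D hD b).trans (congrArg _ hdb)⟩
  obtain ⟨c, -, hc⟩ := oddExt_acyclic (e := Sum.map (Sum.map j j) id) (he := extMap_deg hj)
    (D := D') hvo hvi
    (by rintro p _ ⟨x, -, rfl⟩; exact hpd p x)
    (by intro p i; obtain ⟨w, hw⟩ := hDi i; rw [hw]; exact hpd p w) hKe hDv hac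
    (Finset.nodup_toList _) hmem
    ((extD_baseIncl hj hd D hD ω).trans (by rw [hdω, map_zero]))
  have hrg : ∀ z, r.toAlgHom (gen (Sum.elim (Sum.elim deg deg) degZ) (Sum.inr z)) ∈
      homog (Sum.elim deg deg) (degZ z) := fun z => r.map_gr (gen_mem _ (Sum.inr z))
  refine ⟨extRetraction hj r.toAlgHom hrg c, ?_⟩
  rw [← extRetraction_extD hj hd D hD r.toAlgHom hrg hr r.map_d]
  exact (congrArg _ hc).trans (extRetraction_baseIncl hj r.toAlgHom hrg ω)

end Exactness

end RatTC

namespace RatTC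

open FreeCGA

/-! ### Lower bounds for `TC` from non-exact cocycles. -/

section LowerBound

theorem kerFil_antitone {ι : Type} (deg : ι → ℕ) : Antitone (kerFil deg) := by
  refine antitone_nat_of_succ_le fun k => ?_
  calc kerFil deg (k + 1) = kerFil deg k * kerMul deg := kerFil_succ deg k
    _ ≤ kerFil deg k * kerFil deg 0 := mul_le_mul' le_rfl (by rw [kerFil_zero]; exact le_top)
    _ = kerFil deg k := kerFil_mul deg k 0

theorem le_TC {ι : Type} {deg : ι → ℕ} {d : Differential deg} {N : ℕ}
    (h : ∀ k, HasHomotopyRetraction (rho d k) → N ≤ k) : (N : ℕ∞) ≤ TC d := by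
  refine le_sInf ?_
  rintro _ ⟨k, hk, rfl⟩
  exact_mod_cast h k hk

/-- The witness contracts the product over all odd generators: `|E| + |F|` factors `y_o y'_o`, and a
further `|E|` from the contractions. -/
theorem exists_cocycle_not_exact {E F : Type} [Fintype E] [Fintype F] [DecidableEq E]
    [DecidableEq F] {deg : E ⊕ (E ⊕ F) → ℕ} {B : E ⊕ F → E → E → ℚ} {d : Differential deg}
    (hd : IsPureQuadratic d B) (hB : ∀ e i k, B (Sum.inl e) i k = if i = e ∧ k = e then 1 else 0)
    {N : ℕ} (hN : N ≤ 2 * Fintype.card E + Fintype.card F) :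
    ∃ ω ∈ kerFil deg N, (tensorSq d).toLin ω = 0 ∧ ∀ c, (tensorSq d).toLin c ≠ ω := by
  refine ⟨topClass hd.odd B (oddList E F), ?_, tensorSq_topClass hd _, topClass_not_exact hd hB⟩
  refine kerFil_antitone deg ?_ (topClass_mem hd.odd B (oddList E F))
  have h : (oddList E F).length = Fintype.card E + Fintype.card F := by simp [oddList]; ring
  omega

end LowerBound

/-! ### The elliptic extension and the values of `TC`. -/

section MainResults

/-- Commutation of the `x_i` allows each monomial to be split into two halves, which symmetrises its
coefficient matrix; the polarisation identity needs this symmetry. -/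
theorem exists_symm_of_mem_quadratic {A : Type} [Ring A] [Algebra ℚ A] {n : ℕ} {x : Fin n → A}
    (hx : ∀ i k, x i * x k = x k * x i) {q : A} (hq : q ∈ quadratic x Set.univ) :
    ∃ β : Fin n → Fin n → ℚ, (∀ i k, β i k = β k i) ∧ q = ∑ i, ∑ k, β i k • (x i * x k) := by
  induction hq using Submodule.span_induction with
  | zero => exact ⟨0, fun _ _ => rfl, by simp⟩
  | add y z _ _ hy hz =>
    obtain ⟨β, hβ, rfl⟩ := hy
    obtain ⟨γ, hγ, rfl⟩ := hz
    exact ⟨β + γ, fun i k => congrArg₂ (· + ·) (hβ i k) (hγ i k), by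
      simp [add_smul, Finset.sum_add_distrib]⟩
  | smul c y _ hy =>
    obtain ⟨β, hβ, rfl⟩ := hy
    exact ⟨c • β, fun i k => congrArg (c * ·) (hβ i k), by simp [mul_smul, Finset.smul_sum]⟩
  | mem y hy =>
    obtain ⟨p, -, q, -, rfl⟩ := hy
    have key : ∀ p q : Fin n, ∑ i, ∑ k, (if i = p ∧ k = q then (1 / 2 : ℚ) else 0) • (x i * x k) =
        (1 / 2 : ℚ) • (x p * x q) := by
      intro p q
      rw [Finset.sum_eq_single p, Finset.sum_eq_single q]
      · simp
      · intro k _ hk; simp [hk]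
      · simp
      · intro i _ hi; simp [hi]
      · simp
    refine ⟨fun i k => (if i = p ∧ k = q then 1 / 2 else 0) + (if i = q ∧ k = p then 1 / 2 else 0),
      fun i k => ?_, ?_⟩
    · simp only [add_comm, and_comm]
    · simp only [add_smul, Finset.sum_add_distrib]
      rw [key, key, hx q p, ← add_smul]
      norm_num

variable {n m : ℕ} {a : Fin n → ℕ} {b : Fin m → ℕ}

theorem IsExtension.exists_isPureQuadratic {d : Differential (degW a b)} (h : IsExtension a b d) :
    ∃ B : Fin n ⊕ Fin m → Fin n → Fin n → ℚ, IsPureQuadratic d B ∧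
      ∀ e i k, B (Sum.inl e) i k = if i = e ∧ k = e then 1 else 0 := by
  have hcomm : ∀ i k, W.x a b i * W.x a b k = W.x a b k * W.x a b i := fun i k =>
    (isScalar_gen (deg := degW a b) (i := Sum.inl i) (h.even i)).comm _
  choose β hβ hβ' using fun j => exists_symm_of_mem_quadratic hcomm (h.dy j)
  refine ⟨Sum.elim (fun e i k => if i = e ∧ k = e then 1 else 0) β, ⟨?_, h.even, ?_, ?_, h.dx, ?_⟩,
    fun _ _ _ => rfl⟩
  · rintro (i | i | j)
    · exact h.pos i
    · have := h.pos i
      change 0 < 2 * a i - 1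
      omega
    · exact (h.odd j).pos
  · rintro (i | j)
    · have := h.pos i
      change Odd (2 * a i - 1)
      exact ⟨a i - 1, by omega⟩
    · exact h.odd j
  · rintro (e | j) i k
    · simp only [Sum.elim_inl, and_comm]
    · exact hβ j i k
  · rintro (e | j)
    · refine (h.du e).trans ?_
      rw [Finset.sum_eq_single e, Finset.sum_eq_single e]
      · simp [pow_two, W.x]
      · intro k _ hk; simp [hk]
      · simp
      · intro i _ hi; simp [hi]
      · simp
    · exact hβ' j

/-- `TC(ΛW) = dim W`. -/
theorem IsExtension.TC_eq {d : Differential (degW a b)} (h : IsExtension a b d) :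
    TC d = ((2 * n + m : ℕ) : ℕ∞) := by
  obtain ⟨B, hd, hB⟩ := h.exists_isPureQuadratic
  refine le_antisymm (sInf_le ⟨2 * n + m, ?_, rfl⟩) (le_TC fun k hk => ?_)
  · have := hasHomotopyRetraction_rho hd hB
    rwa [Fintype.card_fin, Fintype.card_fin] at this
  · by_contra hlt
    -- `k < 2n + m` leaves room for a non-exact cocycle in `(ker μ)^(k+1)`.
    obtain ⟨ω, hω, hdω, hne⟩ := exists_cocycle_not_exact hd hB (N := k + 1) (by
      rw [Fintype.card_fin, Fintype.card_fin]; omega)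
    obtain ⟨c, hc⟩ := exact_of_hasHomotopyRetraction hk hω hdω
    exact hne c hc

theorem degW_map (i : Fin n ⊕ Fin m) : degW a b (Sum.map id Sum.inr i) = degV a b i := by
  rcases i with i | j <;> rfl

/-- The values on generators of the differential of the elliptic extension. -/
noncomputable def extensionGen (d : Differential (degV a b)) :
    Fin n ⊕ (Fin n ⊕ Fin m) → FreeCGA (degW a b) :=
  Sum.elim 0 (Sum.elim (fun i => W.x a b i ^ 2)
    (fun j => rename (Sum.map id Sum.inr) degW_map (d.toLin (V.y a b j))))

namespace IsPureCoformal

variable {d : Differential (degV a b)} (h : IsPureCoformal a b d)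

include h in
theorem extensionGen_mem (i : Fin n ⊕ (Fin n ⊕ Fin m)) :
    extensionGen d i ∈ homog (degW a b) (degW a b i + 1) := by
  rcases i with i | i | j
  · exact Submodule.zero_mem _
  · have h2 := FreeCGA.mul_mem (degW a b) (gen_mem (degW a b) (Sum.inl i))
      (gen_mem (degW a b) (Sum.inl i))
    have hpos := h.pos i
    have e : degW a b (Sum.inr (Sum.inl i)) + 1 = degW a b (Sum.inl i) + degW a b (Sum.inl i) := by
      change 2 * a i - 1 + 1 = a i + a i
      omega
    rw [e]
    change W.x a b i ^ 2 ∈ _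
    rw [pow_two]
    exact h2
  · exact rename_mem _ degW_map (d.mem (gen_mem _ (Sum.inr j)))

theorem derivation_rename (x : FreeCGA (degV a b)) :
    derivation _ (extensionGen d) h.extensionGen_mem (rename (Sum.map id Sum.inr) degW_map x) =
      rename (Sum.map id Sum.inr) degW_map (d.toLin x) := by
  refine Differential.rename_comm _ degW_map d (derivation _ (extensionGen d) h.extensionGen_mem)
    (derivation_one _ _ _) (derivation_leibniz _ _ _) ?_ x
  rintro (i | j)
  · refine (derivation_gen _ _ h.extensionGen_mem (Sum.inl i)).trans ?_
    exact ((congrArg _ (h.dx i)).trans (map_zero _)).symm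
  · exact derivation_gen _ _ h.extensionGen_mem (Sum.inr (Sum.inr j))

/-- The differential of the elliptic extension of a pure coformal model. -/
noncomputable def extensionD : Differential (degW a b) :=
  Differential.ofGen _ (extensionGen d) h.extensionGen_mem (by
    have hx : ∀ i, derivation _ (extensionGen d) h.extensionGen_mem (W.x a b i) = 0 := fun i =>
      derivation_gen _ _ h.extensionGen_mem (Sum.inl i)
    rintro (i | i | j)
    · exact map_zero _
    · change derivation _ (extensionGen d) h.extensionGen_mem (W.x a b i ^ 2) = 0
      rw [pow_two, derivation_leibniz _ _ _ _ (show W.x a b i ∈ homog _ _ from gen_mem _ (Sum.inl i)),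
        hx]
      simp
    · exact (h.derivation_rename _).trans ((congrArg _ (d.sq _)).trans (map_zero _)))

theorem isExtension : IsExtension a b h.extensionD where
  pos := h.pos
  even := h.even
  odd := h.odd
  dx i := derivation_gen _ _ h.extensionGen_mem (Sum.inl i)
  du i := derivation_gen _ _ h.extensionGen_mem (Sum.inr (Sum.inl i))
  dy j := by
    have e : h.extensionD.toLin (W.y a b j) =
        rename (Sum.map id Sum.inr) degW_map (d.toLin (V.y a b j)) :=
      derivation_gen _ _ h.extensionGen_mem (Sum.inr (Sum.inr j))
    rw [e]
    have hx : ∀ i, rename (Sum.map id Sum.inr) degW_map (V.x a b i) = W.x a b i := fun i =>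
      rename_gen _ _ _
    generalize d.toLin (V.y a b j) = q, h.dy j = hq
    induction hq using Submodule.span_induction with
    | zero => rw [map_zero]; exact Submodule.zero_mem _
    | add y z _ _ hy hz => rw [map_add]; exact Submodule.add_mem _ hy hz
    | smul c y _ hy => rw [map_smul]; exact Submodule.smul_mem _ _ hy
    | mem y hy =>
      obtain ⟨i, -, k, -, rfl⟩ := hy
      rw [map_mul, hx, hx]
      exact Submodule.subset_span ⟨i, trivial, k, trivial, rfl⟩

include h in
/-- `TC(ΛV) ≥ dim V`. -/
theorem le_TC : ((n + m : ℕ) : ℕ∞) ≤ TC d := by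
  refine RatTC.le_TC fun k hk => ?_
  by_contra hlt
  obtain ⟨B, hd, hB⟩ := h.isExtension.exists_isPureQuadratic
  -- The `n` adjoined `u_i` shift the exponent by `n`, and `k + n + 1 ≤ 2n + m` is the assumption `k
  -- < n + m`.
  obtain ⟨ω, hω, hdω, hne⟩ := exists_cocycle_not_exact hd hB (N := k + n + 1) (by
    rw [Fintype.card_fin, Fintype.card_fin]; omega)
  obtain ⟨c, hc⟩ := exact_of_hasHomotopyRetraction_of_extension (j := Sum.map id Sum.inr)
    degW_map (Sum.map_injective.2 ⟨Function.injective_id, Sum.inr_injective⟩) h.derivation_rename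
    (u := fun i : Fin n => Sum.inr (Sum.inl i)) (fun i => hd.odd (Sum.inl i))
    (Sum.inr_injective.comp Sum.inl_injective) (by rintro (i | j) p <;> simp)
    (by
      rintro (i | i | j)
      · exact Or.inl ⟨Sum.inl i, rfl⟩
      · exact Or.inr ⟨i, rfl⟩
      · exact Or.inl ⟨Sum.inr j, rfl⟩)
    (fun i => ⟨V.x a b i ^ 2, (h.isExtension.du i).trans (by
      rw [map_pow]
      exact congrArg (· ^ 2) (rename_gen _ degW_map (Sum.inl i)).symm)⟩)
    hk (by rwa [Fintype.card_fin]) hdω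
  exact hne c hc

end IsPureCoformal

end MainResults

end RatTC

theorem mainTheorem7 :
    -- the equality `TC(ΛW) = dim W = 2n + m`
    (∀ (n m : ℕ) (hn : 0 < n) (hm : 1 < m) (a : Fin n → ℕ) (b : Fin m → ℕ)
      (d : RatTC.Differential (RatTC.degW a b)), RatTC.IsExtension a b d → RatTC.IsSpecial hn hm a b d →
      RatTC.TC d = ((2 * n + m : ℕ) : ℕ∞)) ∧
    -- the case `n = 2`
    (∀ (m : ℕ) (_ : 1 < m) (a : Fin 2 → ℕ) (b : Fin m → ℕ) (d : RatTC.Differential (RatTC.degW a b)),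
      RatTC.IsExtension a b d → RatTC.TC d = ((m + 4 : ℕ) : ℕ∞)) ∧
    -- the case `n = 3`
    (∀ (m : ℕ) (_ : 1 < m) (a : Fin 3 → ℕ) (b : Fin m → ℕ) (d : RatTC.Differential (RatTC.degW a b)),
      RatTC.IsExtension a b d →
      (∃ w ∈ Submodule.span ℚ (Set.range (RatTC.W.u a b) ∪ Set.range (RatTC.W.y a b)), ∃ c : ℚ, c ≠ 0 ∧
        d.toLin w = c • (RatTC.W.x a b 0 * RatTC.W.x a b 1)) →
      RatTC.TC d = ((m + 6 : ℕ) : ℕ∞)) ∧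
    -- elliptic pure coformal models with `n = 2`, `m > 2`
    (∀ (m : ℕ) (_ : 2 < m) (a : Fin 2 → ℕ) (b : Fin m → ℕ) (d : RatTC.Differential (RatTC.degV a b)),
      RatTC.IsPureCoformal a b d → RatTC.IsElliptic d → ((2 + m : ℕ) : ℕ∞) ≤ RatTC.TC d) ∧
    -- elliptic pure coformal models with `n = 3`, `m > 3`
    (∀ (m : ℕ) (_ : 3 < m) (a : Fin 3 → ℕ) (b : Fin m → ℕ) (d : RatTC.Differential (RatTC.degV a b)),
      RatTC.IsPureCoformal a b d → RatTC.IsElliptic d →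
      (∃ w ∈ Submodule.span ℚ (Set.range (RatTC.V.y a b)), ∃ α β γ : ℚ, β ≠ 0 ∧
        d.toLin w = α • RatTC.V.x a b 0 ^ 2 + β • (RatTC.V.x a b 0 * RatTC.V.x a b 1) + γ • RatTC.V.x a b 1 ^ 2) →
      ((3 + m : ℕ) : ℕ∞) ≤ RatTC.TC d) := by
  refine ⟨fun n m _ _ a b d h _ => h.TC_eq, fun m _ a b d h => ?_, fun m _ a b d h _ => ?_,
    fun m _ a b d h _ => h.le_TC, fun m _ a b d h _ _ => h.le_TC⟩
  · rw [h.TC_eq, add_comm]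
  · rw [h.TC_eq, add_comm]
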